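/- **Differential privacy.** A randomized algorithm $A:\mathbb R^n\to\mathcal Y$ is $(\varepsilon,\delta)$-DP if $\Pr[A(x)\in Y]\le e^{\varepsilon}\Pr[A(x')\in Y]+\delta$ for all $x,x'\in\mathbb R^n$ that differ in exactly one coordinate and all measurable $Y$. **Notation.** $\mathrm{Lap}(b)$ is the Laplace distribution with density $\frac1{2b}e^{-|x|/b}$; $\mathrm{clip}_{[a,b]}(x)=\max(a,\min(b,x))$; $\mathrm{round}(y)$ is the integer $k$ with $k-\frac12\le y<k+\frac12$. A distribution $P$ on $\mathbb R$ is symmetric with center $\mu(P)$ if $X-\mu(P)$ and $\mu(P)-X$ have the same distribution for $X\sim P$. **Coarse estimator** $\mathrm{coarse}_{\varepsilon,\delta}(x_1,\dots,x_{n_1})\in\mathbb R\cup\{\bot\}$. Draw $T$ uniformly from $[-\frac12,\frac12]$; let $K=\{\mathrm{round}(x_i-T):i\le n_1\}$; for $k\in K$ let $N_k=|\{i:\mathrm{round}(x_i-T)=k\}|+\xi_k$ with independent $\xi_k\sim\mathrm{Lap}(2/\varepsilon)$. If $\max_{k\in K}N_k\le 2+\frac{2\log(1/\delta)}{\varepsilon}$,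 output $\bot$; otherwise output $T+\arg\max_{k\in K}N_k$. **Algorithm** $\mathrm{fine}_{\varepsilon,\delta,c,\sigma,n_1,n_2}(x_1,\dots,x_{n_1+n_2})$. Let $\tilde\mu=\sigma\cdot\mathrm{coarse}_{\varepsilon,\delta}(x_1/\sigma,\dots,x_{n_1}/\sigma)$ (with $\sigma\cdot\bot=\bot$). If $\tilde\mu=\bot$, draw independent $b_i\sim\mathrm{Bernoulli}(\delta)$ and output $\hat\mu=\frac1{n_2\delta}\sum_{i=1}^{n_2}x_{n_1+i}b_i$; otherwise output $\hat\mu=\frac1{n_2}\sum_{i=1}^{n_2}\mathrm{clip}_{[\tilde\mu-c,\tilde\mu+c]}(x_{n_1+i})+\mathrm{Lap}\left(\frac{2c}{n_2\varepsilon}\right)$. All random choices are independent of each other and of the data. **Theorem.** For every $\kappa>0$ there is a constant $C>0$, depending only on $\kappa$, with the following properties. Let $\varepsilon,\delta\in(0,1)$, $n_2\ge1$, $\psi\ge1$, $\lambda\ge2$, $\gamma=\delta^2$, $\sigma=10$, $c=\sigma+\psi\,(n_2\varepsilon)^{1/\lambda}$, and let $n_1$ satisfy $$n_1\ \ge\ \max\left\{7+\tfrac7\varepsilon\log(1/\delta),\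 128\log(2/\gamma),\ \tfrac{16}\varepsilon\log(n_1/\gamma)\right\};$$ for all $\varepsilon,\delta\in(0,1)$ there is such an $n_1$ with $n_1\le C\log(n_1/(\gamma\delta))/\varepsilon$. Then $\mathrm{fine}_{\varepsilon,\delta,c,\sigma,n_1,n_2}$ is $(\varepsilon,\delta)$-DP. Moreover, let $P$ be a symmetric distribution with center $\mu(P)$, $\mathbb E_{X\sim P}[(X-\mu(P))^2]\le1$ and $\mathbb E_{X\sim P}[|X-\mu(P)|^\lambda]\le\psi^\lambda$, let $X_1,\dots,X_{n_1+n_2}$ be independent samples from $P$, and let $\tilde\mu,\hat\mu$ be as in the algorithm run on $X$. Then $\hat\mu$ has a finite second moment (also conditionally on $\tilde\mu\ne\bot$), and $$\mathbb E[\hat\mu]=\mu(P),\qquad \Pr[\tilde\mu\ne\bot]\ge1-\delta^2,\qquad \mathbb E[\hat\mu\mid\tilde\mu\ne\bot]=\mathbb E[\tilde\mu\mid\tilde\mu\ne\bot]=\mu(P);$$ and if $n_2\varepsilon\ge\kappa$, then $$\mathbb E[(\hat\mu-\mu(P))^2]\le\frac1{n_2}+C\left(\frac{\psi^2}{(n_2\varepsilon)^{2-2/\lambda}}+\delta\,\frac{\mu(P)^2}{n_2}+\delta^{2-4/\lambda}(n_1+n_2\varepsilon)^{2/\lambda}\psi^2\right),$$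 $$\mathbb E[(\hat\mu-\mu(P))^2\mid\tilde\mu\ne\bot]\le\frac1{n_2}+C\left(\frac{\psi^2}{(n_2\varepsilon)^{2-2/\lambda}}+\delta^{2-4/\lambda}(n_1+n_2\varepsilon)^{2/(\lambda-1)}\psi^2\right).$$ -/

import Mathlib

open MeasureTheory ProbabilityTheory

namespace UnbiasedDP

/-- A randomized algorithm on datasets of size `n` is given by a source of randomness
`(Ω, ν)` and a map `A` taking the dataset and the random outcome to the output.
It is `(ε, δ)`-differentially private if the output distributions on any two datasets at
Hamming distance one are `(ε, δ)`-close. -/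
def IsDP {α β Ω : Type*} [DecidableEq α] [MeasurableSpace β] [MeasurableSpace Ω] {n : ℕ}
    (ν : Measure Ω) (A : (Fin n → α) → Ω → β) (ε δ : ℝ) : Prop :=
  ∀ x x' : Fin n → α, hammingDist x x' = 1 → ∀ Y : Set β, MeasurableSet Y →
    ν {ω | A x ω ∈ Y} ≤
      ENNReal.ofReal (Real.exp ε) * ν {ω | A x' ω ∈ Y} + ENNReal.ofReal δ

/-- `P` is symmetric with center `m`: `X - m` and `m - X` have the same distribution function
when `X` has law `P`. -/
def IsSymmetricAbout (P : Measure ℝ) (m : ℝ) : Prop :=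
  ∀ t : ℝ, P {x | x - m ≤ t} = P {x | m - x ≤ t}

/-- The Laplace distribution with location `0` and scale `b > 0`. -/
noncomputable def laplaceMeasure (b : ℝ) : Measure ℝ :=
  volume.withDensity fun x => ENNReal.ofReal (Real.exp (-|x| / b) / (2 * b))

theorem isProbabilityMeasure_laplaceMeasure {b : ℝ} (hb : 0 < b) :
    IsProbabilityMeasure (laplaceMeasure b) := by
  have hI : IntegrableOn (fun x : ℝ => Real.exp ((-1 / b) * x)) (Set.Ioi 0) :=
    integrableOn_exp_mul_Ioi (by rw [neg_div]; exact neg_lt_zero.2 (by positivity)) 0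
  have hval : ∫ x : ℝ, Real.exp (-|x| / b) / (2 * b) = 1 := by
    have h1 := integral_comp_abs (f := fun x : ℝ => Real.exp ((-1 / b) * x))
    rw [integral_exp_mul_Ioi (by rw [neg_div]; exact neg_lt_zero.2 (by positivity)) 0] at h1
    have h2 : ∀ x : ℝ, Real.exp (-|x| / b) = Real.exp ((-1 / b) * |x|) := by
      intro x; congr 1; ring
    simp_rw [h2]
    rw [integral_div, h1]
    simp only [mul_zero, Real.exp_zero]
    field_simp
  have hint : Integrable (fun x : ℝ => Real.exp (-|x| / b) / (2 * b)) := by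
    by_contra h
    rw [integral_undef h] at hval
    exact zero_ne_one hval
  constructor
  rw [laplaceMeasure, withDensity_apply _ MeasurableSet.univ, Measure.restrict_univ,
    ← ofReal_integral_eq_lintegral_ofReal hint (Filter.Eventually.of_forall fun x => by positivity),
    hval, ENNReal.ofReal_one]

/-- The uniform distribution on `[-1/2, 1/2]`. -/
noncomputable def offsetMeasure : Measure ℝ :=
  volume.restrict (Set.Icc (-1 / 2) (1 / 2))

/-- `clip a b x` projects `x` to the interval `[a, b]`. -/
noncomputable def clip (a b x : ℝ) : ℝ := max a (min b x)

/-- The set `K` of nonempty buckets of the histogram with offset `T`.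
Here `round y` is the integer `k` with `k - 1/2 ≤ y < k + 1/2`. -/
noncomputable def buckets {n : ℕ} (x : Fin n → ℝ) (T : ℝ) : Finset ℤ :=
  Finset.univ.image fun i => round (x i - T)

/-- The noisy count of bucket `k`: the number of data points in it plus the noise `ξ k`. -/
noncomputable def noisyCount {n : ℕ} (x : Fin n → ℝ) (T : ℝ) (ξ : ℤ → ℝ) (k : ℤ) : ℝ :=
  ((Finset.univ.filter fun i => round (x i - T) = k).card : ℝ) + ξ k

/-- The elements of `K` at which `v` attains its maximum over `K`. -/
noncomputable def maximizers (K : Finset ℤ) (v : ℤ → ℝ) : Finset ℤ :=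
  K.filter fun k => ∀ j ∈ K, v j ≤ v k

/-- An argmax of `v` over `K`, the smallest one in case of ties (and `0` if `K` is empty). -/
noncomputable def argmaxOn (K : Finset ℤ) (v : ℤ → ℝ) : ℤ :=
  if h : (maximizers K v).Nonempty then (maximizers K v).min' h else 0

/-- The coarse estimator on the data `x`, run with offset `T` and bucket noises `ξ`;
`none` stands for the failure symbol. -/
noncomputable def coarse (ε δ : ℝ) {n : ℕ} (x : Fin n → ℝ) (T : ℝ) (ξ : ℤ → ℝ) : Option ℝ :=
  open Classical in
  if ∀ k ∈ buckets x T, noisyCount x T ξ k ≤ 2 + 2 * Real.log (1 / δ) / ε then none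
  else some (T + argmaxOn (buckets x T) (noisyCount x T ξ))

/-- The random choices of the algorithm: the offset, the bucket noises (one for each integer,
only those of the nonempty buckets being used), the `n₂` Bernoulli bits, and the final noise. -/
abbrev Noise (n₂ : ℕ) : Type := ℝ × (ℤ → ℝ) × (Fin n₂ → ℝ) × ℝ

/-- The joint law of the independent random choices: offset uniform on `[-1/2, 1/2]`,
bucket noises `Lap(2 / ε)`, bits `Bernoulli(δ)` with values in `{0, 1} ⊆ ℝ`, and
final noise `Lap(2 c / (n₂ ε))`. -/
noncomputable def noiseLaw (ε δ c : ℝ) (n₂ : ℕ) : Measure (Noise n₂) :=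
  offsetMeasure.prod
    ((Measure.infinitePi fun _ : ℤ => laplaceMeasure (2 / ε)).prod
      ((Measure.pi fun _ : Fin n₂ =>
          bernoulliMeasure (1 : ℝ) 0 (Set.projIcc 0 1 zero_le_one δ)).prod
        (laplaceMeasure (2 * c / (n₂ * ε)))))

/-- The value `σ · coarse(x₁/σ, …, x_{n₁}/σ)` computed in the first step. -/
noncomputable def coarseStep (ε δ σ : ℝ) {n₁ n₂ : ℕ} (x : Fin (n₁ + n₂) → ℝ)
    (ω : Noise n₂) : Option ℝ :=
  (coarse ε δ (fun i : Fin n₁ => x (Fin.castAdd n₂ i) / σ) ω.1 ω.2.1).map fun t => σ * t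

/-- The full algorithm: a clipped noisy mean of the last `n₂` points around the coarse
estimate, or name-and-shame on these points if the coarse step fails. -/
noncomputable def fine (ε δ c σ : ℝ) (n₁ n₂ : ℕ) (x : Fin (n₁ + n₂) → ℝ) (ω : Noise n₂) : ℝ :=
  match coarseStep ε δ σ x ω with
  | none => 1 / (n₂ * δ) * ∑ i : Fin n₂, x (Fin.natAdd n₁ i) * ω.2.2.1 i
  | some t => 1 / n₂ * (∑ i : Fin n₂, clip (t - c) (t + c) (x (Fin.natAdd n₁ i))) + ω.2.2.2

/-- The joint law of the `n₁ + n₂` independent samples from `P` and of the random choices of the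
algorithm. -/
noncomputable def jointLaw (P : Measure ℝ) (ε δ c : ℝ) (n₁ n₂ : ℕ) :
    Measure ((Fin (n₁ + n₂) → ℝ) × Noise n₂) :=
  (Measure.pi fun _ : Fin (n₁ + n₂) => P).prod (noiseLaw ε δ c n₂)

/-- The event that the coarse step does not fail. -/
def coarseSucceeds (ε δ σ : ℝ) (n₁ n₂ : ℕ) : Set ((Fin (n₁ + n₂) → ℝ) × Noise n₂) :=
  {z | coarseStep ε δ σ z.1 z.2 ≠ none}

/-- The requirement on the number of points used by the coarse step. -/
def LargeEnough (ε δ γ : ℝ) (n₁ : ℕ) : Prop :=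
  7 + 7 / ε * Real.log (1 / δ) ≤ n₁ ∧
  128 * Real.log (2 / γ) ≤ n₁ ∧
  16 / ε * Real.log (n₁ / γ) ≤ n₁

end UnbiasedDP

open UnbiasedDP

namespace UnbiasedDP

/-! ### The Laplace distribution -/

section Laplace

variable {b : ℝ}

/-! Privacy. Fix the offset. Replacing one of the first n₁ points moves one unit of the histogram
between two buckets, and with noise Lap(2/ε) each of the two unit changes costs a factor e^{ε/2}.
The set of nonempty buckets may change as well, which is what the threshold pays for: an empty
bucket allowed to compete would exceed it with probability at most e^{-ε}δ/2. Both runs can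
therefore be compared over the union of their buckets (`pick_dp`), and the remainder is
post-processing. Replacing one of the last n₂ points does not affect the coarse step. After a
failure the output changes only if the bit of that point is nonzero (`nameAndShame_dp`); after a
success the clipped sum moves by at most 2c, which the Laplace noise hides (`clippedMean_dp`).

Unbiasedness. The reflection x ↦ 2m − x preserves the law of the data and carries the buckets with
offset T to those with offset 2m/σ − T. The law of the selected value depends on the offset only
modulo 1, and the uniform law on the circle is invariant under reflections. Hence the coarse
estimate, restricted to success, is symmetric about m (`coarseLaw_hit_reflect`); ties and points on
bucket boundaries are null. The bias caused by clipping around t is odd in t − m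
(`clipBias_reflect`), so it averages to zero although it need not vanish for a given t.
Name-and-shame is unbiased, and its inputs are independent of the failure event.

Error. By Chebyshev and Hoeffding more than 83.5% of the coarse sample lies within 5 of m, hence in
two adjacent buckets of width 10; the noise is too small to let a bucket without such points win, so
the estimate is within 10 of m outside an event of probability 9γ/16 (`coarse_accuracy`). Given the
estimate t, the error splits into a variance of at most 1/n₂ (clipping is 1-Lipschitz), the Laplace
variance and the squared bias. If t is within 10 of m, the window contains all points at distance at
most ψ(n₂ε)^{1/λ} from m and the λ-th moment bounds the bias. If not, the bias is at most 2|t − m|;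
since t is always near some sample point, its second moment on this rare event is controlled by the
λ-th moments of the sample (`setIntegral_far_le'`). Failure has probability at most δ² while
name-and-shame has variance at most (1 + m²)/(n₂δ), which leaves δ(1 + m²)/n₂. -/

theorem measurable_laplace_density (b : ℝ) :
    Measurable fun x : ℝ => ENNReal.ofReal (Real.exp (-|x| / b) / (2 * b)) := by
  fun_prop

theorem laplaceMeasure_apply (b : ℝ) {B : Set ℝ} (hB : MeasurableSet B) :
    laplaceMeasure b B = ∫⁻ x, B.indicator
      (fun x => ENNReal.ofReal (Real.exp (-|x| / b) / (2 * b))) x := by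
  rw [laplaceMeasure, withDensity_apply _ hB, lintegral_indicator hB]

instance nullSingletonClass_laplaceMeasure (b : ℝ) : NullSingletonClass (laplaceMeasure b) := by
  constructor
  intro x
  exact withDensity_absolutelyContinuous _ _ (measure_singleton x)

/-- The Laplace mechanism: by the triangle inequality the densities at x − s and x differ by a
factor of at most e^{|s|/b}. -/
theorem laplaceMeasure_shift_le (hb : 0 < b) (s : ℝ) {B : Set ℝ} (hB : MeasurableSet B) :
    laplaceMeasure b {r | r + s ∈ B} ≤
      ENNReal.ofReal (Real.exp (|s| / b)) * laplaceMeasure b B := by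
  have hB' : MeasurableSet {r : ℝ | r + s ∈ B} := (measurable_id.add_const s) hB
  rw [laplaceMeasure_apply b hB', laplaceMeasure_apply b hB,
    ← lintegral_sub_right_eq_self _ s, ← lintegral_const_mul _
      ((measurable_laplace_density b).indicator hB)]
  refine lintegral_mono fun x => ?_
  by_cases hx : x ∈ B
  · rw [Set.indicator_of_mem (by simpa using hx), Set.indicator_of_mem hx,
      ← ENNReal.ofReal_mul (Real.exp_pos _).le]
    refine ENNReal.ofReal_le_ofReal ?_
    rw [← mul_div_assoc, ← Real.exp_add, ← add_div]
    gcongr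
    have := abs_sub_abs_le_abs_sub x (x - s)
    have h2 : x - (x - s) = s := by ring
    rw [h2] at this
    linarith
  · rw [Set.indicator_of_notMem (by simpa using hx)]
    exact zero_le

theorem map_neg_laplaceMeasure (b : ℝ) : (laplaceMeasure b).map (fun x => -x) = laplaceMeasure b := by
  ext B hB
  rw [Measure.map_apply measurable_neg hB, laplaceMeasure_apply b hB,
    laplaceMeasure_apply b (measurable_neg hB), ← lintegral_neg_eq_self]
  refine lintegral_congr fun x => ?_
  by_cases hx : x ∈ B
  · rw [Set.indicator_of_mem (by simpa using hx), Set.indicator_of_mem hx, abs_neg]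
  · rw [Set.indicator_of_notMem (by simpa using hx), Set.indicator_of_notMem hx]

theorem laplaceMeasure_Ioi_le (hb : 0 < b) {t : ℝ} (ht : 0 ≤ t) :
    laplaceMeasure b (Set.Ioi t) ≤ ENNReal.ofReal (Real.exp (-t / b) / 2) := by
  have hb' : -1 / b < 0 := by rw [neg_div]; exact neg_lt_zero.2 (by positivity)
  have hI := (integrableOn_exp_mul_Ioi hb' t).div_const (2 * b)
  rw [laplaceMeasure, withDensity_apply _ measurableSet_Ioi]
  calc _ = ∫⁻ x in Set.Ioi t, ENNReal.ofReal (Real.exp (-1 / b * x) / (2 * b)) := by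
        refine setLIntegral_congr_fun measurableSet_Ioi fun x hx => ?_
        have hx' : 0 ≤ x := ht.trans (le_of_lt hx)
        simp only [abs_of_nonneg hx']
        congr 3
        ring
    _ = ENNReal.ofReal (∫ x in Set.Ioi t, Real.exp (-1 / b * x) / (2 * b)) := by
        rw [ofReal_integral_eq_lintegral_ofReal hI
          (Filter.Eventually.of_forall fun x => by positivity)]
    _ ≤ _ := by
        rw [integral_div, integral_exp_mul_Ioi hb' t]
        refine ENNReal.ofReal_le_ofReal (le_of_eq ?_)
        have : -1 / b * t = -t / b := by ring
        rw [this]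
        field_simp

theorem laplaceMeasure_Iio_neg_le (hb : 0 < b) {t : ℝ} (ht : 0 ≤ t) :
    laplaceMeasure b (Set.Iio (-t)) ≤ ENNReal.ofReal (Real.exp (-t / b) / 2) := by
  rw [← map_neg_laplaceMeasure b, Measure.map_apply measurable_neg measurableSet_Iio]
  convert laplaceMeasure_Ioi_le hb ht using 2
  ext x
  simp

theorem integral_sq_mul_laplace_density (hb : 0 < b) :
    ∫ x : ℝ, x ^ 2 * (Real.exp (-|x| / b) / (2 * b)) = 2 * b ^ 2 := by
  have h1 := integral_comp_abs (f := fun x : ℝ => x ^ 2 * (Real.exp (-x / b) / (2 * b)))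
  simp only [sq_abs] at h1
  rw [h1]
  have h2 := Real.integral_rpow_mul_exp_neg_mul_Ioi (a := 3) (r := 1 / b) (by norm_num)
    (by positivity)
  have h3 : ∫ x in Set.Ioi (0 : ℝ), x ^ 2 * (Real.exp (-x / b) / (2 * b)) =
      (∫ x in Set.Ioi (0 : ℝ), x ^ ((3 : ℝ) - 1) * Real.exp (-(1 / b * x))) / (2 * b) := by
    rw [← integral_div]
    refine setIntegral_congr_fun measurableSet_Ioi fun x _ => ?_
    have : (3 : ℝ) - 1 = (2 : ℕ) := by norm_num
    simp only [this, Real.rpow_natCast]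
    have h : -x / b = -(1 / b * x) := by ring
    rw [h]
    ring
  have h4 : Real.Gamma 3 = 2 := by
    have := Real.Gamma_nat_eq_factorial 2
    rw [Nat.cast_ofNat, show (2 : ℝ) + 1 = 3 by norm_num] at this
    rw [this]
    norm_num [Nat.factorial]
  have h5 : (1 / (1 / b)) ^ (3 : ℝ) = b ^ 3 := by
    rw [one_div_one_div]
    exact_mod_cast Real.rpow_natCast b 3
  rw [h3, h2, h4, h5]
  field_simp

theorem integrable_sq_laplaceMeasure (hb : 0 < b) :
    Integrable (fun x : ℝ => x ^ 2) (laplaceMeasure b) := by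
  rw [laplaceMeasure, integrable_withDensity_iff (measurable_laplace_density b)
    (Filter.Eventually.of_forall fun x => ENNReal.ofReal_lt_top)]
  have h := integral_sq_mul_laplace_density hb
  have hI : Integrable fun x : ℝ => x ^ 2 * (Real.exp (-|x| / b) / (2 * b)) := by
    -- A non-integrable function has integral 0 by convention, whereas the integral equals 2b² > 0.
    by_contra hn
    rw [integral_undef hn] at h
    have : 0 < 2 * b ^ 2 := by positivity
    exact this.ne h
  refine hI.congr (Filter.Eventually.of_forall fun x => ?_)
  simp only
  rw [ENNReal.toReal_ofReal (by positivity)]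

theorem integral_sq_laplaceMeasure (hb : 0 < b) :
    ∫ x, x ^ 2 ∂(laplaceMeasure b) = 2 * b ^ 2 := by
  rw [← integral_sq_mul_laplace_density hb, laplaceMeasure,
    integral_withDensity_eq_integral_toReal_smul (measurable_laplace_density b)
    (Filter.Eventually.of_forall fun x => ENNReal.ofReal_lt_top)]
  refine integral_congr_ae (Filter.Eventually.of_forall fun x => ?_)
  simp only [smul_eq_mul]
  rw [ENNReal.toReal_ofReal (by positivity), mul_comm]

theorem memLp_two_laplaceMeasure (hb : 0 < b) : MemLp (fun x : ℝ => x) 2 (laplaceMeasure b) :=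
  (memLp_two_iff_integrable_sq measurable_id.aestronglyMeasurable).2
    (integrable_sq_laplaceMeasure hb)

/-- Oddness makes the integral equal to its own negative, which requires no integrability. -/
theorem integral_id_laplaceMeasure (b : ℝ) : ∫ x, x ∂(laplaceMeasure b) = 0 := by
  have h : ∫ x, x ∂(laplaceMeasure b) = -∫ x, x ∂(laplaceMeasure b) := by
    conv_lhs => rw [← map_neg_laplaceMeasure b]
    rw [integral_map measurable_neg.aemeasurable (by fun_prop), integral_neg]
  linarith

end Laplace

/-! ### Infinite product measures -/

section InfinitePi

variable {ι : Type*} (ν : Measure ℝ) [IsProbabilityMeasure ν]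

/-- Independent identically distributed noises may be relabelled. This transports the bucket noises
along when the bucket labels are translated or negated. -/
theorem map_comp_equiv_infinitePi (e : ι ≃ ι) :
    (Measure.infinitePi fun _ : ι => ν).map (fun ξ i => ξ (e i)) =
      Measure.infinitePi fun _ : ι => ν := by
  have hm : Measurable fun (ξ : ι → ℝ) i => ξ (e i) := by fun_prop
  refine Measure.eq_infinitePi _ fun s t ht => ?_
  rw [Measure.map_apply hm (.pi s.countable_toSet fun _ _ => ht _)]
  have : (fun (ξ : ι → ℝ) i => ξ (e i)) ⁻¹' (Set.pi s t) =
      Set.pi (s.map e.toEmbedding : Finset ι) fun i => t (e.symm i) := by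
    ext ξ
    simp only [Set.mem_preimage, Set.mem_pi, Finset.mem_coe, Finset.mem_map_equiv]
    exact ⟨fun h i hi => by simpa using h _ hi, fun h i hi => by simpa using h (e i) (by simpa)⟩
  rw [this, Measure.infinitePi_pi _ (fun i _ => ht _)]
  simp

theorem infinitePi_eval_apply (k : ι) {B : Set ℝ} (hB : MeasurableSet B) :
    (Measure.infinitePi fun _ : ι => ν) {ξ | ξ k ∈ B} = ν B := by
  conv_rhs => rw [← Measure.infinitePi_map_eval (fun _ : ι => ν) k]
  rw [Measure.map_apply (by fun_prop) hB]
  rfl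

variable [DecidableEq ι]

theorem measurable_update_pair (k : ι) :
    Measurable fun p : ℝ × (ι → ℝ) => Function.update p.2 k p.1 := by
  rw [measurable_pi_iff]
  intro j
  by_cases h : j = k
  · subst h; simpa using measurable_fst
  · simp only [Function.update_of_ne h]; fun_prop

/-- Resampling one coordinate preserves a product measure. -/
theorem map_update_infinitePi (k : ι) :
    (ν.prod (Measure.infinitePi fun _ : ι => ν)).map (fun p => Function.update p.2 k p.1) =
      Measure.infinitePi fun _ : ι => ν := by
  have hm := measurable_update_pair (ι := ι) k
  refine Measure.eq_infinitePi _ fun s t ht => ?_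
  rw [Measure.map_apply hm (.pi s.countable_toSet fun _ _ => ht _)]
  by_cases hk : k ∈ s
  · have : (fun p : ℝ × (ι → ℝ) => Function.update p.2 k p.1) ⁻¹' (Set.pi s t) =
        t k ×ˢ Set.pi (s.erase k : Finset ι) t := by
      ext p
      simp only [Set.mem_preimage, Set.mem_pi, Finset.mem_coe, Set.mem_prod, Finset.mem_erase]
      constructor
      · intro h
        refine ⟨by simpa using h k hk, fun i hi => ?_⟩
        simpa [hi.1] using h i hi.2
      · rintro ⟨h1, h2⟩ i hi
        by_cases h : i = k
        · subst h; simpa using h1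
        · simpa [h] using h2 i ⟨h, hi⟩
    rw [this, Measure.prod_prod, Measure.infinitePi_pi _ (fun i _ => ht i),
      Finset.mul_prod_erase s (fun i => ν (t i)) hk]
  · have : (fun p : ℝ × (ι → ℝ) => Function.update p.2 k p.1) ⁻¹' (Set.pi s t) =
        Set.univ ×ˢ Set.pi s t := by
      ext p
      simp only [Set.mem_preimage, Set.mem_pi, Finset.mem_coe, Set.mem_prod, Set.mem_univ,
        true_and]
      refine forall₂_congr fun i hi => ?_
      have h : i ≠ k := fun h => hk (h ▸ hi)
      simp [h]
    rw [this, Measure.prod_prod, Measure.infinitePi_pi _ (fun i _ => ht i), measure_univ, one_mul]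

theorem infinitePi_apply_eq_lintegral (k : ι) {B : Set (ι → ℝ)} (hB : MeasurableSet B) :
    (Measure.infinitePi fun _ : ι => ν) B =
      ∫⁻ ξ, ν {r | Function.update ξ k r ∈ B} ∂(Measure.infinitePi fun _ : ι => ν) := by
  conv_lhs => rw [← map_update_infinitePi ν k]
  rw [Measure.map_apply (measurable_update_pair k) hB,
    Measure.prod_apply_symm (measurable_update_pair k hB)]
  rfl

/-- Conditionally on all other coordinates this is the one-dimensional shift bound; resampling
coordinate k provides the conditioning. -/
theorem infinitePi_shift_le {b : ℝ} (hb : 0 < b) (k : ι) (s : ℝ) {B : Set (ι → ℝ)}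
    (hB : MeasurableSet B) :
    (Measure.infinitePi fun _ : ι => laplaceMeasure b) {ξ | ξ + Pi.single k s ∈ B} ≤
      ENNReal.ofReal (Real.exp (|s| / b)) *
        (Measure.infinitePi fun _ : ι => laplaceMeasure b) B := by
  have := isProbabilityMeasure_laplaceMeasure hb
  have hB' : MeasurableSet {ξ : ι → ℝ | ξ + Pi.single k s ∈ B} :=
    (show Measurable fun ξ : ι → ℝ => ξ + Pi.single k s by fun_prop) hB
  have hu : ∀ ξ : ι → ℝ, Measurable fun r : ℝ => Function.update ξ k r := fun ξ =>
    measurable_update ξ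
  rw [infinitePi_apply_eq_lintegral _ k hB', infinitePi_apply_eq_lintegral _ k hB,
    ← lintegral_const_mul']
  · refine lintegral_mono fun ξ => ?_
    have h1 : {r | Function.update ξ k r ∈ {ξ | ξ + Pi.single k s ∈ B}} =
        {r | r + s ∈ {r | Function.update ξ k r ∈ B}} := by
      ext r
      have : Function.update ξ k r + Pi.single k s = Function.update ξ k (r + s) := by
        ext j
        by_cases h : j = k
        · subst h; simp
        · simp [h]
      simp [this]
    rw [h1]
    exact laplaceMeasure_shift_le hb s (hu ξ hB)
  · exact ENNReal.ofReal_ne_top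

/-- Given the other coordinates, a tie pins coordinate k to a single point, which is null. -/
theorem infinitePi_tie_eq_zero [NullSingletonClass ν] {j k : ι} (hjk : j ≠ k) (a : ℝ) :
    (Measure.infinitePi fun _ : ι => ν) {ξ | ξ k = ξ j + a} = 0 := by
  have hm : MeasurableSet {ξ : ι → ℝ | ξ k = ξ j + a} :=
    measurableSet_eq_fun (by fun_prop) (by fun_prop)
  rw [infinitePi_apply_eq_lintegral ν k hm]
  simp [hjk]

end InfinitePi

/-! ### Selecting a bucket from the labels of the data points -/

section Select

/-- The argmax of `v` over `S` if some value of `v` on `S` exceeds `thr`. -/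
noncomputable def select (thr : ℝ) (S : Finset ℤ) (v : ℤ → ℝ) : Option ℤ :=
  open Classical in
  if ∀ k ∈ S, v k ≤ thr then none else some (argmaxOn S v)

/-- The number of labels equal to `k`. -/
noncomputable def hist {n : ℕ} (r : Fin n → ℤ) (k : ℤ) : ℝ :=
  ((Finset.univ.filter fun i => r i = k).card : ℝ)

/-- The bucket selected from the labels `r` with bucket noises `ξ`. -/
noncomputable def pick (thr : ℝ) {n : ℕ} (r : Fin n → ℤ) (ξ : ℤ → ℝ) : Option ℤ :=
  select thr (Finset.univ.image r) (hist r + ξ)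

/-- The bucket labels of the data `x` with offset `T`. -/
noncomputable def labels {n : ℕ} (x : Fin n → ℝ) (T : ℝ) : Fin n → ℤ := fun i => round (x i - T)

theorem coarse_eq_map_pick (ε δ : ℝ) {n : ℕ} (x : Fin n → ℝ) (T : ℝ) (ξ : ℤ → ℝ) :
    coarse ε δ x T ξ =
      (pick (2 + 2 * Real.log (1 / δ) / ε) (labels x T) ξ).map fun k : ℤ => T + k := by
  have h1 : buckets x T = Finset.univ.image (labels x T) := rfl
  have h2 : noisyCount x T ξ = hist (labels x T) + ξ := rfl
  rw [coarse, pick, select, h1, h2]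
  split_ifs <;> rfl

/-- A first-order description of the selection, tie-breaking included. It gives measurability and
makes selections over different sets comparable. -/
theorem argmaxOn_eq_iff {S : Finset ℤ} (hS : S.Nonempty) (v : ℤ → ℝ) (y : ℤ) :
    argmaxOn S v = y ↔ y ∈ S ∧ (∀ j ∈ S, v j ≤ v y) ∧ ∀ j ∈ S, j < y → v j < v y := by
  have hne : (maximizers S v).Nonempty := by
    obtain ⟨k, hk, hmax⟩ := S.exists_max_image v hS
    exact ⟨k, Finset.mem_filter.2 ⟨hk, hmax⟩⟩
  rw [argmaxOn, dif_pos hne]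
  constructor
  · rintro rfl
    have hmem := Finset.mem_filter.1 (Finset.min'_mem _ hne)
    refine ⟨hmem.1, hmem.2, fun j hj hlt => ?_⟩
    by_contra hcon
    have hj' : j ∈ maximizers S v :=
      Finset.mem_filter.2 ⟨hj, fun i hi => (hmem.2 i hi).trans (not_lt.1 hcon)⟩
    exact absurd (Finset.min'_le _ _ hj') (not_le.2 hlt)
  · rintro ⟨hy, hmax, hmin⟩
    refine le_antisymm (Finset.min'_le _ _ (Finset.mem_filter.2 ⟨hy, hmax⟩)) ?_
    refine Finset.le_min' _ _ _ fun j hj => ?_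
    obtain ⟨hj, hjmax⟩ := Finset.mem_filter.1 hj
    by_contra hcon
    exact absurd (hjmax y hy) (not_le.2 (hmin j hj (not_le.1 hcon)))

theorem select_eq_none_iff {thr : ℝ} {S : Finset ℤ} {v : ℤ → ℝ} :
    select thr S v = none ↔ ∀ k ∈ S, v k ≤ thr := by
  rw [select]
  split_ifs with h
  · exact ⟨fun _ => h, fun _ => rfl⟩
  · simp [h]

theorem select_eq_some_iff {thr : ℝ} {S : Finset ℤ} {v : ℤ → ℝ} {y : ℤ} :
    select thr S v = some y ↔
      y ∈ S ∧ thr < v y ∧ (∀ j ∈ S, v j ≤ v y) ∧ ∀ j ∈ S, j < y → v j < v y := by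
  rw [select]
  split_ifs with h
  · refine iff_of_false (by simp) ?_
    rintro ⟨h1, h2, -⟩
    exact absurd (h y h1) (not_le.2 h2)
  · push Not at h
    obtain ⟨k, hk, hlt⟩ := h
    rw [Option.some.injEq, argmaxOn_eq_iff ⟨k, hk⟩]
    exact ⟨fun ⟨h1, h2, h3⟩ => ⟨h1, hlt.trans_le (h2 k hk), h2, h3⟩,
      fun ⟨h1, _, h2, h3⟩ => ⟨h1, h2, h3⟩⟩

/-- Elements with values below the threshold do not matter. -/
theorem select_eq_of_subset {thr : ℝ} {K L : Finset ℤ} {v : ℤ → ℝ} (hKL : K ⊆ L)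
    (h : ∀ k ∈ L, k ∉ K → v k ≤ thr) : select thr K v = select thr L v := by
  ext y
  rw [select_eq_some_iff, select_eq_some_iff]
  constructor
  · rintro ⟨h1, h2, h3, h4⟩
    refine ⟨hKL h1, h2, fun j hj => ?_, fun j hj hlt => ?_⟩
    · by_cases hjK : j ∈ K
      · exact h3 j hjK
      · exact (h j hj hjK).trans h2.le
    · by_cases hjK : j ∈ K
      · exact h4 j hjK hlt
      · exact (h j hj hjK).trans_lt h2
  · rintro ⟨h1, h2, h3, h4⟩
    refine ⟨?_, h2, fun j hj => h3 j (hKL hj), fun j hj => h4 j (hKL hj)⟩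
    by_contra hy
    exact absurd (h y h1 hy) (not_le.2 h2)

/-- Relabelling can interfere with the selection only through the tie-breaking rule, so for each
pair it suffices that the order is kept or that there is no tie. Translations satisfy the first
alternative; negation needs the second. -/
theorem select_map (thr : ℝ) (S : Finset ℤ) (v : ℤ → ℝ) (e : ℤ ≃ ℤ)
    (h : ∀ j ∈ S, ∀ k ∈ S, j < k → e j < e k ∨ v (e j) ≠ v (e k)) :
    select thr (S.map e.toEmbedding) v = (select thr S fun k => v (e k)).map e := by
  ext y
  obtain ⟨x, rfl⟩ := e.surjective y
  have h1 : (select thr S fun k => v (e k)).map e = some (e x) ↔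
      (select thr S fun k => v (e k)) = some x := by
    simp [Option.map_eq_some_iff]
  rw [h1, select_eq_some_iff, select_eq_some_iff]
  simp only [Finset.mem_map_equiv, Equiv.symm_apply_apply]
  constructor
  · rintro ⟨hx, h2, h3, h4⟩
    refine ⟨hx, h2, fun j hj => h3 _ (by simpa), fun j hj hlt => ?_⟩
    rcases h j hj x hx hlt with h5 | h5
    · exact h4 _ (by simpa) h5
    · exact lt_of_le_of_ne (h3 _ (by simpa)) h5
  · rintro ⟨hx, h2, h3, h4⟩
    refine ⟨hx, h2, fun j hj => by simpa using h3 _ hj, fun j hj hlt => ?_⟩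
    obtain ⟨i, rfl⟩ := e.surjective j
    rw [Equiv.symm_apply_apply] at hj
    rcases lt_trichotomy i x with h5 | rfl | h5
    · exact h4 i hj h5
    · exact absurd hlt (lt_irrefl _)
    · rcases h x hx i hj h5 with h6 | h6
      · exact absurd hlt h6.not_gt
      · exact lt_of_le_of_ne (h3 i hj) h6.symm

instance measurableSpaceOptionInt : MeasurableSpace (Option ℤ) := ⊤

instance discreteMeasurableSpaceOptionInt : DiscreteMeasurableSpace (Option ℤ) := ⟨fun _ => trivial⟩

/-! ### Measurability and relabelling of the selection. -/

theorem measurable_select (thr : ℝ) (S : Finset ℤ) : Measurable (select thr S) := by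
  refine measurable_to_countable' fun y => ?_
  have hle : ∀ j k : ℤ, MeasurableSet {v : ℤ → ℝ | v j ≤ v k} := fun j k =>
    measurableSet_le (by fun_prop) (by fun_prop)
  have hlt : ∀ j k : ℤ, MeasurableSet {v : ℤ → ℝ | v j < v k} := fun j k =>
    measurableSet_lt (by fun_prop) (by fun_prop)
  cases y with
  | none =>
    have : select thr S ⁻¹' {none} = ⋂ k ∈ S, {v | v k ≤ thr} := by
      ext v; simp [select_eq_none_iff]
    rw [this]
    exact S.measurableSet_biInter fun k _ => measurableSet_le (by fun_prop) (by fun_prop)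
  | some y =>
    by_cases hy : y ∈ S
    · have : select thr S ⁻¹' {some y} = {v | thr < v y} ∩
          ((⋂ j ∈ S, {v | v j ≤ v y}) ∩ ⋂ j ∈ S, ⋂ (_ : j < y), {v | v j < v y}) := by
        ext v; simp [select_eq_some_iff, hy]
      rw [this]
      refine (measurableSet_lt (by fun_prop) (by fun_prop)).inter
        ((S.measurableSet_biInter fun k _ => hle k y).inter
          (S.measurableSet_biInter fun k _ => MeasurableSet.iInter fun _ => hlt k y))
    · have : select thr S ⁻¹' {some y} = ∅ := by
        ext v; simp [select_eq_some_iff, hy]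
      rw [this]
      exact MeasurableSet.empty

theorem measurable_pick_right (thr : ℝ) {n : ℕ} (r : Fin n → ℤ) : Measurable (pick thr r) :=
  (measurable_select thr _).comp (show Measurable fun ξ : ℤ → ℝ => hist r + ξ by fun_prop)

theorem measurable_pick (thr : ℝ) (n : ℕ) :
    Measurable fun p : (Fin n → ℤ) × (ℤ → ℝ) => pick thr p.1 p.2 :=
  measurable_from_prod_countable_right fun r => measurable_pick_right thr r

theorem measurable_labels (n : ℕ) :
    Measurable fun p : (Fin n → ℝ) × ℝ => labels p.1 p.2 := by
  rw [measurable_pi_iff]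
  intro i
  simp only [labels, round_eq]
  exact Int.measurable_floor.comp (by fun_prop)

theorem pick_eq_some {thr : ℝ} {n : ℕ} {r : Fin n → ℤ} {ξ : ℤ → ℝ} {y : ℤ}
    (h : pick thr r ξ = some y) : ∃ i, r i = y := by
  simpa using (select_eq_some_iff.1 h).1

theorem hist_comp_equiv {n : ℕ} (r : Fin n → ℤ) (e : ℤ ≃ ℤ) (k : ℤ) :
    hist (fun i => e (r i)) (e k) = hist r k := by
  simp [hist]

theorem pick_comp_equiv (thr : ℝ) {n : ℕ} (r : Fin n → ℤ) (ξ : ℤ → ℝ) (e : ℤ ≃ ℤ)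
    (h : ∀ j k, j < k → e j < e k ∨ hist r j + ξ j ≠ hist r k + ξ k) :
    pick thr (fun i => e (r i)) (fun k => ξ (e.symm k)) = (pick thr r ξ).map e := by
  have h1 : Finset.univ.image (fun i => e (r i)) = (Finset.univ.image r).map e.toEmbedding := by
    ext k
    simp only [Finset.mem_image, Finset.mem_univ, true_and, Finset.mem_map_equiv]
    exact exists_congr fun i => by rw [Equiv.eq_symm_apply]
  rw [pick, h1, select_map]
  · simp only [Pi.add_apply, hist_comp_equiv, Equiv.symm_apply_apply]
    rfl
  · intro j _ k _ hjk
    simpa only [Pi.add_apply, hist_comp_equiv, Equiv.symm_apply_apply] using h j k hjk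

/-! ### Privacy of the selection. -/

theorem hist_add_single {n : ℕ} {r r' : Fin n → ℤ} {i₀ : Fin n} (h : ∀ j, j ≠ i₀ → r j = r' j) :
    hist r = hist r' + Pi.single (r i₀) 1 + Pi.single (r' i₀) (-1) := by
  have key : ∀ (s : Fin n → ℤ) (k : ℤ), hist s k =
      (∑ i ∈ Finset.univ.erase i₀, if s i = k then (1 : ℝ) else 0) +
        (Pi.single (s i₀) (1 : ℝ) : ℤ → ℝ) k := by
    intro s k
    rw [hist, Finset.card_filter]
    push_cast
    rw [← Finset.sum_erase_add _ _ (Finset.mem_univ i₀)]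
    congr 1
    by_cases hk : s i₀ = k
    · subst hk; simp
    · rw [if_neg hk, Pi.single_eq_of_ne (Ne.symm hk)]
  ext k
  rw [Pi.add_apply, Pi.add_apply, key r, key r', Pi.single_neg, Pi.neg_apply]
  have : ∀ i ∈ Finset.univ.erase i₀, (if r i = k then (1 : ℝ) else 0) =
      if r' i = k then (1 : ℝ) else 0 := fun i hi => by
    rw [h i (Finset.ne_of_mem_erase hi)]
  rw [Finset.sum_congr rfl this]
  ring

theorem hist_eq_zero {n : ℕ} {r : Fin n → ℤ} {k : ℤ} (hk : k ∉ Finset.univ.image r) :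
    hist r k = 0 := by
  rw [hist, Nat.cast_eq_zero, Finset.card_eq_zero, Finset.filter_eq_empty_iff]
  intro i _ h
  exact hk (Finset.mem_image.2 ⟨i, Finset.mem_univ _, h⟩)

/-- The set of competing buckets itself depends on the data. Letting the union of both bucket sets
compete removes this dependence, at the price of the event that the noise of a bucket empty in one
of the runs exceeds the threshold. Over the fixed union, two noise shifts by one unit turn one
histogram into the other. -/
theorem pick_dp {ε δ : ℝ} (hε : 0 < ε) (hδ : 0 < δ) (hδ1 : δ < 1) {n : ℕ} {r r' : Fin n → ℤ}
    {i₀ : Fin n} (h : ∀ j, j ≠ i₀ → r j = r' j) (Z : Set (Option ℤ)) :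
    (Measure.infinitePi fun _ : ℤ => laplaceMeasure (2 / ε))
        {ξ | pick (2 + 2 * Real.log (1 / δ) / ε) r ξ ∈ Z} ≤
      ENNReal.ofReal (Real.exp ε) * (Measure.infinitePi fun _ : ℤ => laplaceMeasure (2 / ε))
        {ξ | pick (2 + 2 * Real.log (1 / δ) / ε) r' ξ ∈ Z} + ENNReal.ofReal δ := by
  have hb : 0 < 2 / ε := by positivity
  have := isProbabilityMeasure_laplaceMeasure hb
  set thr := 2 + 2 * Real.log (1 / δ) / ε with hthr
  set Λ := Measure.infinitePi fun _ : ℤ => laplaceMeasure (2 / ε) with hΛ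
  have hlog : 0 ≤ Real.log (1 / δ) := Real.log_nonneg (by rw [le_div_iff₀ hδ]; linarith)
  have hthr0 : 0 ≤ thr := by positivity
  have htail : ∀ k : ℤ, Λ {ξ | thr < ξ k} ≤ ENNReal.ofReal (Real.exp (-ε) * δ / 2) := by
    intro k
    have h1 := laplaceMeasure_Ioi_le hb hthr0
    rw [← infinitePi_eval_apply (laplaceMeasure (2 / ε)) k measurableSet_Ioi] at h1
    refine h1.trans (ENNReal.ofReal_le_ofReal (le_of_eq ?_))
    -- The summand 2 of the threshold yields e^{-ε}, and the logarithmic summand yields δ.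
    have h2 : -thr / (2 / ε) = -ε + Real.log δ := by
      rw [hthr, one_div, Real.log_inv]
      field_simp
      ring
    rw [h2, Real.exp_add, Real.exp_log hδ]
  set L := Finset.univ.image r ∪ Finset.univ.image r' with hL
  -- The only bucket of the union that can be empty for s is s' i₀. Its noisy count is pure noise,
  -- so below the threshold it does not influence the selection.
  have hsub : ∀ (s s' : Fin n → ℤ), (∀ j, j ≠ i₀ → s j = s' j) →
      Finset.univ.image s ∪ Finset.univ.image s' = L → ∀ ξ, ¬ thr < ξ (s' i₀) →
      pick thr s ξ = select thr L (hist s + ξ) := by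
    intro s s' hs hU ξ hξ
    refine select_eq_of_subset (hU ▸ Finset.subset_union_left) fun k hk hk' => ?_
    rw [← hU, Finset.mem_union] at hk
    obtain ⟨i, -, rfl⟩ := Finset.mem_image.1 (hk.resolve_left hk')
    have hi : i = i₀ := by
      by_contra hi
      exact hk' (Finset.mem_image.2 ⟨i, Finset.mem_univ _, hs i hi⟩)
    subst hi
    rw [Pi.add_apply, hist_eq_zero hk', zero_add]
    exact not_lt.1 hξ
  set G : (Fin n → ℤ) → Set (ℤ → ℝ) := fun s => {ξ | select thr L (hist s + ξ) ∈ Z} with hG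
  have hGm : ∀ s, MeasurableSet (G s) := fun s =>
    ((measurable_select thr L).comp
      (show Measurable fun ξ : ℤ → ℝ => hist s + ξ by fun_prop)) (MeasurableSet.of_discrete (s := Z))
  have h1 : Λ {ξ | pick thr r ξ ∈ Z} ≤ Λ (G r) + ENNReal.ofReal (Real.exp (-ε) * δ / 2) := by
    refine (measure_mono (t := G r ∪ {ξ | thr < ξ (r' i₀)}) fun ξ hξ => ?_).trans
      ((measure_union_le _ _).trans (by gcongr; exact htail _))
    by_cases hlt : thr < ξ (r' i₀)
    · exact Or.inr hlt
    · left
      have := hsub r r' h rfl ξ hlt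
      simpa [hG, ← this] using hξ
  have h2 : Λ (G r') ≤ Λ {ξ | pick thr r' ξ ∈ Z} + ENNReal.ofReal (Real.exp (-ε) * δ / 2) := by
    refine (measure_mono (t := {ξ | pick thr r' ξ ∈ Z} ∪ {ξ | thr < ξ (r i₀)}) fun ξ hξ => ?_).trans
      ((measure_union_le _ _).trans (by gcongr; exact htail _))
    by_cases hlt : thr < ξ (r i₀)
    · exact Or.inr hlt
    · left
      have := hsub r' r (fun j hj => (h j hj).symm) (Finset.union_comm _ _) ξ hlt
      simpa [hG, this] using hξ
  have h3 : Λ (G r) ≤ ENNReal.ofReal (Real.exp ε) * Λ (G r') := by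
    have e1 : G r = {ξ | ξ + Pi.single (r' i₀) (-1) ∈ {ξ | ξ + Pi.single (r i₀) 1 ∈ G r'}} := by
      ext ξ
      simp only [hG, Set.mem_ofPred_eq]
      rw [hist_add_single h]
      have : hist r' + Pi.single (r i₀) 1 + Pi.single (r' i₀) (-1) + ξ =
        hist r' + (ξ + Pi.single (r' i₀) (-1) + Pi.single (r i₀) 1) := by abel
      rw [this]
    have hm : MeasurableSet {ξ : ℤ → ℝ | ξ + Pi.single (r i₀) 1 ∈ G r'} :=
      (show Measurable fun ξ : ℤ → ℝ => ξ + Pi.single (r i₀) 1 by fun_prop) (hGm r')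
    rw [e1]
    refine (infinitePi_shift_le hb _ _ hm).trans ((mul_le_mul_right
      (infinitePi_shift_le hb _ _ (hGm r')) _).trans (le_of_eq ?_))
    rw [← mul_assoc, ← ENNReal.ofReal_mul (Real.exp_pos _).le, ← Real.exp_add]
    congr 3
    rw [abs_neg, abs_one]
    field_simp
    norm_num
  calc Λ {ξ | pick thr r ξ ∈ Z}
      ≤ ENNReal.ofReal (Real.exp ε) * (Λ {ξ | pick thr r' ξ ∈ Z} +
          ENNReal.ofReal (Real.exp (-ε) * δ / 2)) + ENNReal.ofReal (Real.exp (-ε) * δ / 2) :=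
        h1.trans (by gcongr; exact h3.trans (by gcongr))
    _ ≤ _ := by
        rw [mul_add, add_assoc]
        gcongr
        rw [← ENNReal.ofReal_mul (Real.exp_pos _).le, ← ENNReal.ofReal_add (by positivity)
          (by positivity)]
        -- The second replacement error is multiplied by e^ε. Its factor e^{-ε} cancels this, and
        -- the two errors add up to δ/2 + e^{-ε}δ/2 ≤ δ.
        refine ENNReal.ofReal_le_ofReal ?_
        have h4 : Real.exp ε * (Real.exp (-ε) * δ / 2) = δ / 2 := by
          rw [← mul_div_assoc, ← mul_assoc, ← Real.exp_add]
          simp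
        have h5 : Real.exp (-ε) ≤ 1 := Real.exp_le_one_iff.2 (by linarith)
        rw [h4]
        nlinarith

end Select

/-! ### Accuracy of the selection -/

section Accuracy

theorem hist_le_of_forall_notMem {n : ℕ} {r : Fin n → ℤ} {G : Finset (Fin n)} {k : ℤ}
    (h : ∀ i ∈ G, r i ≠ k) : hist r k ≤ n - G.card := by
  have h1 : (Finset.univ.filter fun i => r i = k).card ≤ Gᶜ.card := by
    refine Finset.card_le_card fun i hi => ?_
    rw [Finset.mem_compl]
    exact fun hG => h i hG (Finset.mem_filter.1 hi).2
  rw [Finset.card_compl, Fintype.card_fin] at h1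
  have h2 : G.card ≤ n := by simpa using G.card_le_univ
  rw [hist, ← Nat.cast_sub h2]
  exact_mod_cast h1

/-- Pigeonhole: one of the two labels is carried by at least half of G. -/
theorem exists_popular_label {n : ℕ} {r : Fin n → ℤ} {G : Finset (Fin n)} (hG : G.Nonempty) {a : ℤ}
    (h : ∀ i ∈ G, r i = a ∨ r i = a + 1) : ∃ i ∈ G, (G.card : ℝ) ≤ 2 * hist r (r i) := by
  set A := G.filter fun i => r i = a
  set B := G.filter fun i => r i = a + 1
  have hcard : G.card ≤ A.card + B.card := by
    refine le_trans (Finset.card_le_card fun i hi => ?_) (Finset.card_union_le A B)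
    rcases h i hi with h1 | h1
    · exact Finset.mem_union_left _ (Finset.mem_filter.2 ⟨hi, h1⟩)
    · exact Finset.mem_union_right _ (Finset.mem_filter.2 ⟨hi, h1⟩)
  have key : ∀ c : ℤ, G.card ≤ 2 * (G.filter fun i => r i = c).card →
      ∃ i ∈ G, (G.card : ℝ) ≤ 2 * hist r (r i) := by
    intro c hc
    have hne : (G.filter fun i => r i = c).Nonempty := by
      rw [← Finset.card_pos]
      have := hG.card_pos
      omega
    obtain ⟨i, hi⟩ := hne
    obtain ⟨hiG, rfl⟩ := Finset.mem_filter.1 hi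
    refine ⟨i, hiG, ?_⟩
    have h2 : (G.filter fun j => r j = r i).card ≤ (Finset.univ.filter fun j => r j = r i).card :=
      Finset.card_le_card (Finset.filter_subset_filter _ (Finset.subset_univ _))
    rw [hist]
    exact_mod_cast hc.trans (by omega)
  rcases le_total A.card B.card with h1 | h1
  · exact key (a + 1) (by change _ ≤ 2 * B.card; omega)
  · exact key a (by change _ ≤ 2 * A.card; omega)

/-- The numerical margins: the popular bucket has noisy count above 0.835n/2 − n/8 = 0.2925n. This
exceeds the threshold, which is at most 2n/7 < 0.2858n, and it exceeds the noisy count of any bucket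
avoiding G, which is below 0.165n + n/8 = 0.29n. -/
theorem pick_of_noise_le {n : ℕ} {r : Fin n → ℤ} {G : Finset (Fin n)} (hG : 0.835 * (n : ℝ) < G.card)
    {thr τ : ℝ} (hτ : τ ≤ n / 8) (hthr : thr ≤ 2 * n / 7) {i₀ : Fin n} (hi₀ : i₀ ∈ G)
    (hpop : (G.card : ℝ) ≤ 2 * hist r (r i₀)) {ξ : ℤ → ℝ} (h1 : -τ ≤ ξ (r i₀))
    (h2 : ∀ k ∈ (Finset.univ.image r).erase (r i₀), ξ k ≤ τ) :
    ∃ i ∈ G, pick thr r ξ = some (r i) := by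
  have hn : (0 : ℝ) ≤ n := Nat.cast_nonneg n
  have hmem : r i₀ ∈ Finset.univ.image r := Finset.mem_image_of_mem _ (Finset.mem_univ _)
  have hv : 0.2925 * (n : ℝ) < (hist r + ξ) (r i₀) := by
    rw [Pi.add_apply]; linarith
  cases hp : pick thr r ξ with
  | none =>
    have := select_eq_none_iff.1 hp _ hmem
    linarith
  | some y =>
    obtain ⟨hy, -, hmax, -⟩ := select_eq_some_iff.1 hp
    by_contra hcon
    have hno : ∀ i ∈ G, r i ≠ y := fun i hi hiy => hcon ⟨i, hi, by rw [hiy]⟩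
    have h3 := hist_le_of_forall_notMem hno
    have h4 := h2 y (Finset.mem_erase.2 ⟨fun h => hno i₀ hi₀ h.symm, hy⟩)
    have h5 := hmax _ hmem
    rw [Pi.add_apply _ _ y] at h5
    linarith

theorem pick_accuracy {ε γ : ℝ} (hε : 0 < ε) (hγ : 0 < γ) (hγ1 : γ ≤ 1) {n : ℕ} {r : Fin n → ℤ}
    {G : Finset (Fin n)} (hn : 0 < n) (hG : 0.835 * (n : ℝ) < G.card) {a : ℤ}
    (ha : ∀ i ∈ G, r i = a ∨ r i = a + 1) {thr : ℝ} (hthr : thr ≤ 2 * n / 7)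
    (hlog : 16 / ε * Real.log (n / γ) ≤ n) :
    (Measure.infinitePi fun _ : ℤ => laplaceMeasure (2 / ε))
        {ξ | ¬ ∃ i ∈ G, pick thr r ξ = some (r i)} ≤ ENNReal.ofReal (γ / 2) := by
  have hb : 0 < 2 / ε := by positivity
  have := isProbabilityMeasure_laplaceMeasure hb
  set Λ := Measure.infinitePi fun _ : ℤ => laplaceMeasure (2 / ε) with hΛ
  have hn' : (0 : ℝ) < n := Nat.cast_pos.2 hn
  have hn1 : (1 : ℝ) ≤ n := Nat.one_le_cast.2 hn
  have hGne : G.Nonempty := by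
    rw [← Finset.card_pos]
    have : (0 : ℝ) < G.card := by linarith
    exact_mod_cast this
  obtain ⟨i₀, hi₀, hpop⟩ := exists_popular_label hGne ha
  -- At this level each one-sided noise tail is at most γ/(2n), so a union bound over at most n
  -- nonempty buckets gives γ/2. One side per bucket suffices: the popular bucket must not lose much
  -- and the others must not gain much.
  set τ := 2 / ε * Real.log (n / γ) with hτ
  have hτ0 : 0 ≤ τ := mul_nonneg hb.le (Real.log_nonneg (by rw [le_div_iff₀ hγ]; linarith))
  have hτ8 : τ ≤ n / 8 := by
    have : τ = (16 / ε * Real.log (n / γ)) / 8 := by rw [hτ]; ring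
    linarith
  have hval : Real.exp (-τ / (2 / ε)) / 2 = γ / n / 2 := by
    have : -τ / (2 / ε) = -Real.log (n / γ) := by
      rw [hτ]; field_simp
    rw [this, Real.exp_neg, Real.exp_log (by positivity), inv_div]
  have hS : ∀ k : ℤ, Λ (if k = r i₀ then {ξ | ξ k ∈ Set.Iio (-τ)} else {ξ | ξ k ∈ Set.Ioi τ}) ≤
      ENNReal.ofReal (γ / n / 2) := by
    intro k
    rw [← hval]
    split_ifs
    · rw [infinitePi_eval_apply _ _ measurableSet_Iio]
      exact laplaceMeasure_Iio_neg_le hb hτ0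
    · rw [infinitePi_eval_apply _ _ measurableSet_Ioi]
      exact laplaceMeasure_Ioi_le hb hτ0
  calc Λ {ξ | ¬ ∃ i ∈ G, pick thr r ξ = some (r i)}
      ≤ Λ (⋃ k ∈ Finset.univ.image r,
          if k = r i₀ then {ξ | ξ k ∈ Set.Iio (-τ)} else {ξ | ξ k ∈ Set.Ioi τ}) := by
        refine measure_mono fun ξ hξ => ?_
        by_contra hcon
        simp only [Set.mem_iUnion, not_exists] at hcon
        refine hξ (pick_of_noise_le hG hτ8 hthr hi₀ hpop ?_ fun k hk => ?_)
        · simpa using hcon (r i₀) (Finset.mem_image_of_mem _ (Finset.mem_univ _))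
        · obtain ⟨h1, h2⟩ := Finset.mem_erase.1 hk
          simpa [h1] using hcon k h2
    _ ≤ ∑ k ∈ Finset.univ.image r, ENNReal.ofReal (γ / n / 2) :=
        (measure_biUnion_finset_le _ _).trans (Finset.sum_le_sum fun k _ => hS k)
    _ ≤ ENNReal.ofReal (γ / 2) := by
        rw [Finset.sum_const, nsmul_eq_mul, ← ENNReal.ofReal_natCast,
          ← ENNReal.ofReal_mul (Nat.cast_nonneg _)]
        refine ENNReal.ofReal_le_ofReal ?_
        have h1 : ((Finset.univ.image r).card : ℝ) ≤ n := by
          exact_mod_cast Finset.card_image_le.trans (by simp)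
        calc ((Finset.univ.image r).card : ℝ) * (γ / n / 2) ≤ n * (γ / n / 2) := by gcongr
          _ = γ / 2 := by field_simp

end Accuracy

/-! ### The law of the coarse estimate -/

instance isProbabilityMeasure_offsetMeasure : IsProbabilityMeasure offsetMeasure := by
  constructor
  rw [offsetMeasure, Measure.restrict_apply_univ, Real.volume_Icc]
  norm_num

/-- The threshold of the coarse estimator. -/
noncomputable def threshold (ε δ : ℝ) : ℝ := 2 + 2 * Real.log (1 / δ) / ε

/-- The law of the data and the random choices used by the coarse step. -/
noncomputable def coarseLaw (P : Measure ℝ) (ε : ℝ) (n : ℕ) :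
    Measure ((Fin n → ℝ) × ℝ × (ℤ → ℝ)) :=
  (Measure.pi fun _ : Fin n => P).prod
    (offsetMeasure.prod (Measure.infinitePi fun _ : ℤ => laplaceMeasure (2 / ε)))

/-- The bucket selected by the coarse step. -/
noncomputable def chosen (ε δ σ : ℝ) {n : ℕ} (p : (Fin n → ℝ) × ℝ × (ℤ → ℝ)) : Option ℤ :=
  pick (threshold ε δ) (labels (fun i => p.1 i / σ) p.2.1) p.2.2

/-- The value of the coarse step, meaningful only if a bucket is selected. -/
noncomputable def center (ε δ σ : ℝ) {n : ℕ} (p : (Fin n → ℝ) × ℝ × (ℤ → ℝ)) : ℝ :=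
  σ * (p.2.1 + ((chosen ε δ σ p).getD 0 : ℤ))

theorem measurable_chosen (ε δ σ : ℝ) (n : ℕ) :
    Measurable fun p : (Fin n → ℝ) × ℝ × (ℤ → ℝ) => chosen ε δ σ p := by
  have h1 : Measurable fun p : (Fin n → ℝ) × ℝ × (ℤ → ℝ) =>
      ((fun i => p.1 i / σ : Fin n → ℝ), p.2.1) := by fun_prop
  have h2 : Measurable fun p : (Fin n → ℝ) × ℝ × (ℤ → ℝ) =>
      labels (fun i => p.1 i / σ) p.2.1 := (measurable_labels n).comp h1
  have h3 : Measurable fun p : (Fin n → ℝ) × ℝ × (ℤ → ℝ) => p.2.2 := by fun_prop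
  have h4 := (measurable_pick (threshold ε δ) n).comp (h2.prodMk h3)
  exact h4

theorem measurable_center (ε δ σ : ℝ) (n : ℕ) :
    Measurable fun p : (Fin n → ℝ) × ℝ × (ℤ → ℝ) => center ε δ σ p := by
  have h : Measurable fun p : (Fin n → ℝ) × ℝ × (ℤ → ℝ) =>
      (((chosen ε δ σ p).getD 0 : ℤ) : ℝ) :=
    (measurable_from_top (f := fun o : Option ℤ => ((o.getD 0 : ℤ) : ℝ))).comp
      (measurable_chosen ε δ σ n)
  unfold center
  fun_prop

theorem measurableSet_chosen (ε δ σ : ℝ) (n : ℕ) :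
    MeasurableSet {p : (Fin n → ℝ) × ℝ × (ℤ → ℝ) | chosen ε δ σ p ≠ none} :=
  measurable_chosen ε δ σ n (MeasurableSet.of_discrete (s := {o | o ≠ none}))

theorem abs_center_sub_le {ε δ σ : ℝ} (hσ : 0 < σ) {n : ℕ} {p : (Fin n → ℝ) × ℝ × (ℤ → ℝ)}
    {i : Fin n} (h : chosen ε δ σ p = some (labels (fun i => p.1 i / σ) p.2.1 i)) :
    |center ε δ σ p - p.1 i| ≤ σ / 2 := by
  have h1 := abs_sub_round (p.1 i / σ - p.2.1)
  rw [center, h, Option.getD_some, labels]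
  have h2 : σ * (p.2.1 + (round (p.1 i / σ - p.2.1) : ℤ)) - p.1 i =
      -(σ * (p.1 i / σ - p.2.1 - (round (p.1 i / σ - p.2.1) : ℤ))) := by
    field_simp
    ring
  rw [h2, abs_neg, abs_mul, abs_of_pos hσ]
  nlinarith

/-- Only nonempty buckets compete, so even a bad estimate lies within half a bucket of some data
point. This is why moments of the sample control the estimate on the event that it is far from the
mean. -/
theorem exists_abs_center_sub_le {ε δ σ : ℝ} (hσ : 0 < σ) {n : ℕ}
    {p : (Fin n → ℝ) × ℝ × (ℤ → ℝ)} (h : chosen ε δ σ p ≠ none) :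
    ∃ i, |center ε δ σ p - p.1 i| ≤ σ / 2 := by
  obtain ⟨k, hk⟩ := Option.ne_none_iff_exists'.1 h
  obtain ⟨i, hi⟩ := pick_eq_some hk
  exact ⟨i, abs_center_sub_le hσ (by rw [hk, ← hi])⟩

/-! #### Concentration of the number of outliers -/

theorem measureReal_abs_sub_gt_le {P : Measure ℝ} [IsProbabilityMeasure P] {m : ℝ}
    (hI : Integrable (fun x => (x - m) ^ 2) P) (h1 : ∫ x, (x - m) ^ 2 ∂P ≤ 1) :
    P.real {x | 5 < |x - m|} ≤ 1 / 25 := by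
  have h := mul_meas_ge_le_integral_of_nonneg
    (Filter.Eventually.of_forall fun x => sq_nonneg (x - m)) hI 25
  have h2 : P.real {x | 5 < |x - m|} ≤ P.real {x | 25 ≤ (x - m) ^ 2} := by
    refine measureReal_mono fun x hx => ?_
    have h3 : 5 < |x - m| := hx
    change 25 ≤ (x - m) ^ 2
    rw [← sq_abs]
    nlinarith
  linarith

/-- Hoeffding for the indicators of outliers. Their mean is at most 1/25 = 0.04 by Chebyshev, so a
fraction 0.165 of outliers is a deviation of at least 1/8. -/
theorem measure_outliers_le {P : Measure ℝ} [IsProbabilityMeasure P] {m γ : ℝ} (hγ : 0 < γ)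
    (hγ1 : γ ≤ 1) (hI : Integrable (fun x => (x - m) ^ 2) P) (h1 : ∫ x, (x - m) ^ 2 ∂P ≤ 1)
    {n : ℕ} (hn : 128 * Real.log (2 / γ) ≤ n) :
    (Measure.pi fun _ : Fin n => P)
      {x | 0.165 * (n : ℝ) ≤ ((Finset.univ.filter fun i => 5 < |x i - m|).card : ℝ)} ≤
      ENNReal.ofReal (γ / 16) := by
  classical
  have hlog : 0 < Real.log (2 / γ) := Real.log_pos (by rw [lt_div_iff₀ hγ]; linarith)
  have hn0 : (0 : ℝ) < n := by linarith
  set s : Set ℝ := {x | 5 < |x - m|} with hs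
  have hsm : MeasurableSet s := measurableSet_lt (by fun_prop) (by fun_prop)
  set Y : ℝ → ℝ := s.indicator 1 with hY
  have hYm : Measurable Y := measurable_one.indicator hsm
  have hYI : ∫ x, Y x ∂P ≤ 1 / 25 := by
    rw [hY, integral_indicator_one hsm]
    exact measureReal_abs_sub_gt_le hI h1
  have hsub : HasSubgaussianMGF (fun x => Y x - ∫ y, Y y ∂P) ((‖(1 : ℝ) - 0‖₊ / 2) ^ 2) P := by
    refine hasSubgaussianMGF_of_mem_Icc hYm.aemeasurable (Filter.Eventually.of_forall fun x => ?_)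
    by_cases hx : x ∈ s <;> simp [hY, hx]
  have hind : iIndepFun (fun (i : Fin n) (x : Fin n → ℝ) => Y (x i) - ∫ y, Y y ∂P)
      (Measure.pi fun _ : Fin n => P) :=
    iIndepFun_pi (X := fun (_ : Fin n) x => Y x - ∫ y, Y y ∂P)
      fun i => (hYm.sub_const _).aemeasurable
  have hsub' : ∀ i ∈ (Finset.univ : Finset (Fin n)),
      HasSubgaussianMGF (fun x : Fin n → ℝ => Y (x i) - ∫ y, Y y ∂P)
        ((‖(1 : ℝ) - 0‖₊ / 2) ^ 2) (Measure.pi fun _ : Fin n => P) := by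
    intro i _
    have he := measurePreserving_eval (fun _ : Fin n => P) i
    refine HasSubgaussianMGF.of_map (Y := fun x : Fin n → ℝ => x i) he.measurable.aemeasurable
      (X := fun x => Y x - ∫ y, Y y ∂P) ?_
    rw [show (fun x : Fin n → ℝ => x i) = Function.eval i from rfl, he.map_eq]
    exact hsub
  have hH := HasSubgaussianMGF.measure_sum_ge_le_of_iIndepFun hind hsub'
    (ε := (n : ℝ) / 8) (by positivity)
  have hexp : Real.exp (-((n : ℝ) / 8) ^ 2 /
      (2 * ((∑ i : Fin n, (‖(1 : ℝ) - 0‖₊ / 2) ^ 2 : NNReal) : ℝ))) ≤ γ / 16 := by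
    have e1 : ((∑ i : Fin n, (‖(1 : ℝ) - 0‖₊ / 2) ^ 2 : NNReal) : ℝ) = n / 4 := by
      simp
      ring
    rw [e1]
    have e2 : -((n : ℝ) / 8) ^ 2 / (2 * (n / 4)) = -(n / 32) := by
      field_simp
      ring
    rw [e2]
    calc Real.exp (-(n / 32 : ℝ)) ≤ Real.exp (-(4 * Real.log (2 / γ))) := by
          rw [Real.exp_le_exp]; linarith
      _ = (γ / 2) ^ 4 := by
          rw [← mul_neg, ← Real.log_inv, inv_div, mul_comm, Real.exp_mul,
            Real.exp_log (by positivity)]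
          exact_mod_cast Real.rpow_natCast _ 4
      -- The hypothesis on n makes the Hoeffding bound e^{-n/32} at most (γ/2)⁴. The small factor
      -- 1/16 keeps the total failure probability at 9γ/16, strictly below 1.
      _ ≤ γ / 16 := by
          have : γ ^ 4 ≤ γ := by
            calc γ ^ 4 ≤ γ ^ 1 := pow_le_pow_of_le_one hγ.le hγ1 (by norm_num)
              _ = γ := pow_one γ
          rw [div_pow]
          linarith
  refine (measure_mono (t := {x : Fin n → ℝ | (n : ℝ) / 8 ≤ ∑ i, (Y (x i) - ∫ y, Y y ∂P)})
    fun x hx => ?_).trans ?_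
  · change (n : ℝ) / 8 ≤ ∑ i, (Y (x i) - ∫ y, Y y ∂P)
    have hx' : 0.165 * (n : ℝ) ≤ ((Finset.univ.filter fun i => 5 < |x i - m|).card : ℝ) := hx
    have e3 : ∑ i, Y (x i) = ((Finset.univ.filter fun i => 5 < |x i - m|).card : ℝ) := by
      rw [Finset.card_filter]
      push_cast
      refine Finset.sum_congr rfl fun i _ => ?_
      simp [hY, hs, Set.indicator_apply]
    rw [Finset.sum_sub_distrib, e3]
    simp only [Finset.sum_const, Finset.card_univ, Fintype.card_fin, nsmul_eq_mul]
    nlinarith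
  · rw [← ofReal_measureReal]
    exact ENNReal.ofReal_le_ofReal (hH.trans hexp)

/-- Rounding is monotone, and it increases by exactly one across the closed interval of length 1
around a. -/
theorem round_mem_of_abs_le {a y : ℝ} (h : |y - a| ≤ 1 / 2) :
    round y = round (a - 1 / 2) ∨ round y = round (a - 1 / 2) + 1 := by
  obtain ⟨h1, h2⟩ := abs_le.1 h
  have h3 : round (a - 1 / 2) ≤ round y := by
    rw [round_eq, round_eq]
    exact Int.floor_mono (by linarith)
  have h4 : round y ≤ round (a - 1 / 2) + 1 := by
    rw [← round_add_one, round_eq, round_eq]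
    exact Int.floor_mono (by linarith)
  omega

theorem threshold_le {ε δ : ℝ} {n : ℕ} (h : 7 + 7 / ε * Real.log (1 / δ) ≤ n) :
    threshold ε δ ≤ 2 * n / 7 := by
  have : threshold ε δ = 2 / 7 * (7 + 7 / ε * Real.log (1 / δ)) := by
    rw [threshold]; ring
  rw [this]
  linarith

/-- With σ = 10 the points within 5 of m fill an interval of one bucket width, so they carry at most
two labels. The selected bucket contains such a point, and half a bucket width plus 5 gives 10. The
probabilities γ/16 (too many outliers) and γ/2 (large noise) add up to 9γ/16. -/
theorem coarse_accuracy {P : Measure ℝ} [IsProbabilityMeasure P] {m ε δ γ : ℝ} (hε : 0 < ε)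
    (hδ : 0 < δ) (hδ1 : δ < 1) (hγ : 0 < γ) (hγ1 : γ ≤ 1)
    (hI : Integrable (fun x => (x - m) ^ 2) P) (h1 : ∫ x, (x - m) ^ 2 ∂P ≤ 1) {n : ℕ}
    (hn : LargeEnough ε δ γ n) :
    coarseLaw P ε n {p | ¬ (chosen ε δ 10 p ≠ none ∧ |center ε δ 10 p - m| ≤ 10)} ≤
      ENNReal.ofReal (9 / 16 * γ) := by
  classical
  have := isProbabilityMeasure_laplaceMeasure (b := 2 / ε) (by positivity)
  obtain ⟨hn1, hn2, hn3⟩ := hn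
  have hlog : 0 ≤ Real.log (1 / δ) := Real.log_nonneg (by rw [le_div_iff₀ hδ]; linarith)
  have hn0 : (0 : ℝ) < n := by
    have : 0 ≤ 7 / ε * Real.log (1 / δ) := by positivity
    linarith
  have hDm : MeasurableSet {p : (Fin n → ℝ) × ℝ × (ℤ → ℝ) |
      ¬ (chosen ε δ 10 p ≠ none ∧ |center ε δ 10 p - m| ≤ 10)} :=
    ((measurableSet_chosen ε δ 10 n).inter (measurableSet_le
      (((measurable_center ε δ 10 n).sub_const m).abs) measurable_const)).compl
  set W : Set (Fin n → ℝ) :=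
    {x | 0.165 * (n : ℝ) ≤ ((Finset.univ.filter fun i => 5 < |x i - m|).card : ℝ)} with hW
  have hWm : MeasurableSet W := by
    have e3 : ∀ x : Fin n → ℝ, ((Finset.univ.filter fun i => 5 < |x i - m|).card : ℝ) =
        ∑ i, ({y : ℝ | 5 < |y - m|}.indicator 1 (x i) : ℝ) := by
      intro x
      rw [Finset.card_filter]
      push_cast
      refine Finset.sum_congr rfl fun i _ => ?_
      simp [Set.indicator_apply]
    simp only [hW, e3]
    refine measurableSet_le measurable_const (Finset.measurable_fun_sum _ fun i _ => ?_)
    exact (measurable_one.indicator (measurableSet_lt (by fun_prop) (by fun_prop))).comp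
      (measurable_pi_apply i)
  rw [coarseLaw, Measure.prod_apply hDm]
  calc _ ≤ ∫⁻ x, (W.indicator 1 x + ENNReal.ofReal (γ / 2)) ∂(Measure.pi fun _ : Fin n => P) := by
        refine lintegral_mono fun x => ?_
        by_cases hx : x ∈ W
        · rw [Set.indicator_of_mem hx]
          exact prob_le_one.trans (by simp)
        · rw [Set.indicator_of_notMem hx, zero_add, Measure.prod_apply (measurable_prodMk_left hDm)]
          refine (lintegral_mono (g := fun _ => ENNReal.ofReal (γ / 2)) fun T => ?_).trans
            (by simp)
          set G : Finset (Fin n) := (Finset.univ.filter fun i => 5 < |x i - m|)ᶜ with hG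
          have hGcard : 0.835 * (n : ℝ) < G.card := by
            have h2 : ((Finset.univ.filter fun i => 5 < |x i - m|).card : ℝ) < 0.165 * n :=
              not_le.1 hx
            have h3 := Finset.card_compl_add_card (Finset.univ.filter fun i => 5 < |x i - m|)
            rw [Fintype.card_fin] at h3
            have h4 : (G.card : ℝ) + ((Finset.univ.filter fun i => 5 < |x i - m|).card : ℝ) = n := by
              exact_mod_cast h3
            linarith
          have hGm : ∀ i ∈ G, |x i - m| ≤ 5 := fun i hi => by
            simpa [hG] using hi
          refine (measure_mono fun ξ hξ => ?_).trans (pick_accuracy hε hγ hγ1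
            (r := labels (fun i => x i / 10) T) (G := G) (a := round (m / 10 - T - 1 / 2))
            (by exact_mod_cast hn0) hGcard (fun i hi => round_mem_of_abs_le ?_)
            (threshold_le hn1) hn3)
          · rintro ⟨i, hi, hpick⟩
            refine hξ ⟨?_, ?_⟩
            · change pick _ _ _ ≠ none
              rw [hpick]
              simp
            · have h5 := abs_center_sub_le (ε := ε) (δ := δ) (σ := 10) (by norm_num)
                (p := (x, T, ξ)) (i := i) hpick
              have h6 := abs_sub_le (center ε δ 10 (x, T, ξ)) (x i) m
              have h7 := hGm i hi
              simp only at h5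
              change |center ε δ 10 (x, T, ξ) - m| ≤ 10
              linarith
          · have e : x i / 10 - T - (m / 10 - T) = (x i - m) / 10 := by ring
            rw [e, abs_div, abs_of_pos (by norm_num : (0 : ℝ) < 10)]
            have := hGm i hi
            linarith
    _ = (Measure.pi fun _ : Fin n => P) W + ENNReal.ofReal (γ / 2) := by
        rw [lintegral_add_right _ measurable_const, lintegral_indicator_one hWm]
        simp
    _ ≤ ENNReal.ofReal (γ / 16) + ENNReal.ofReal (γ / 2) := by
        gcongr
        exact measure_outliers_le hγ hγ1 hI h1 hn2
    _ = ENNReal.ofReal (9 / 16 * γ) := by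
        rw [← ENNReal.ofReal_add (by positivity) (by positivity)]
        congr 1
        ring

/-! #### Symmetry of the coarse estimate -/

theorem map_reflect_eq {P : Measure ℝ} [IsProbabilityMeasure P] {m : ℝ}
    (h : IsSymmetricAbout P m) : P.map (fun x => 2 * m - x) = P := by
  have h1 : P.map (fun x => x - m) = P.map (fun x => m - x) := by
    have := Measure.isProbabilityMeasure_map (μ := P) (f := fun x : ℝ => x - m) (by fun_prop)
    refine Measure.ext_of_Iic _ _ fun t => ?_
    rw [Measure.map_apply (by fun_prop) measurableSet_Iic,
      Measure.map_apply (by fun_prop) measurableSet_Iic]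
    exact h t
  have h2 := congrArg (Measure.map fun x => x + m) h1
  rw [Measure.map_map (by fun_prop) (by fun_prop), Measure.map_map (by fun_prop) (by fun_prop)] at h2
  have e1 : (fun x : ℝ => x + m) ∘ (fun x => x - m) = id := by ext x; simp
  have e2 : (fun x : ℝ => x + m) ∘ (fun x => m - x) = fun x => 2 * m - x := by
    ext x; simp only [Function.comp]; ring
  rw [e1, e2, Measure.map_id] at h2
  exact h2.symm

/-- Reflection turns the offset interval into another interval of length 1, and a periodic function
has the same integral over every full period. -/
theorem lintegral_offset_reflect {h : ℝ → ENNReal} (hper : Function.Periodic h 1) (c : ℝ) :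
    ∫⁻ T, h (c - T) ∂offsetMeasure = ∫⁻ T, h T ∂offsetMeasure := by
  have key : ∀ t : ℝ, ∫⁻ T in Set.Ioc t (t + 1), h T =
      ∫⁻ b : UnitAddCircle, hper.lift b := fun t => by
    rw [← UnitAddCircle.lintegral_preimage t]
    rfl
  have h1 : ∫⁻ T, h T ∂offsetMeasure = ∫⁻ b : UnitAddCircle, hper.lift b := by
    rw [← key (-1 / 2), offsetMeasure, restrict_Ioc_eq_restrict_Icc]
    norm_num
  rw [h1, ← key (c - 1 / 2), offsetMeasure, restrict_Ioc_eq_restrict_Icc,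
    ← lintegral_indicator measurableSet_Icc, ← lintegral_indicator measurableSet_Icc,
    ← lintegral_sub_left_eq_self _ c]
  refine lintegral_congr fun T => ?_
  simp only [Set.indicator_apply, Set.mem_Icc, sub_sub_cancel]
  congr 1
  refine propext ⟨fun ⟨h1, h2⟩ => ⟨by linarith, by linarith⟩, fun ⟨h1, h2⟩ => ⟨by linarith, by linarith⟩⟩

theorem labels_add_one {n : ℕ} (z : Fin n → ℝ) (T : ℝ) :
    labels z (T + 1) = fun i => labels z T i + (-1) := by
  ext i
  rw [labels, labels, ← sub_sub, round_sub_one]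
  ring

theorem round_neg_eq {y : ℝ} (h : ∀ k : ℤ, y ≠ k - 1 / 2) : round (-y) = -round y := by
  rw [round_eq_iff]
  have h1 := (round_eq_iff (x := y)).1 rfl
  push_cast
  refine ⟨by linarith [h1.2], ?_⟩
  -- The half-open rounding convention is not symmetric; excluding left end points of buckets makes
  -- the required inequality strict.
  have := lt_of_le_of_ne h1.1 (h _).symm
  linarith

theorem labels_reflect {n : ℕ} {z : Fin n → ℝ} {T : ℝ} (h : ∀ i, ∀ k : ℤ, z i - T ≠ k - 1 / 2)
    (c : ℝ) : labels (fun i => c - z i) (c - T) = fun i => -labels z T i := by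
  ext i
  rw [labels, labels, ← round_neg_eq (h i)]
  congr 1
  ring

/-- The probability, given data and offset, that the coarse step succeeds with value in `B`. -/
noncomputable def hitProb (ε δ σ : ℝ) {n : ℕ} (B : Set ℝ) (x : Fin n → ℝ) (T : ℝ) : ENNReal :=
  (Measure.infinitePi fun _ : ℤ => laplaceMeasure (2 / ε))
    {ξ | ∃ k : ℤ, pick (threshold ε δ) (labels (fun i => x i / σ) T) ξ = some k ∧ σ * (T + k) ∈ B}

theorem measurableSet_pick_hit (thr σ T : ℝ) (B : Set ℝ) {n : ℕ} (r : Fin n → ℤ) :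
    MeasurableSet {ξ : ℤ → ℝ | ∃ k : ℤ, pick thr r ξ = some k ∧ σ * (T + k) ∈ B} :=
  measurable_pick_right thr r
    (MeasurableSet.of_discrete (s := {o : Option ℤ | ∃ k : ℤ, o = some k ∧ σ * (T + k) ∈ B}))

/-- Raising the offset by 1 lowers every label by 1, so the value T + k is unchanged. The noises are
relabelled without changing their law, and a translation respects the tie-breaking order. -/
theorem hitProb_periodic {ε : ℝ} (hε : 0 < ε) (δ σ : ℝ) {n : ℕ} (B : Set ℝ) (x : Fin n → ℝ) :
    Function.Periodic (hitProb ε δ σ B x) 1 := by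
  intro T
  have := isProbabilityMeasure_laplaceMeasure (b := 2 / ε) (by positivity)
  set e : ℤ ≃ ℤ := Equiv.addRight (-1) with he
  rw [hitProb, hitProb]
  conv_lhs => rw [← map_comp_equiv_infinitePi (laplaceMeasure (2 / ε)) e.symm]
  rw [Measure.map_apply (by fun_prop) (measurableSet_pick_hit _ _ _ _ _)]
  congr 1
  ext ξ
  simp only [Set.mem_preimage, Set.mem_ofPred_eq]
  have h1 : labels (fun i => x i / σ) (T + 1) = fun i => e (labels (fun i => x i / σ) T i) :=
    labels_add_one _ _
  rw [h1, pick_comp_equiv _ _ _ _ (fun j k hjk => Or.inl (by simpa [he] using hjk))]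
  simp only [Option.map_eq_some_iff]
  constructor
  · rintro ⟨k, ⟨a, ha, rfl⟩, hk⟩
    refine ⟨a, ha, ?_⟩
    convert hk using 2
    simp [he]
    ring
  · rintro ⟨a, ha, hk⟩
    refine ⟨_, ⟨a, ha, rfl⟩, ?_⟩
    convert hk using 2
    simp [he]
    ring

theorem hitProb_reflect {ε : ℝ} (hε : 0 < ε) (δ : ℝ) {σ : ℝ} (hσ : 0 < σ) {n : ℕ} (B : Set ℝ)
    (x : Fin n → ℝ) (m : ℝ) {T : ℝ} (hT : ∀ i, ∀ k : ℤ, x i / σ - T ≠ k - 1 / 2) :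
    hitProb ε δ σ B (fun i => 2 * m - x i) (2 * m / σ - T) =
      hitProb ε δ σ ((fun t => 2 * m - t) ⁻¹' B) x T := by
  have := isProbabilityMeasure_laplaceMeasure (b := 2 / ε) (by positivity)
  set e : ℤ ≃ ℤ := Equiv.neg ℤ with he
  rw [hitProb, hitProb]
  conv_lhs => rw [← map_comp_equiv_infinitePi (laplaceMeasure (2 / ε)) e.symm]
  rw [Measure.map_apply (by fun_prop) (measurableSet_pick_hit _ _ _ _ _)]
  set r := labels (fun i => x i / σ) T with hr
  have h1 : labels (fun i => (2 * m - x i) / σ) (2 * m / σ - T) = fun i => e (r i) := by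
    rw [hr]
    simp only [sub_div]
    exact labels_reflect hT (2 * m / σ)
  -- Negation reverses the order of the labels and would break a tie the other way, so the
  -- reflection is valid only off the null set of ties.
  have hae : ∀ᵐ ξ ∂(Measure.infinitePi fun _ : ℤ => laplaceMeasure (2 / ε)),
      ∀ j k : ℤ, j < k → hist r j + ξ j ≠ hist r k + ξ k := by
    rw [ae_all_iff]; intro j
    rw [ae_all_iff]; intro k
    by_cases hjk : j < k
    · rw [ae_iff]
      refine measure_mono_null (fun ξ hξ => ?_)
        (infinitePi_tie_eq_zero (laplaceMeasure (2 / ε)) hjk.ne (hist r j - hist r k))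
      have h2 : hist r j + ξ j = hist r k + ξ k := by
        by_contra hne
        exact hξ fun _ => hne
      change ξ k = ξ j + _
      linarith
    · exact Filter.Eventually.of_forall fun ξ h => absurd h hjk
  refine measure_congr ?_
  filter_upwards [hae] with ξ hξ
  refine propext ?_
  change (∃ k : ℤ, pick (threshold ε δ) (labels (fun i => (2 * m - x i) / σ) (2 * m / σ - T))
    (fun i => ξ (e.symm i)) = some k ∧ σ * (2 * m / σ - T + k) ∈ B) ↔
    ∃ k : ℤ, pick (threshold ε δ) r ξ = some k ∧ 2 * m - σ * (T + k) ∈ B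
  rw [h1, pick_comp_equiv _ _ _ _ (fun j k hjk => Or.inr (hξ j k hjk))]
  have h3 : ∀ a : ℤ, σ * (2 * m / σ - T + ((e a : ℤ) : ℝ)) = 2 * m - σ * (T + a) := by
    intro a
    simp only [he, Equiv.neg_apply, Int.cast_neg]
    field_simp
    ring
  simp only [Option.map_eq_some_iff]
  constructor
  · rintro ⟨k, ⟨a, ha, rfl⟩, hk⟩
    exact ⟨a, ha, h3 a ▸ hk⟩
  · rintro ⟨a, ha, hk⟩
    exact ⟨_, ⟨a, ha, rfl⟩, (h3 a).symm ▸ hk⟩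

theorem measurableSet_hit (ε δ σ : ℝ) (n : ℕ) {B : Set ℝ} (hB : MeasurableSet B) :
    MeasurableSet {p : (Fin n → ℝ) × ℝ × (ℤ → ℝ) | chosen ε δ σ p ≠ none ∧ center ε δ σ p ∈ B} :=
  (measurableSet_chosen ε δ σ n).inter (measurable_center ε δ σ n hB)

theorem coarseLaw_hit_eq {P : Measure ℝ} [IsProbabilityMeasure P] {ε : ℝ} (hε : 0 < ε) (δ σ : ℝ)
    (n : ℕ) {B : Set ℝ} (hB : MeasurableSet B) :
    coarseLaw P ε n {p | chosen ε δ σ p ≠ none ∧ center ε δ σ p ∈ B} =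
      ∫⁻ x, ∫⁻ T, hitProb ε δ σ B x T ∂offsetMeasure ∂(Measure.pi fun _ : Fin n => P) := by
  have := isProbabilityMeasure_laplaceMeasure (b := 2 / ε) (by positivity)
  have hm := measurableSet_hit ε δ σ n hB
  rw [coarseLaw, Measure.prod_apply hm]
  refine lintegral_congr fun x => ?_
  rw [Measure.prod_apply (measurable_prodMk_left hm)]
  refine lintegral_congr fun T => ?_
  rw [hitProb]
  congr 1
  ext ξ
  simp only [Set.mem_preimage, Set.mem_ofPred_eq, center]
  change (pick (threshold ε δ) (labels (fun i => x i / σ) T) ξ ≠ none ∧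
    σ * (T + ((pick (threshold ε δ) (labels (fun i => x i / σ) T) ξ).getD 0 : ℤ)) ∈ B) ↔ _
  cases pick (threshold ε δ) (labels (fun i => x i / σ) T) ξ <;> simp

theorem measurable_lintegral_hitProb {ε : ℝ} (hε : 0 < ε) (δ σ : ℝ) (n : ℕ) {B : Set ℝ}
    (hB : MeasurableSet B) :
    Measurable fun x : Fin n → ℝ => ∫⁻ T, hitProb ε δ σ B x T ∂offsetMeasure := by
  have := isProbabilityMeasure_laplaceMeasure (b := 2 / ε) (by positivity)
  have hm := measurableSet_hit ε δ σ n hB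
  have h := measurable_measure_prodMk_left
    (ν := offsetMeasure.prod (Measure.infinitePi fun _ : ℤ => laplaceMeasure (2 / ε))) hm
  convert h using 2 with x
  rw [Measure.prod_apply (measurable_prodMk_left hm)]
  refine lintegral_congr fun T => ?_
  rw [hitProb]
  congr 1
  ext ξ
  simp only [Set.mem_preimage, Set.mem_ofPred_eq, center]
  change _ ↔ (pick (threshold ε δ) (labels (fun i => x i / σ) T) ξ ≠ none ∧
    σ * (T + ((pick (threshold ε δ) (labels (fun i => x i / σ) T) ξ).getD 0 : ℤ)) ∈ B)
  cases pick (threshold ε δ) (labels (fun i => x i / σ) T) ξ <;> simp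

/-- Data and offset are reflected together. The data law is invariant by symmetry of P, the offset
law by periodicity; points on bucket boundaries occur only for a null set of offsets. -/
theorem coarseLaw_hit_reflect {P : Measure ℝ} [IsProbabilityMeasure P] {m : ℝ}
    (hP : IsSymmetricAbout P m) {ε : ℝ} (hε : 0 < ε) (δ : ℝ) {σ : ℝ} (hσ : 0 < σ) (n : ℕ)
    {B : Set ℝ} (hB : MeasurableSet B) :
    coarseLaw P ε n {p | chosen ε δ σ p ≠ none ∧ center ε δ σ p ∈ (fun t => 2 * m - t) ⁻¹' B} =
      coarseLaw P ε n {p | chosen ε δ σ p ≠ none ∧ center ε δ σ p ∈ B} := by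
  have hB' : MeasurableSet ((fun t => 2 * m - t) ⁻¹' B) := (measurable_id.const_sub (2 * m)) hB
  rw [coarseLaw_hit_eq hε δ σ n hB', coarseLaw_hit_eq hε δ σ n hB]
  have hpi : (Measure.pi fun _ : Fin n => P).map (fun x i => 2 * m - x i) =
      Measure.pi fun _ : Fin n => P := by
    have : IsProbabilityMeasure (P.map fun x => 2 * m - x) :=
      Measure.isProbabilityMeasure_map (by fun_prop)
    rw [Measure.pi_map_pi (μ := fun _ : Fin n => P) (f := fun _ x => 2 * m - x)
      (fun _ => by fun_prop)]
    simp_rw [map_reflect_eq hP]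
  conv_rhs => rw [← hpi]
  rw [lintegral_map (measurable_lintegral_hitProb hε δ σ n hB) (by fun_prop)]
  refine lintegral_congr fun x => ?_
  rw [← lintegral_offset_reflect (hitProb_periodic hε δ σ B _) (2 * m / σ)]
  refine lintegral_congr_ae ?_
  have hae : ∀ᵐ T ∂offsetMeasure, ∀ i, ∀ k : ℤ, x i / σ - T ≠ k - 1 / 2 := by
    rw [ae_all_iff]; intro i
    rw [ae_all_iff]; intro k
    refine ae_restrict_of_ae ?_
    rw [ae_iff]
    refine measure_mono_null (t := {x i / σ - (k - 1 / 2)}) (fun T hT => ?_) (measure_singleton _)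
    have h1 : x i / σ - T = k - 1 / 2 := by
      by_contra h; exact hT h
    rw [Set.mem_singleton_iff]
    linarith
  filter_upwards [hae] with T hT
  exact (hitProb_reflect hε δ hσ B x m hT).symm

/-! ### Rearranging products -/

/-- This regroups data and noise according to whether the coarse step uses them. -/
theorem measurePreserving_prodProdProdComm {α β γ η : Type*} [MeasurableSpace α]
    [MeasurableSpace β] [MeasurableSpace γ] [MeasurableSpace η] (μ : Measure α) (ν : Measure β)
    (ρ : Measure γ) (τ : Measure η) [IsProbabilityMeasure μ] [IsProbabilityMeasure ν]
    [IsProbabilityMeasure ρ] [IsProbabilityMeasure τ] :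
    MeasurePreserving (fun p : (α × β) × (γ × η) => ((p.1.1, p.2.1), (p.1.2, p.2.2)))
      ((μ.prod ν).prod (ρ.prod τ)) ((μ.prod ρ).prod (ν.prod τ)) := by
  have hm : Measurable (fun p : (α × β) × (γ × η) => ((p.1.1, p.2.1), (p.1.2, p.2.2))) := by
    fun_prop
  refine ⟨hm, (Measure.prod_eq fun s t hs ht => ?_).symm⟩
  rw [Measure.map_apply hm (hs.prod ht), Measure.prod_apply (hm (hs.prod ht)),
    Measure.prod_apply hs, Measure.prod_apply ht,
    ← lintegral_prod_mul (measurable_measure_prodMk_left hs).aemeasurable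
      (measurable_measure_prodMk_left ht).aemeasurable]
  refine lintegral_congr fun p => ?_
  rw [← Measure.prod_prod]
  rfl

theorem measurePreserving_split (P : Measure ℝ) [IsProbabilityMeasure P] (n₁ n₂ : ℕ) :
    MeasurePreserving (fun x : Fin (n₁ + n₂) → ℝ =>
        ((fun i => x (Fin.castAdd n₂ i) : Fin n₁ → ℝ), (fun i => x (Fin.natAdd n₁ i) : Fin n₂ → ℝ)))
      (Measure.pi fun _ => P) ((Measure.pi fun _ => P).prod (Measure.pi fun _ => P)) := by
  have hm : Measurable (fun x : Fin (n₁ + n₂) → ℝ =>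
    ((fun i => x (Fin.castAdd n₂ i) : Fin n₁ → ℝ), (fun i => x (Fin.natAdd n₁ i) : Fin n₂ → ℝ))) := by
    fun_prop
  have ha : Measurable fun q : (Fin n₁ → ℝ) × (Fin n₂ → ℝ) => Fin.append q.1 q.2 := by
    rw [measurable_pi_iff]
    intro i
    refine Fin.addCases (fun j => ?_) (fun j => ?_) i
    · simp only [Fin.append_left]; fun_prop
    · simp only [Fin.append_right]; fun_prop
  have h1 : (Measure.pi fun _ : Fin (n₁ + n₂) => P) =
      ((Measure.pi fun _ : Fin n₁ => P).prod (Measure.pi fun _ : Fin n₂ => P)).map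
        fun q => Fin.append q.1 q.2 := by
    refine Measure.pi_eq fun s hs => ?_
    rw [Measure.map_apply ha (.univ_pi hs)]
    have : (fun q : (Fin n₁ → ℝ) × (Fin n₂ → ℝ) => Fin.append q.1 q.2) ⁻¹' (Set.univ.pi s) =
        (Set.univ.pi fun i => s (Fin.castAdd n₂ i)) ×ˢ (Set.univ.pi fun i => s (Fin.natAdd n₁ i)) := by
      ext q
      simp only [Set.mem_preimage, Set.mem_univ_pi, Set.mem_prod]
      constructor
      · intro h
        exact ⟨fun i => by simpa using h (Fin.castAdd n₂ i),
          fun i => by simpa using h (Fin.natAdd n₁ i)⟩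
      · rintro ⟨h1, h2⟩ i
        refine Fin.addCases (fun j => ?_) (fun j => ?_) i
        · simpa using h1 j
        · simpa using h2 j
    rw [this, Measure.prod_prod, Measure.pi_pi, Measure.pi_pi, Fin.prod_univ_add]
  refine ⟨hm, ?_⟩
  rw [h1, Measure.map_map hm ha]
  convert Measure.map_id using 2
  ext q i <;> simp

/-- The law of the data and the random choices used after the coarse step. -/
noncomputable def tailLaw (P : Measure ℝ) (p : unitInterval) (b : ℝ) (n : ℕ) :
    Measure ((Fin n → ℝ) × (Fin n → ℝ) × ℝ) :=
  (Measure.pi fun _ : Fin n => P).prod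
    ((Measure.pi fun _ : Fin n => bernoulliMeasure (1 : ℝ) 0 p).prod (laplaceMeasure b))

theorem isProbabilityMeasure_coarseLaw (P : Measure ℝ) [IsProbabilityMeasure P] {ε : ℝ}
    (hε : 0 < ε) (n : ℕ) : IsProbabilityMeasure (coarseLaw P ε n) := by
  have := isProbabilityMeasure_laplaceMeasure (b := 2 / ε) (by positivity)
  unfold coarseLaw
  infer_instance

theorem isProbabilityMeasure_tailLaw (P : Measure ℝ) [IsProbabilityMeasure P] (p : unitInterval)
    {b : ℝ} (hb : 0 < b) (n : ℕ) : IsProbabilityMeasure (tailLaw P p b n) := by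
  have := isProbabilityMeasure_laplaceMeasure hb
  unfold tailLaw
  infer_instance

/-- The inputs of the coarse step. -/
def headPart {n₁ n₂ : ℕ} (z : (Fin (n₁ + n₂) → ℝ) × Noise n₂) : (Fin n₁ → ℝ) × ℝ × (ℤ → ℝ) :=
  (fun i => z.1 (Fin.castAdd n₂ i), z.2.1, z.2.2.1)

/-- The inputs not used by the coarse step. -/
def tailPart {n₁ n₂ : ℕ} (z : (Fin (n₁ + n₂) → ℝ) × Noise n₂) : (Fin n₂ → ℝ) × (Fin n₂ → ℝ) × ℝ :=
  (fun i => z.1 (Fin.natAdd n₁ i), z.2.2.2.1, z.2.2.2.2)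

theorem measurePreserving_headPart_tailPart (P : Measure ℝ) [IsProbabilityMeasure P]
    {ε δ c : ℝ} (hε : 0 < ε) (n₁ : ℕ) {n₂ : ℕ} (hb : 0 < 2 * c / (n₂ * ε)) :
    MeasurePreserving (fun z : (Fin (n₁ + n₂) → ℝ) × Noise n₂ => (headPart z, tailPart z))
      (jointLaw P ε δ c n₁ n₂)
      ((coarseLaw P ε n₁).prod
        (tailLaw P (Set.projIcc 0 1 zero_le_one δ) (2 * c / (n₂ * ε)) n₂)) := by
  have := isProbabilityMeasure_laplaceMeasure (b := 2 / ε) (by positivity)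
  have := isProbabilityMeasure_laplaceMeasure hb
  have h1 := (measurePreserving_split P n₁ n₂).prod
    (measurePreserving_prodAssoc offsetMeasure
      (Measure.infinitePi fun _ : ℤ => laplaceMeasure (2 / ε))
      ((Measure.pi fun _ : Fin n₂ =>
          bernoulliMeasure (1 : ℝ) 0 (Set.projIcc 0 1 zero_le_one δ)).prod
        (laplaceMeasure (2 * c / (n₂ * ε))))).symm
  exact (measurePreserving_prodProdProdComm _ _ _ _).comp h1

/-! ### Second moments of sums -/

theorem integral_sq_sum_pi {n : ℕ} {ν : Fin n → Measure ℝ} [∀ i, IsProbabilityMeasure (ν i)]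
    {X : Fin n → ℝ → ℝ} (h : ∀ i, MemLp (X i) 2 (ν i)) (h0 : ∀ i, ∫ x, X i x ∂(ν i) = 0) :
    ∫ y, (∑ i, X i (y i)) ^ 2 ∂(Measure.pi ν) = ∑ i, ∫ x, X i x ^ 2 ∂(ν i) := by
  have hL : ∀ i, MemLp (fun y : Fin n → ℝ => X i (y i)) 2 (Measure.pi ν) := fun i =>
    (h i).comp_measurePreserving (measurePreserving_eval _ i)
  have hS : MemLp (∑ i, fun y : Fin n → ℝ => X i (y i)) 2 (Measure.pi ν) :=
    memLp_finsetSum' _ fun i _ => hL i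
  have h0' : ∀ i, ∫ y, X i (y i) ∂(Measure.pi ν) = 0 := fun i => by
    rw [integral_comp_eval (h i).aestronglyMeasurable, h0 i]
  have hv := variance_sum_pi h
  rw [variance_of_integral_eq_zero hS.aestronglyMeasurable.aemeasurable] at hv
  · simp only [Finset.sum_apply] at hv
    rw [hv]
    refine Finset.sum_congr rfl fun i _ => ?_
    rw [variance_of_integral_eq_zero (h i).aestronglyMeasurable.aemeasurable (h0 i)]
  · simp only [Finset.sum_apply]
    rw [integral_finsetSum _ fun i _ => (hL i).integrable one_le_two]
    simp [h0']

theorem memLp_sum_pi {n : ℕ} {ν : Fin n → Measure ℝ} [∀ i, IsProbabilityMeasure (ν i)]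
    {X : Fin n → ℝ → ℝ} (h : ∀ i, MemLp (X i) 2 (ν i)) :
    MemLp (fun y : Fin n → ℝ => ∑ i, X i (y i)) 2 (Measure.pi ν) :=
  memLp_finsetSum _ fun i _ => (h i).comp_measurePreserving (measurePreserving_eval _ i)

theorem integral_sum_pi {n : ℕ} {ν : Fin n → Measure ℝ} [∀ i, IsProbabilityMeasure (ν i)]
    {X : Fin n → ℝ → ℝ} (h : ∀ i, Integrable (X i) (ν i)) :
    ∫ y, ∑ i, X i (y i) ∂(Measure.pi ν) = ∑ i, ∫ x, X i x ∂(ν i) := by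
  rw [integral_finsetSum _ fun i _ => integrable_comp_eval (h i)]
  exact Finset.sum_congr rfl fun i _ => integral_comp_eval (h i).aestronglyMeasurable

/-- All cross terms vanish because the two random terms are independent and centred. -/
theorem integral_sq_add_add_const {α β : Type*} [MeasurableSpace α] [MeasurableSpace β]
    {μ : Measure α} {ν : Measure β} [IsProbabilityMeasure μ] [IsProbabilityMeasure ν]
    {u : α → ℝ} {v : β → ℝ} (hu : MemLp u 2 μ) (hv : MemLp v 2 ν) (hu0 : ∫ x, u x ∂μ = 0)
    (hv0 : ∫ y, v y ∂ν = 0) (a : ℝ) :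
    ∫ z, (u z.1 + v z.2 + a) ^ 2 ∂(μ.prod ν) =
      ∫ x, u x ^ 2 ∂μ + ∫ y, v y ^ 2 ∂ν + a ^ 2 := by
  have hu1 := hu.integrable one_le_two
  have hv1 := hv.integrable one_le_two
  have e : ∀ z : α × β, (u z.1 + v z.2 + a) ^ 2 =
      u z.1 ^ 2 + v z.2 ^ 2 + 2 * (u z.1 * v z.2) + 2 * a * u z.1 + 2 * a * v z.2 + a ^ 2 := by
    intro z; ring
  simp_rw [e]
  have i1 : Integrable (fun z : α × β => u z.1 ^ 2) (μ.prod ν) := hu.integrable_sq.comp_fst ν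
  have i2 : Integrable (fun z : α × β => v z.2 ^ 2) (μ.prod ν) := hv.integrable_sq.comp_snd μ
  have i3 : Integrable (fun z : α × β => 2 * (u z.1 * v z.2)) (μ.prod ν) :=
    (hu1.mul_prod hv1).const_mul 2
  have i4 : Integrable (fun z : α × β => 2 * a * u z.1) (μ.prod ν) :=
    (hu1.comp_fst ν).const_mul (2 * a)
  have i5 : Integrable (fun z : α × β => 2 * a * v z.2) (μ.prod ν) :=
    (hv1.comp_snd μ).const_mul (2 * a)
  have j2 : Integrable (fun z : α × β => u z.1 ^ 2 + v z.2 ^ 2) (μ.prod ν) := i1.add i2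
  have j3 : Integrable (fun z : α × β => u z.1 ^ 2 + v z.2 ^ 2 + 2 * (u z.1 * v z.2))
    (μ.prod ν) := j2.add i3
  have j4 : Integrable (fun z : α × β => u z.1 ^ 2 + v z.2 ^ 2 + 2 * (u z.1 * v z.2) +
    2 * a * u z.1) (μ.prod ν) := j3.add i4
  have j5 : Integrable (fun z : α × β => u z.1 ^ 2 + v z.2 ^ 2 + 2 * (u z.1 * v z.2) +
    2 * a * u z.1 + 2 * a * v z.2) (μ.prod ν) := j4.add i5
  rw [integral_add j5 (integrable_const _), integral_add j4 i5, integral_add j3 i4,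
    integral_add j2 i3, integral_add i1 i2, integral_const_mul, integral_const_mul,
    integral_const_mul, integral_prod_mul, integral_fun_fst (fun x => u x ^ 2),
    integral_fun_snd (fun y => v y ^ 2), integral_fun_fst, integral_fun_snd, hu0, hv0]
  simp

/-! ### The clipped mean -/

theorem measurable_clip (a b : ℝ) : Measurable (clip a b) := by
  unfold clip; fun_prop

theorem abs_clip_sub_clip_le (a b x y : ℝ) : |clip a b x - clip a b y| ≤ |x - y| := by
  unfold clip
  refine (abs_max_sub_max_le_max a (min b x) a (min b y)).trans ?_
  refine max_le (by simp) ((abs_min_sub_min_le_max b x b y).trans (by simp))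

theorem clip_reflect (t c m x : ℝ) (hc : 0 ≤ c) :
    clip (2 * m - t - c) (2 * m - t + c) x = 2 * m - clip (t - c) (t + c) (2 * m - x) := by
  unfold clip
  rcases le_total (2 * m - t + c) x with h1 | h1 <;>
    rcases le_total (t + c) (2 * m - x) with h2 | h2 <;>
    simp only [h1, h2, min_eq_left, min_eq_right] <;>
    simp only [max_def] <;> split_ifs <;> linarith

theorem abs_clip_sub_le {t c m x : ℝ} (hc : 0 ≤ c) : |clip (t - c) (t + c) x - m| ≤
    |x - m| + |t - m| := by
  unfold clip
  rw [abs_le]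
  have h1 := abs_le.1 (le_refl |x - m|)
  have h2 := abs_le.1 (le_refl |t - m|)
  have h3 := abs_nonneg (x - m)
  have h4 := abs_nonneg (t - m)
  rcases le_total (t + c) x with h | h <;> simp only [h, min_eq_left, min_eq_right] <;>
    simp only [max_def] <;> split_ifs <;> constructor <;> linarith

/-- The output of the algorithm when the coarse estimate is `t`. -/
noncomputable def clippedMean (c : ℝ) {n : ℕ} (t : ℝ) (r : (Fin n → ℝ) × (Fin n → ℝ) × ℝ) : ℝ :=
  1 / n * (∑ i, clip (t - c) (t + c) (r.1 i)) + r.2.2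

/-- The output of the algorithm when the coarse step fails. -/
noncomputable def nameAndShame (δ : ℝ) {n : ℕ} (r : (Fin n → ℝ) × (Fin n → ℝ) × ℝ) : ℝ :=
  1 / (n * δ) * ∑ i, r.1 i * r.2.1 i

/-- The bias of a clipped sample. -/
noncomputable def clipBias (P : Measure ℝ) (m c t : ℝ) : ℝ :=
  ∫ x, clip (t - c) (t + c) x ∂P - m

section Statistics

variable {P : Measure ℝ} {m : ℝ}

theorem memLp_sub_of_integrable_sq (hI : Integrable (fun x => (x - m) ^ 2) P) :
    MemLp (fun x => x - m) 2 P :=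
  (memLp_two_iff_integrable_sq (by fun_prop)).2 hI

/-- The error decomposition into centred sampling noise, Laplace noise and deterministic bias, from
which the first two moments are read off. -/
theorem clippedMean_sub_eq {n : ℕ} (hn : n ≠ 0) (c t : ℝ) (r : (Fin n → ℝ) × (Fin n → ℝ) × ℝ) :
    clippedMean c t r - m =
      (∑ i, (clip (t - c) (t + c) (r.1 i) - ∫ x, clip (t - c) (t + c) x ∂P) / n) + r.2.2 +
        clipBias P m c t := by
  have hn' : (n : ℝ) ≠ 0 := Nat.cast_ne_zero.2 hn
  rw [clippedMean, clipBias, ← Finset.sum_div, Finset.sum_sub_distrib]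
  simp only [Finset.sum_const, Finset.card_univ, Fintype.card_fin, nsmul_eq_mul]
  field_simp
  ring

variable [IsProbabilityMeasure P]

theorem integrable_of_integrable_sq (hI : Integrable (fun x => (x - m) ^ 2) P) :
    Integrable (fun x : ℝ => x) P := by
  have := ((memLp_sub_of_integrable_sq hI).integrable one_le_two).add (integrable_const m)
  refine this.congr (Filter.Eventually.of_forall fun x => ?_)
  simp

theorem integral_id_eq_of_symmetric (hP : IsSymmetricAbout P m)
    (hI : Integrable (fun x => (x - m) ^ 2) P) : ∫ x, x ∂P = m := by
  have h1 : ∫ x, x ∂P = ∫ x, (2 * m - x) ∂P := by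
    conv_lhs => rw [← map_reflect_eq hP]
    rw [integral_map (by fun_prop) (by fun_prop)]
  rw [integral_sub (integrable_const _) (integrable_of_integrable_sq hI)] at h1
  simp at h1
  linarith

theorem memLp_clip (hI : Integrable (fun x => (x - m) ^ 2) P) (a b : ℝ) :
    MemLp (clip a b) 2 P := by
  have h1 : MemLp (fun x => clip a b x - clip a b m) 2 P :=
    (memLp_sub_of_integrable_sq hI).mono
      ((measurable_clip a b).sub_const _).aestronglyMeasurable
      (Filter.Eventually.of_forall fun x => abs_clip_sub_clip_le a b x m)
  have h2 := h1.add (memLp_const (clip a b m))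
  refine h2.ae_eq (Filter.Eventually.of_forall fun x => ?_)
  simp

theorem variance_clip_le (hI : Integrable (fun x => (x - m) ^ 2) P)
    (h1 : ∫ x, (x - m) ^ 2 ∂P ≤ 1) (a b : ℝ) : Var[clip a b; P] ≤ 1 := by
  have hm := (measurable_clip a b).aestronglyMeasurable (μ := P)
  rw [← variance_sub_const hm (clip a b m)]
  refine (variance_le_expectation_sq (hm.sub aestronglyMeasurable_const)).trans (le_trans ?_ h1)
  refine integral_mono_of_nonneg (Filter.Eventually.of_forall fun x => sq_nonneg _) hI
    (Filter.Eventually.of_forall fun x => ?_)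
  exact sq_le_sq.2 (abs_clip_sub_clip_le a b x m)

/-- Reflecting sample and clipping window together reflects the clipped value, and the sample law is
unchanged. Together with the symmetry of the window centre, this oddness makes the output unbiased.
-/
theorem clipBias_reflect (hP : IsSymmetricAbout P m) (hI : Integrable (fun x => (x - m) ^ 2) P)
    {c : ℝ} (hc : 0 ≤ c) (t : ℝ) : clipBias P m c (2 * m - t) = -clipBias P m c t := by
  rw [clipBias, clipBias]
  have h1 : ∫ x, clip (2 * m - t - c) (2 * m - t + c) x ∂P =
      ∫ x, (2 * m - clip (t - c) (t + c) (2 * m - x)) ∂P :=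
    integral_congr_ae (Filter.Eventually.of_forall fun x => clip_reflect t c m x hc)
  have h2 : ∫ x, (2 * m - clip (t - c) (t + c) (2 * m - x)) ∂P =
      ∫ x, (2 * m - clip (t - c) (t + c) x) ∂P := by
    conv_rhs => rw [← map_reflect_eq hP]
    rw [integral_map (by fun_prop)
      ((measurable_clip _ _).const_sub _).aestronglyMeasurable]
  rw [h1, h2, integral_sub (integrable_const _) ((memLp_clip hI _ _).integrable one_le_two)]
  simp
  ring

theorem clipBias_eq (hI : Integrable (fun x => (x - m) ^ 2) P) (hm : ∫ x, x ∂P = m) (c t : ℝ) :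
    clipBias P m c t = ∫ x, (clip (t - c) (t + c) x - x) ∂P := by
  rw [integral_sub ((memLp_clip hI _ _).integrable one_le_two) (integrable_of_integrable_sq hI),
    hm, clipBias]

theorem integral_abs_sub_le_one (hI : Integrable (fun x => (x - m) ^ 2) P)
    (h1 : ∫ x, (x - m) ^ 2 ∂P ≤ 1) : ∫ x, |x - m| ∂P ≤ 1 := by
  have hL := ((memLp_sub_of_integrable_sq hI).integrable one_le_two).abs
  calc ∫ x, |x - m| ∂P ≤ ∫ x, (1 + (x - m) ^ 2) / 2 ∂P := by
        refine integral_mono hL (((integrable_const 1).add hI).div_const 2) fun x => ?_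
        have := sq_nonneg (|x - m| - 1)
        have h2 := sq_abs (x - m)
        simp only
        nlinarith
    _ = (1 + ∫ x, (x - m) ^ 2 ∂P) / 2 := by
        rw [integral_div, integral_add (integrable_const 1) hI]
        simp
    _ ≤ 1 := by linarith

theorem abs_clipBias_le (hI : Integrable (fun x => (x - m) ^ 2) P)
    (h1 : ∫ x, (x - m) ^ 2 ∂P ≤ 1) {c : ℝ} (hc : 0 ≤ c) (t : ℝ) :
    |clipBias P m c t| ≤ 1 + |t - m| := by
  have hL := (memLp_sub_of_integrable_sq hI).integrable one_le_two
  have hC := (memLp_clip hI (t - c) (t + c)).integrable one_le_two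
  have e : clipBias P m c t = ∫ x, (clip (t - c) (t + c) x - m) ∂P := by
    rw [integral_sub hC (integrable_const m), clipBias]
    simp
  rw [e]
  calc |∫ x, (clip (t - c) (t + c) x - m) ∂P| ≤ ∫ x, |clip (t - c) (t + c) x - m| ∂P :=
        abs_integral_le_integral_abs
    _ ≤ ∫ x, (|x - m| + |t - m|) ∂P := by
        refine integral_mono (hC.sub (integrable_const m)).abs (hL.abs.add (integrable_const _))
          fun x => abs_clip_sub_le hc
    _ = ∫ x, |x - m| ∂P + |t - m| := by
        rw [integral_add hL.abs (integrable_const _)]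
        simp
    _ ≤ 1 + |t - m| := by
        gcongr
        exact integral_abs_sub_le_one hI h1

/-- The window contains every point within w of m, so clipping moves only points farther away, and
by at most |x − m| since m itself lies in the window. For those, |x − m| ≤ |x − m|^λ / w^{λ−1}. -/
theorem abs_clip_sub_self_le {m c t w lam x : ℝ} (hw : 0 < w) (hlam : 1 ≤ lam)
    (ht : |t - m| ≤ c - w) : |clip (t - c) (t + c) x - x| ≤ |x - m| ^ lam / w ^ (lam - 1) := by
  have h0 : 0 ≤ |x - m| ^ lam / w ^ (lam - 1) := by positivity
  obtain ⟨t1, t2⟩ := abs_le.1 ht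
  have h1 : |x - m| ≤ w → clip (t - c) (t + c) x = x := by
    intro h
    obtain ⟨x1, x2⟩ := abs_le.1 h
    rw [clip, min_eq_right (by linarith), max_eq_right (by linarith)]
  rcases le_or_gt |x - m| w with h | h
  · rw [h1 h, sub_self, abs_zero]
    exact h0
  · have h2 : |clip (t - c) (t + c) x - x| ≤ |x - m| := by
      have x1 := le_abs_self (x - m)
      have x2 := neg_abs_le (x - m)
      unfold clip
      rw [abs_le]
      rcases le_total (t + c) x with h | h <;> simp only [h, min_eq_left, min_eq_right] <;>
        simp only [max_def] <;> split_ifs <;> constructor <;> linarith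
    refine h2.trans ?_
    have h3 : w ^ (lam - 1) ≤ |x - m| ^ (lam - 1) :=
      Real.rpow_le_rpow hw.le h.le (by linarith)
    rw [le_div_iff₀ (by positivity)]
    calc |x - m| * w ^ (lam - 1) ≤ |x - m| * |x - m| ^ (lam - 1) := by gcongr
      _ = |x - m| ^ lam := by
          rw [← Real.rpow_one_add' (abs_nonneg _) (by linarith)]
          congr 1
          ring

theorem abs_clipBias_le_of_near {lam ψ w c t : ℝ} (hI : Integrable (fun x => (x - m) ^ 2) P)
    (hm : ∫ x, x ∂P = m) (hIl : Integrable (fun x => |x - m| ^ lam) P)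
    (hl : ∫ x, |x - m| ^ lam ∂P ≤ ψ ^ lam) (hw : 0 < w) (hlam : 1 ≤ lam) (ht : |t - m| ≤ c - w) :
    |clipBias P m c t| ≤ ψ ^ lam / w ^ (lam - 1) := by
  rw [clipBias_eq hI hm]
  calc |∫ x, (clip (t - c) (t + c) x - x) ∂P| ≤ ∫ x, |clip (t - c) (t + c) x - x| ∂P :=
        abs_integral_le_integral_abs
    _ ≤ ∫ x, |x - m| ^ lam / w ^ (lam - 1) ∂P := by
        refine integral_mono (((memLp_clip hI _ _).integrable one_le_two).sub
          (integrable_of_integrable_sq hI)).abs (hIl.div_const _)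
          fun x => abs_clip_sub_self_le hw hlam ht
    _ = (∫ x, |x - m| ^ lam ∂P) / w ^ (lam - 1) := integral_div _ _
    _ ≤ ψ ^ lam / w ^ (lam - 1) := by gcongr

variable {p : unitInterval} {b : ℝ} {n : ℕ}

theorem memLp_centered_clip (hI : Integrable (fun x => (x - m) ^ 2) P) (a b : ℝ) (n : ℕ) :
    MemLp (fun x => (clip a b x - ∫ x, clip a b x ∂P) / n) 2 P := by
  have := ((memLp_clip hI a b).sub (memLp_const (∫ x, clip a b x ∂P))).const_mul ((n : ℝ)⁻¹)
  refine this.ae_eq (Filter.Eventually.of_forall fun x => ?_)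
  simp only [Pi.sub_apply]
  ring

theorem integral_centered_clip (hI : Integrable (fun x => (x - m) ^ 2) P) (a b : ℝ) (n : ℕ) :
    ∫ x, (clip a b x - ∫ x, clip a b x ∂P) / n ∂P = 0 := by
  rw [integral_div, integral_sub ((memLp_clip hI a b).integrable one_le_two) (integrable_const _)]
  simp

theorem integral_sq_clippedMean_le (hI : Integrable (fun x => (x - m) ^ 2) P)
    (h1 : ∫ x, (x - m) ^ 2 ∂P ≤ 1) (hb : 0 < b) (hn : n ≠ 0) (c t : ℝ) :
    ∫ r, (clippedMean c t r - m) ^ 2 ∂(tailLaw P p b n) ≤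
      1 / n + 2 * b ^ 2 + clipBias P m c t ^ 2 := by
  have := isProbabilityMeasure_laplaceMeasure hb
  have hn' : (0 : ℝ) < n := Nat.cast_pos.2 (Nat.pos_of_ne_zero hn)
  simp_rw [clippedMean_sub_eq (P := P) (m := m) hn c t]
  have hX := memLp_centered_clip hI (t - c) (t + c) n
  have hX0 := integral_centered_clip hI (t - c) (t + c) n
  have hl := (memLp_two_laplaceMeasure hb).comp_snd
    (Measure.pi fun _ : Fin n => bernoulliMeasure (1 : ℝ) 0 p)
  rw [tailLaw, integral_sq_add_add_const (memLp_sum_pi fun _ : Fin n => hX) hl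
    (by rw [integral_sum_pi fun _ : Fin n => hX.integrable one_le_two]; simp [hX0])
    (by rw [integral_fun_snd (fun x : ℝ => x), integral_id_laplaceMeasure]; simp),
    integral_sq_sum_pi (fun _ : Fin n => hX) (fun _ => hX0),
    integral_fun_snd (fun x : ℝ => x ^ 2), integral_sq_laplaceMeasure hb]
  have hv : ∫ x, ((clip (t - c) (t + c) x - ∫ x, clip (t - c) (t + c) x ∂P) / n) ^ 2 ∂P ≤
      1 / (n : ℝ) ^ 2 := by
    simp_rw [div_pow]
    rw [integral_div, ← variance_eq_integral (measurable_clip _ _).aemeasurable]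
    gcongr
    exact variance_clip_le hI h1 _ _
  simp only [Finset.sum_const, Finset.card_univ, Fintype.card_fin, nsmul_eq_mul, probReal_univ,
    one_smul]
  have : (n : ℝ) * (1 / (n : ℝ) ^ 2) = 1 / n := by field_simp
  nlinarith

theorem integral_clippedMean (hI : Integrable (fun x => (x - m) ^ 2) P) (hb : 0 < b) (hn : n ≠ 0)
    (c t : ℝ) : ∫ r, clippedMean c t r ∂(tailLaw P p b n) = clipBias P m c t + m := by
  have := isProbabilityMeasure_laplaceMeasure hb
  have hX := memLp_centered_clip hI (t - c) (t + c) n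
  have hX0 := integral_centered_clip hI (t - c) (t + c) n
  have e : ∀ r : (Fin n → ℝ) × (Fin n → ℝ) × ℝ, clippedMean c t r =
      (∑ i, (clip (t - c) (t + c) (r.1 i) - ∫ x, clip (t - c) (t + c) x ∂P) / n) + r.2.2 +
        (clipBias P m c t + m) := fun r => by
    have := clippedMean_sub_eq (P := P) (m := m) hn c t r
    linarith
  simp_rw [e]
  have hl := (memLp_two_laplaceMeasure hb).comp_snd
    (Measure.pi fun _ : Fin n => bernoulliMeasure (1 : ℝ) 0 p)
  have i1 := ((memLp_sum_pi fun _ : Fin n => hX).integrable one_le_two).comp_fst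
    ((Measure.pi fun _ : Fin n => bernoulliMeasure (1 : ℝ) 0 p).prod (laplaceMeasure b))
  have i2 := (hl.integrable one_le_two).comp_snd (Measure.pi fun _ : Fin n => P)
  have i3 : Integrable (fun r : (Fin n → ℝ) × (Fin n → ℝ) × ℝ =>
      (∑ i, (clip (t - c) (t + c) (r.1 i) - ∫ x, clip (t - c) (t + c) x ∂P) / n) + r.2.2)
      ((Measure.pi fun _ : Fin n => P).prod
        ((Measure.pi fun _ : Fin n => bernoulliMeasure (1 : ℝ) 0 p).prod (laplaceMeasure b))) :=
    i1.add i2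
  rw [tailLaw, integral_add i3 (integrable_const _), integral_add i1 i2,
    integral_fun_fst (fun y : Fin n → ℝ => ∑ i, (clip (t - c) (t + c) (y i) -
      ∫ x, clip (t - c) (t + c) x ∂P) / n),
    integral_sum_pi (fun _ : Fin n => hX.integrable one_le_two),
    integral_fun_snd (fun q : (Fin n → ℝ) × ℝ => q.2), integral_fun_snd (fun x : ℝ => x),
    integral_id_laplaceMeasure]
  simp [hX0]

theorem measurable_clippedMean (c : ℝ) (n : ℕ) :
    Measurable fun q : ℝ × (Fin n → ℝ) × (Fin n → ℝ) × ℝ => clippedMean c q.1 q.2 := by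
  unfold clippedMean clip
  fun_prop

theorem measurable_nameAndShame (δ : ℝ) (n : ℕ) :
    Measurable fun r : (Fin n → ℝ) × (Fin n → ℝ) × ℝ => nameAndShame δ r := by
  unfold nameAndShame
  fun_prop

/-- The error is dominated by |t − m| + ∑ |xᵢ − m| + |noise|, where the window centre t is now
random with law Q. -/
theorem memLp_clippedMean (hI : Integrable (fun x => (x - m) ^ 2) P) (hb : 0 < b) (hn : n ≠ 0)
    {c : ℝ} (hc : 0 ≤ c) {Q : Measure ℝ} [IsFiniteMeasure Q] (hQ : MemLp (fun t => t - m) 2 Q) :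
    MemLp (fun q => clippedMean c q.1 q.2 - m) 2 (Q.prod (tailLaw P p b n)) := by
  have := isProbabilityMeasure_laplaceMeasure hb
  have := isProbabilityMeasure_tailLaw P p hb n
  have hn' : (0 : ℝ) < n := Nat.cast_pos.2 (Nat.pos_of_ne_zero hn)
  have m1 : MemLp (fun q : ℝ × (Fin n → ℝ) × (Fin n → ℝ) × ℝ => |q.1 - m|) 2
    (Q.prod (tailLaw P p b n)) := hQ.abs.comp_fst _
  have m2 : MemLp (fun q : ℝ × (Fin n → ℝ) × (Fin n → ℝ) × ℝ => ∑ i, |q.2.1 i - m|) 2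
      (Q.prod (tailLaw P p b n)) :=
    ((memLp_sum_pi fun _ : Fin n => (memLp_sub_of_integrable_sq hI).abs).comp_fst _).comp_snd Q
  have m3 : MemLp (fun q : ℝ × (Fin n → ℝ) × (Fin n → ℝ) × ℝ => |q.2.2.2|) 2
      (Q.prod (tailLaw P p b n)) :=
    (((memLp_two_laplaceMeasure hb).abs.comp_snd
      (Measure.pi fun _ : Fin n => bernoulliMeasure (1 : ℝ) 0 p)).comp_snd
        (Measure.pi fun _ : Fin n => P)).comp_snd Q
  refine ((m1.add m2).add m3).mono' ((measurable_clippedMean c n).sub_const m).aestronglyMeasurable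
    (Filter.Eventually.of_forall fun q => ?_)
  have e : clippedMean c q.1 q.2 - m =
      (∑ i, (clip (q.1 - c) (q.1 + c) (q.2.1 i) - m)) / n + q.2.2.2 := by
    rw [clippedMean, Finset.sum_sub_distrib]
    simp only [Finset.sum_const, Finset.card_univ, Fintype.card_fin, nsmul_eq_mul]
    field_simp
    ring
  simp only [Pi.add_apply, Real.norm_eq_abs]
  rw [e]
  refine (abs_add_le _ _).trans ?_
  gcongr
  rw [abs_div, abs_of_pos hn', div_le_iff₀ hn']
  have h2 : 1 ≤ (n : ℝ) := Nat.one_le_cast.2 (Nat.one_le_iff_ne_zero.2 hn)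
  calc |∑ i, (clip (q.1 - c) (q.1 + c) (q.2.1 i) - m)|
      ≤ ∑ i, |clip (q.1 - c) (q.1 + c) (q.2.1 i) - m| := Finset.abs_sum_le_sum_abs _ _
    _ ≤ ∑ i, (|q.2.1 i - m| + |q.1 - m|) := Finset.sum_le_sum fun i _ => abs_clip_sub_le hc
    _ = ∑ i, |q.2.1 i - m| + n * |q.1 - m| := by
        rw [Finset.sum_add_distrib]; simp
    _ ≤ (|q.1 - m| + ∑ i, |q.2.1 i - m|) * n := by
        have : 0 ≤ ∑ i, |q.2.1 i - m| := Finset.sum_nonneg fun i _ => abs_nonneg _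
        nlinarith

end Statistics

/-! ### Name-and-shame -/

section NameAndShame

variable {P : Measure ℝ} [IsProbabilityMeasure P] {m : ℝ} {p : unitInterval} {b : ℝ} {n : ℕ}

theorem memLp_bernoulliMeasure (p : unitInterval) {f : ℝ → ℝ} (hf : Measurable f) :
    MemLp f 2 (bernoulliMeasure (1 : ℝ) 0 p) :=
  (memLp_two_iff_integrable_sq hf.aestronglyMeasurable).2 (integrable_bernoulliMeasure _ _ _ _)

theorem integral_sq_add_const {α : Type*} [MeasurableSpace α] {μ : Measure α}
    [IsProbabilityMeasure μ] {u : α → ℝ} (hu : MemLp u 2 μ) (hu0 : ∫ x, u x ∂μ = 0) (a : ℝ) :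
    ∫ x, (u x + a) ^ 2 ∂μ = ∫ x, u x ^ 2 ∂μ + a ^ 2 := by
  have e : ∀ x, (u x + a) ^ 2 = u x ^ 2 + 2 * a * u x + a ^ 2 := fun x => by ring
  have i1 := (hu.integrable one_le_two).const_mul (2 * a)
  have i2 : Integrable (fun x => u x ^ 2 + 2 * a * u x) μ := hu.integrable_sq.add i1
  simp_rw [e]
  rw [integral_add i2 (integrable_const _), integral_add hu.integrable_sq i1, integral_const_mul,
    hu0]
  simp

theorem memLp_nameAndShame (hI : Integrable (fun x => (x - m) ^ 2) P) (hb : 0 < b) (δ : ℝ) :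
    MemLp (fun r => nameAndShame δ r) 2 (tailLaw P p b n) := by
  have := isProbabilityMeasure_laplaceMeasure hb
  suffices key : ∀ i : Fin n, MemLp (fun r : (Fin n → ℝ) × (Fin n → ℝ) × ℝ => r.1 i * r.2.1 i) 2
      (tailLaw P p b n) by
    have h := (memLp_finsetSum Finset.univ fun i _ => key i).const_mul (1 / (n * δ))
    exact h
  intro i
  rw [memLp_two_iff_integrable_sq (by fun_prop)]
  have h1 : MemLp (fun x : ℝ => x) 2 P := by
    refine ((memLp_sub_of_integrable_sq hI).add (memLp_const m)).ae_eq
      (Filter.Eventually.of_forall fun x => ?_)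
    simp
  have h2 : Integrable (fun y : Fin n → ℝ => y i ^ 2) (Measure.pi fun _ : Fin n => P) :=
    integrable_comp_eval (μ := fun _ : Fin n => P) h1.integrable_sq
  have h3 : Integrable (fun β : Fin n → ℝ => β i ^ 2)
      (Measure.pi fun _ : Fin n => bernoulliMeasure (1 : ℝ) 0 p) :=
    integrable_comp_eval (μ := fun _ : Fin n => bernoulliMeasure (1 : ℝ) 0 p)
      (f := fun x : ℝ => x ^ 2) (integrable_bernoulliMeasure _ _ _ _)
  refine (h2.mul_prod (h3.comp_fst (laplaceMeasure b))).congr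
    (Filter.Eventually.of_forall fun r => ?_)
  simp only [mul_pow]

/-- Given the bits, the first sum is centred over the data, and the second depends on the bits alone
and is centred as well. Integrating over the data first thus removes the cross term. -/
theorem nameAndShame_sub_eq {δ : ℝ} (hδ : 0 < δ) (hn : n ≠ 0)
    (r : (Fin n → ℝ) × (Fin n → ℝ) × ℝ) :
    nameAndShame δ r - m =
      1 / (n * δ) * (∑ i, r.2.1 i * (r.1 i - m) + m * ∑ i, (r.2.1 i - δ)) := by
  have hn' : (n : ℝ) ≠ 0 := Nat.cast_ne_zero.2 hn
  have e : ∑ i, r.2.1 i * (r.1 i - m) + m * ∑ i, (r.2.1 i - δ) =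
      ∑ i, r.1 i * r.2.1 i - n * δ * m := by
    rw [Finset.mul_sum, ← Finset.sum_add_distrib]
    have : ∀ i, r.2.1 i * (r.1 i - m) + m * (r.2.1 i - δ) = r.1 i * r.2.1 i - δ * m := fun i => by
      ring
    simp_rw [this]
    rw [Finset.sum_sub_distrib]
    simp
    ring
  rw [e, nameAndShame]
  field_simp

theorem memLp_weighted (hI : Integrable (fun x => (x - m) ^ 2) P) (β : Fin n → ℝ) (i : Fin n) :
    MemLp (fun x => β i * (x - m)) 2 P := (memLp_sub_of_integrable_sq hI).const_mul _

theorem integral_weighted (hI : Integrable (fun x => (x - m) ^ 2) P) (hm : ∫ x, x ∂P = m)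
    (β : Fin n → ℝ) (i : Fin n) : ∫ x, β i * (x - m) ∂P = 0 := by
  rw [integral_const_mul, integral_sub (integrable_of_integrable_sq hI) (integrable_const _), hm]
  simp

theorem integral_nameAndShame (hI : Integrable (fun x => (x - m) ^ 2) P) (hm : ∫ x, x ∂P = m)
    (hb : 0 < b) (hn : n ≠ 0) (hp : 0 < (p : ℝ)) :
    ∫ r, nameAndShame p r ∂(tailLaw P p b n) = m := by
  have := isProbabilityMeasure_laplaceMeasure hb
  have := isProbabilityMeasure_tailLaw P p hb n
  have hn' : (n : ℝ) ≠ 0 := Nat.cast_ne_zero.2 hn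
  have hS := (memLp_nameAndShame (p := p) (n := n) hI hb p).integrable one_le_two
  have h0 : ∫ r, (nameAndShame (p : ℝ) r - m) ∂(tailLaw P p b n) = 0 := by
    have hS' : Integrable (fun r : (Fin n → ℝ) × (Fin n → ℝ) × ℝ => nameAndShame (p : ℝ) r - m)
      (tailLaw P p b n) := hS.sub (integrable_const m)
    rw [tailLaw] at hS' ⊢
    rw [integral_prod_symm _ hS']
    have inner : ∀ q : (Fin n → ℝ) × ℝ,
        ∫ y, (nameAndShame (p : ℝ) (y, q) - m) ∂(Measure.pi fun _ : Fin n => P) =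
          1 / (n * p) * (m * ∑ i, (q.1 i - p)) := by
      intro q
      simp_rw [nameAndShame_sub_eq hp hn]
      rw [integral_const_mul, integral_add ((memLp_sum_pi fun i =>
          memLp_weighted hI q.1 i).integrable one_le_two) (integrable_const _),
        integral_sum_pi fun i => (memLp_weighted hI q.1 i).integrable one_le_two]
      simp [integral_weighted hI hm]
    simp_rw [inner]
    rw [integral_fun_fst (fun β : Fin n → ℝ => 1 / (n * (p : ℝ)) * (m * ∑ i, (β i - p))),
      integral_const_mul, integral_const_mul, integral_sum_pi (X := fun _ x => x - (p : ℝ))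
        (fun _ => integrable_bernoulliMeasure _ _ _ _)]
    simp [integral_bernoulliMeasure]
    ring_nf
    simp
  rw [integral_sub hS (integrable_const m)] at h0
  simp at h0
  linarith

theorem integral_sq_nameAndShame_le (hI : Integrable (fun x => (x - m) ^ 2) P)
    (h1 : ∫ x, (x - m) ^ 2 ∂P ≤ 1) (hm : ∫ x, x ∂P = m) (hb : 0 < b) (hn : n ≠ 0)
    (hp : 0 < (p : ℝ)) :
    ∫ r, (nameAndShame p r - m) ^ 2 ∂(tailLaw P p b n) ≤ (1 + m ^ 2) / (n * p) := by
  have := isProbabilityMeasure_laplaceMeasure hb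
  have := isProbabilityMeasure_tailLaw P p hb n
  have hn' : (0 : ℝ) < n := Nat.cast_pos.2 (Nat.pos_of_ne_zero hn)
  have hS' := ((memLp_nameAndShame (p := p) (n := n) hI hb p).sub (memLp_const m)).integrable_sq
  simp only [Pi.sub_apply] at hS'
  rw [tailLaw] at hS' ⊢
  rw [integral_prod_symm _ hS']
  set V := ∫ x, (x - m) ^ 2 ∂P with hV
  have inner : ∀ q : (Fin n → ℝ) × ℝ,
      ∫ y, (nameAndShame (p : ℝ) (y, q) - m) ^ 2 ∂(Measure.pi fun _ : Fin n => P) =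
        (1 / (n * p)) ^ 2 * (V * ∑ i, q.1 i ^ 2 + m ^ 2 * (∑ i, (q.1 i - p)) ^ 2) := by
    intro q
    simp_rw [nameAndShame_sub_eq hp hn, mul_pow (1 / ((n : ℝ) * p))]
    rw [integral_const_mul, integral_sq_add_const (memLp_sum_pi fun i => memLp_weighted hI q.1 i),
      integral_sq_sum_pi (fun i => memLp_weighted hI q.1 i) (fun i => integral_weighted hI hm q.1 i)]
    · simp_rw [mul_pow, integral_const_mul]
      rw [← hV, ← Finset.sum_mul, mul_comm V]
    · rw [integral_sum_pi fun i => (memLp_weighted hI q.1 i).integrable one_le_two]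
      simp [integral_weighted hI hm]
  have hB1 : MemLp (fun x : ℝ => x - (p : ℝ)) 2 (bernoulliMeasure (1 : ℝ) 0 p) :=
    memLp_bernoulliMeasure p (by fun_prop)
  have i1 : Integrable (fun β : Fin n → ℝ => ∑ i, β i ^ 2)
      (Measure.pi fun _ : Fin n => bernoulliMeasure (1 : ℝ) 0 p) :=
    integrable_finsetSum _ fun i _ => integrable_comp_eval
      (μ := fun _ : Fin n => bernoulliMeasure (1 : ℝ) 0 p) (f := fun x : ℝ => x ^ 2)
      (integrable_bernoulliMeasure _ _ _ _)
  have i2 : Integrable (fun β : Fin n → ℝ => (∑ i, (β i - (p : ℝ))) ^ 2)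
      (Measure.pi fun _ : Fin n => bernoulliMeasure (1 : ℝ) 0 p) :=
    (memLp_sum_pi fun _ : Fin n => hB1).integrable_sq
  simp_rw [inner]
  rw [integral_fun_fst (fun β : Fin n → ℝ => (1 / ((n : ℝ) * p)) ^ 2 *
      (V * ∑ i, β i ^ 2 + m ^ 2 * (∑ i, (β i - (p : ℝ))) ^ 2)),
    integral_const_mul, integral_add (i1.const_mul V) (i2.const_mul (m ^ 2)), integral_const_mul,
    integral_const_mul, integral_sum_pi (X := fun _ x => x ^ 2)
      (fun _ => integrable_bernoulliMeasure _ _ _ _),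
    integral_sq_sum_pi (fun _ => hB1) (fun _ => by simp [integral_bernoulliMeasure]; ring)]
  simp only [integral_bernoulliMeasure, smul_eq_mul, Finset.sum_const, Finset.card_univ,
    Fintype.card_fin, nsmul_eq_mul, probReal_univ]
  have hV0 : 0 ≤ V := integral_nonneg fun x => sq_nonneg _
  have hp1 : (p : ℝ) ≤ 1 := p.2.2
  have e : (1 : ℝ) * ((1 / ((n : ℝ) * p)) ^ 2 * (V * (n * (p * 1 ^ 2 + (1 - p) * 0 ^ 2)) +
      m ^ 2 * (n * (p * (1 - p) ^ 2 + (1 - p) * (0 - p) ^ 2)))) =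
      (V + m ^ 2 * (1 - p)) / (n * p) := by
    field_simp
    ring
  rw [e]
  gcongr
  nlinarith [sq_nonneg m]

end NameAndShame

/-! ### The law of the coarse estimate on the event of success -/

/-- The event, in terms of the inputs of the coarse step, that a bucket is selected. -/
def successSet (ε δ : ℝ) (n : ℕ) : Set ((Fin n → ℝ) × ℝ × (ℤ → ℝ)) :=
  {p | chosen ε δ 10 p ≠ none}

theorem measurableSet_successSet (ε δ : ℝ) (n : ℕ) : MeasurableSet (successSet ε δ n) :=
  measurableSet_chosen ε δ 10 n

/-- The law of the coarse estimate on the event of success, a subprobability measure. -/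
noncomputable def centerLaw (P : Measure ℝ) (ε δ : ℝ) (n : ℕ) : Measure ℝ :=
  ((coarseLaw P ε n).restrict (successSet ε δ n)).map (center ε δ 10)

section CenterLaw

variable {P : Measure ℝ} [IsProbabilityMeasure P] {m ε δ : ℝ} {n : ℕ}

theorem centerLaw_apply (P : Measure ℝ) (ε δ : ℝ) (n : ℕ) {B : Set ℝ} (hB : MeasurableSet B) :
    centerLaw P ε δ n B =
      coarseLaw P ε n {p | chosen ε δ 10 p ≠ none ∧ center ε δ 10 p ∈ B} := by
  rw [centerLaw, Measure.map_apply (measurable_center ε δ 10 n) hB,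
    Measure.restrict_apply (measurable_center ε δ 10 n hB), Set.inter_comm]
  rfl

theorem isFiniteMeasure_centerLaw (P : Measure ℝ) [IsProbabilityMeasure P] (hε : 0 < ε) (δ : ℝ)
    (n : ℕ) : IsFiniteMeasure (centerLaw P ε δ n) := by
  have := isProbabilityMeasure_coarseLaw P hε n
  unfold centerLaw
  infer_instance

theorem map_reflect_centerLaw (hP : IsSymmetricAbout P m) (hε : 0 < ε) (δ : ℝ) (n : ℕ) :
    (centerLaw P ε δ n).map (fun t => 2 * m - t) = centerLaw P ε δ n := by
  ext B hB
  rw [Measure.map_apply (by fun_prop) hB, centerLaw_apply P ε δ n hB,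
    centerLaw_apply P ε δ n ((show Measurable fun t : ℝ => 2 * m - t by fun_prop) hB),
    coarseLaw_hit_reflect hP hε δ (by norm_num) n hB]

theorem real_centerLaw_univ (P : Measure ℝ) (ε δ : ℝ) (n : ℕ) :
    (centerLaw P ε δ n).real Set.univ = (coarseLaw P ε n).real (successSet ε δ n) := by
  rw [measureReal_def, measureReal_def, centerLaw_apply P ε δ n MeasurableSet.univ]
  simp [successSet]

theorem measureReal_compl_successSet_le (hε : 0 < ε) (hδ : 0 < δ) (hδ1 : δ < 1)
    (hI : Integrable (fun x => (x - m) ^ 2) P) (h1 : ∫ x, (x - m) ^ 2 ∂P ≤ 1)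
    (hn : LargeEnough ε δ (δ ^ 2) n) :
    (coarseLaw P ε n).real (successSet ε δ n)ᶜ ≤ 9 / 16 * δ ^ 2 := by
  have := isProbabilityMeasure_coarseLaw P hε n
  have hδ2 : δ ^ 2 ≤ 1 := by nlinarith
  have h := coarse_accuracy hε hδ hδ1 (by positivity) hδ2 hI h1 hn
  refine ENNReal.toReal_le_of_le_ofReal (by positivity) ((measure_mono fun p hp => ?_).trans h)
  exact fun hh => hp hh.1

theorem measureReal_far_le (hε : 0 < ε) (hδ : 0 < δ) (hδ1 : δ < 1)
    (hI : Integrable (fun x => (x - m) ^ 2) P) (h1 : ∫ x, (x - m) ^ 2 ∂P ≤ 1)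
    (hn : LargeEnough ε δ (δ ^ 2) n) :
    (coarseLaw P ε n).real {p | chosen ε δ 10 p ≠ none ∧ 10 < |center ε δ 10 p - m|} ≤ δ ^ 2 := by
  have := isProbabilityMeasure_coarseLaw P hε n
  have hδ2 : δ ^ 2 ≤ 1 := by nlinarith
  have h := coarse_accuracy hε hδ hδ1 (by positivity) hδ2 hI h1 hn
  refine ENNReal.toReal_le_of_le_ofReal (by positivity) ((measure_mono fun p hp => ?_).trans
    (h.trans (ENNReal.ofReal_le_ofReal (by nlinarith [sq_nonneg δ]))))
  exact fun hh => absurd hh.2 (not_le.2 hp.2)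

/-! ### Second moment of the coarse estimate, in particular far from the mean. -/

theorem memLp_centerLaw (hε : 0 < ε) (δ : ℝ) (n : ℕ) (hI : Integrable (fun x => (x - m) ^ 2) P) :
    MemLp (fun t => t - m) 2 (centerLaw P ε δ n) := by
  have := isProbabilityMeasure_coarseLaw P hε n
  have := isProbabilityMeasure_laplaceMeasure (b := 2 / ε) (by positivity)
  have hc := measurable_center ε δ 10 n
  rw [centerLaw, memLp_map_measure_iff (by fun_prop) hc.aemeasurable]
  have m1 : MemLp (fun p : (Fin n → ℝ) × ℝ × (ℤ → ℝ) => (∑ i, |p.1 i - m|)) 2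
      (coarseLaw P ε n) :=
    (memLp_sum_pi fun _ : Fin n => (memLp_sub_of_integrable_sq hI).abs).comp_fst _
  refine ((m1.add (memLp_const (5 : ℝ))).restrict (successSet ε δ n)).mono'
    (hc.sub_const m).aestronglyMeasurable ?_
  filter_upwards [ae_restrict_mem (measurableSet_successSet ε δ n)] with p hp
  obtain ⟨i, hi⟩ := exists_abs_center_sub_le (σ := 10) (by norm_num) hp
  have h2 := abs_sub_le (center ε δ 10 p) (p.1 i) m
  have h3 : |p.1 i - m| ≤ ∑ i, |p.1 i - m| :=
    Finset.single_le_sum (f := fun i => |p.1 i - m|) (fun i _ => abs_nonneg _) (Finset.mem_univ i)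
  simp only [Function.comp, Pi.add_apply, Real.norm_eq_abs]
  linarith

/-- For `u, a > 0` and `λ ≥ 2`, the square of `u` is at most `a²` or dominated by `u^λ`. -/
theorem sq_le_add_rpow {u a lam : ℝ} (hu : 0 ≤ u) (ha : 0 < a) (hlam : 2 ≤ lam) :
    u ^ 2 ≤ a ^ 2 + a ^ (2 - lam) * u ^ lam := by
  rcases le_or_gt u a with h | h
  · have : 0 ≤ a ^ (2 - lam) * u ^ lam := by positivity
    nlinarith
  · have hu' : 0 < u := ha.trans h
    have h2 : a ^ (lam - 2) ≤ u ^ (lam - 2) := Real.rpow_le_rpow ha.le h.le (by linarith)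
    have h3 : a ^ (2 - lam) * a ^ (lam - 2) = 1 := by
      rw [← Real.rpow_add ha]; simp
    have h4 : u ^ lam = u ^ (lam - 2) * u ^ 2 := by
      rw [← Real.rpow_natCast u 2, ← Real.rpow_add hu']
      congr 1
      push_cast
      ring
    have h5 : 0 < a ^ (2 - lam) := by positivity
    calc u ^ 2 = a ^ (2 - lam) * a ^ (lam - 2) * u ^ 2 := by rw [h3, one_mul]
      _ ≤ a ^ (2 - lam) * u ^ (lam - 2) * u ^ 2 := by gcongr
      _ = a ^ (2 - lam) * u ^ lam := by rw [h4]; ring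
      _ ≤ _ := by nlinarith [sq_nonneg a]

/-- If the estimate is more than 10 from m, the data point within 5 of it is at least half as far
from m. Its square is truncated at level a: the bounded part is weighted by the probability δ², the
rest is charged to the sum of the λ-th moments. -/
theorem setIntegral_far_le {lam ψ a : ℝ} (hε : 0 < ε) (hδ : 0 < δ) (hδ1 : δ < 1)
    (hI : Integrable (fun x => (x - m) ^ 2) P) (h1 : ∫ x, (x - m) ^ 2 ∂P ≤ 1)
    (hIl : Integrable (fun x => |x - m| ^ lam) P) (hl : ∫ x, |x - m| ^ lam ∂P ≤ ψ ^ lam)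
    (hn : LargeEnough ε δ (δ ^ 2) n) (ha : 0 < a) (hlam : 2 ≤ lam) :
    ∫ t in {t | 10 < |t - m|}, (t - m) ^ 2 ∂(centerLaw P ε δ n) ≤
      4 * (a ^ 2 * δ ^ 2 + a ^ (2 - lam) * (n * ψ ^ lam)) := by
  have := isProbabilityMeasure_coarseLaw P hε n
  have := isProbabilityMeasure_laplaceMeasure (b := 2 / ε) (by positivity)
  have hc := measurable_center ε δ 10 n
  have hfar : MeasurableSet {t : ℝ | 10 < |t - m|} := measurableSet_lt (by fun_prop) (by fun_prop)
  set D : Set ((Fin n → ℝ) × ℝ × (ℤ → ℝ)) :=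
    {p | chosen ε δ 10 p ≠ none ∧ 10 < |center ε δ 10 p - m|} with hD
  have hDm : MeasurableSet D := measurableSet_hit ε δ 10 n hfar
  have e1 : ∫ t in {t | 10 < |t - m|}, (t - m) ^ 2 ∂(centerLaw P ε δ n) =
      ∫ p in D, (center ε δ 10 p - m) ^ 2 ∂(coarseLaw P ε n) := by
    rw [centerLaw, setIntegral_map hfar (by fun_prop) hc.aemeasurable,
      Measure.restrict_restrict (hc hfar), Set.inter_comm]
    rfl
  have iS : Integrable (fun p : (Fin n → ℝ) × ℝ × (ℤ → ℝ) => ∑ i, |p.1 i - m| ^ lam)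
      (coarseLaw P ε n) := by
    have : Integrable (fun x : Fin n → ℝ => ∑ i, |x i - m| ^ lam)
        (Measure.pi fun _ : Fin n => P) :=
      integrable_finsetSum _ fun i _ => integrable_comp_eval (μ := fun _ : Fin n => P)
        (f := fun x => |x - m| ^ lam) hIl
    exact this.comp_fst _
  have eS : ∫ p, ∑ i, |p.1 i - m| ^ lam ∂(coarseLaw P ε n) = n * ∫ x, |x - m| ^ lam ∂P := by
    rw [coarseLaw, integral_fun_fst (fun x : Fin n → ℝ => ∑ i, |x i - m| ^ lam),
      integral_sum_pi (X := fun _ x => |x - m| ^ lam) fun _ => hIl]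
    simp
  have hS0 : ∀ p : (Fin n → ℝ) × ℝ × (ℤ → ℝ), 0 ≤ ∑ i, |p.1 i - m| ^ lam := fun p =>
    Finset.sum_nonneg fun i _ => by positivity
  have iR : IntegrableOn (fun p : (Fin n → ℝ) × ℝ × (ℤ → ℝ) =>
      4 * (a ^ 2 + a ^ (2 - lam) * ∑ i, |p.1 i - m| ^ lam)) D (coarseLaw P ε n) :=
    (((integrable_const _).add (iS.const_mul _)).const_mul 4).integrableOn
  rw [e1]
  calc ∫ p in D, (center ε δ 10 p - m) ^ 2 ∂(coarseLaw P ε n)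
      ≤ ∫ p in D, 4 * (a ^ 2 + a ^ (2 - lam) * ∑ i, |p.1 i - m| ^ lam) ∂(coarseLaw P ε n) := by
        refine integral_mono_of_nonneg (Filter.Eventually.of_forall fun p => sq_nonneg _) iR ?_
        filter_upwards [ae_restrict_mem hDm] with p hp
        obtain ⟨i, hi⟩ := exists_abs_center_sub_le (σ := 10) (by norm_num) hp.1
        have h2 := abs_sub_le (center ε δ 10 p) (p.1 i) m
        have h3 : |p.1 i - m| ^ lam ≤ ∑ i, |p.1 i - m| ^ lam :=
          Finset.single_le_sum (f := fun i => |p.1 i - m| ^ lam)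
            (fun i _ => by positivity) (Finset.mem_univ i)
        have h4 := sq_le_add_rpow (abs_nonneg (p.1 i - m)) ha hlam
        have h5 : 10 < |center ε δ 10 p - m| := hp.2
        have h6 : |center ε δ 10 p - m| ≤ 2 * |p.1 i - m| := by linarith
        have h7 : a ^ (2 - lam) * |p.1 i - m| ^ lam ≤
            a ^ (2 - lam) * ∑ i, |p.1 i - m| ^ lam := by gcongr
        calc (center ε δ 10 p - m) ^ 2 = |center ε δ 10 p - m| ^ 2 := (sq_abs _).symm
          _ ≤ (2 * |p.1 i - m|) ^ 2 := by gcongr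
          _ = 4 * |p.1 i - m| ^ 2 := by ring
          _ ≤ _ := by linarith
    _ = 4 * (a ^ 2 * (coarseLaw P ε n).real D +
          a ^ (2 - lam) * ∫ p in D, ∑ i, |p.1 i - m| ^ lam ∂(coarseLaw P ε n)) := by
        rw [integral_const_mul, integral_add (integrable_const _) (iS.const_mul _).integrableOn,
          integral_const_mul]
        simp
        ring
    _ ≤ 4 * (a ^ 2 * δ ^ 2 + a ^ (2 - lam) * (n * ψ ^ lam)) := by
        have h8 : ∫ p in D, ∑ i, |p.1 i - m| ^ lam ∂(coarseLaw P ε n) ≤ n * ψ ^ lam := by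
          refine (setIntegral_le_integral iS (Filter.Eventually.of_forall hS0)).trans ?_
          rw [eS]
          gcongr
        have h9 := measureReal_far_le hε hδ hδ1 hI h1 hn
        gcongr

theorem setIntegral_far_le' {lam ψ : ℝ} (hε : 0 < ε) (hδ : 0 < δ) (hδ1 : δ < 1) (hψ : 0 < ψ)
    (hI : Integrable (fun x => (x - m) ^ 2) P) (h1 : ∫ x, (x - m) ^ 2 ∂P ≤ 1)
    (hIl : Integrable (fun x => |x - m| ^ lam) P) (hl : ∫ x, |x - m| ^ lam ∂P ≤ ψ ^ lam)
    (hn : LargeEnough ε δ (δ ^ 2) n) (hn0 : 0 < n) (hlam : 2 ≤ lam) :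
    ∫ t in {t | 10 < |t - m|}, (t - m) ^ 2 ∂(centerLaw P ε δ n) ≤
      8 * (δ ^ (2 - 4 / lam) * n ^ (2 / lam) * ψ ^ 2) := by
  have hn' : (0 : ℝ) < n := Nat.cast_pos.2 hn0
  have hl0 : 0 < lam := by linarith
  set N : ℝ := (n : ℝ) ^ (1 / lam) with hN
  set d : ℝ := δ ^ (-2 / lam) with hd
  have hN0 : 0 < N := by positivity
  have hd0 : 0 < d := by positivity
  -- The level a = ψ n^{1/λ} δ^{-2/λ} makes the two summands a²δ² and a^{2−λ} n ψ^λ equal.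
  refine (setIntegral_far_le (a := ψ * N * d) hε hδ hδ1 hI h1 hIl hl hn (by positivity)
    hlam).trans (le_of_eq ?_)
  have eN2 : N ^ 2 = (n : ℝ) ^ (2 / lam) := by
    rw [hN, ← Real.rpow_natCast, ← Real.rpow_mul hn'.le]
    congr 1; push_cast; ring
  have ed2 : d ^ 2 * δ ^ 2 = δ ^ (2 - 4 / lam) := by
    rw [hd, ← Real.rpow_natCast (δ ^ (-2 / lam)), ← Real.rpow_mul hδ.le, ← Real.rpow_natCast δ 2,
      ← Real.rpow_add hδ]
    congr 1; push_cast; ring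
  have eNl : N ^ (2 - lam) * n = (n : ℝ) ^ (2 / lam) := by
    conv_lhs => rw [← Real.rpow_one (n : ℝ)]
    rw [hN, Real.rpow_one, ← Real.rpow_mul hn'.le, ← Real.rpow_add_one hn'.ne']
    congr 1; field_simp; ring
  have edl : d ^ (2 - lam) = δ ^ (2 - 4 / lam) := by
    rw [hd, ← Real.rpow_mul hδ.le]
    congr 1; field_simp; ring
  have eψ : ψ ^ (2 - lam) * ψ ^ lam = ψ ^ 2 := by
    rw [← Real.rpow_add hψ, ← Real.rpow_natCast ψ 2]
    congr 1; push_cast; ring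
  have e2 : (ψ * N * d) ^ (2 - lam) = ψ ^ (2 - lam) * N ^ (2 - lam) * d ^ (2 - lam) := by
    rw [Real.mul_rpow (by positivity) hd0.le, Real.mul_rpow hψ.le hN0.le]
  rw [e2]
  have t1 : (ψ * N * d) ^ 2 * δ ^ 2 = δ ^ (2 - 4 / lam) * n ^ (2 / lam) * ψ ^ 2 := by
    rw [← ed2, ← eN2]; ring
  have t2 : ψ ^ (2 - lam) * N ^ (2 - lam) * d ^ (2 - lam) * (n * ψ ^ lam) =
      δ ^ (2 - 4 / lam) * n ^ (2 / lam) * ψ ^ 2 := by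
    rw [← edl, ← eNl, ← eψ]; ring
  rw [t1, t2]
  ring

end CenterLaw

/-! ### The algorithm on the events of success and failure -/

section Fine

theorem coarseStep_eq (ε δ σ : ℝ) {n₁ n₂ : ℕ} (z : (Fin (n₁ + n₂) → ℝ) × Noise n₂) :
    coarseStep ε δ σ z.1 z.2 =
      (chosen ε δ σ (headPart z)).map fun k : ℤ => σ * (z.2.1 + k) := by
  rw [coarseStep, coarse_eq_map_pick, Option.map_map]
  rfl

theorem coarseSucceeds_eq (ε δ : ℝ) (n₁ n₂ : ℕ) :
    coarseSucceeds ε δ 10 n₁ n₂ = headPart ⁻¹' successSet ε δ n₁ := by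
  ext z
  simp only [coarseSucceeds, successSet, Set.mem_ofPred_eq, Set.mem_preimage, coarseStep_eq, ne_eq,
    Option.map_eq_none_iff]

theorem coarseStep_of_success {ε δ : ℝ} {n₁ n₂ : ℕ} {z : (Fin (n₁ + n₂) → ℝ) × Noise n₂}
    (h : z ∈ coarseSucceeds ε δ 10 n₁ n₂) :
    coarseStep ε δ 10 z.1 z.2 = some (center ε δ 10 (headPart z)) := by
  rw [coarseSucceeds_eq] at h
  obtain ⟨k, hk⟩ := Option.ne_none_iff_exists'.1 h
  rw [coarseStep_eq, center, hk]
  rfl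

theorem fine_of_success {ε δ c : ℝ} {n₁ n₂ : ℕ} {z : (Fin (n₁ + n₂) → ℝ) × Noise n₂}
    (h : z ∈ coarseSucceeds ε δ 10 n₁ n₂) :
    fine ε δ c 10 n₁ n₂ z.1 z.2 = clippedMean c (center ε δ 10 (headPart z)) (tailPart z) := by
  rw [fine, coarseStep_of_success h]
  rfl

theorem fine_of_failure {ε δ c : ℝ} {n₁ n₂ : ℕ} {z : (Fin (n₁ + n₂) → ℝ) × Noise n₂}
    (h : z ∈ (coarseSucceeds ε δ 10 n₁ n₂)ᶜ) :
    fine ε δ c 10 n₁ n₂ z.1 z.2 = nameAndShame δ (tailPart z) := by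
  have h' : coarseStep ε δ 10 z.1 z.2 = none := by
    by_contra hh
    exact h hh
  rw [fine, h']
  rfl

theorem measurable_headPart (n₁ n₂ : ℕ) :
    Measurable fun z : (Fin (n₁ + n₂) → ℝ) × Noise n₂ => headPart z := by
  unfold headPart
  fun_prop

theorem measurable_tailPart (n₁ n₂ : ℕ) :
    Measurable fun z : (Fin (n₁ + n₂) → ℝ) × Noise n₂ => tailPart z := by
  unfold tailPart
  fun_prop

theorem measurableSet_coarseSucceeds (ε δ : ℝ) (n₁ n₂ : ℕ) :
    MeasurableSet (coarseSucceeds ε δ 10 n₁ n₂) := by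
  rw [coarseSucceeds_eq]
  exact measurable_headPart n₁ n₂ (measurableSet_successSet ε δ n₁)

variable {P : Measure ℝ} [IsProbabilityMeasure P] {m ε δ c : ℝ} {n₁ n₂ : ℕ}

/-- Success and the coarse estimate depend only on inputs the final step does not use, so on success
the law factorises. Moments of the output become iterated integrals, with a fixed window centre in
the inner one. -/
theorem measurePreserving_success (hε : 0 < ε) (hb : 0 < 2 * c / (n₂ * ε)) :
    MeasurePreserving
      (fun z : (Fin (n₁ + n₂) → ℝ) × Noise n₂ => (center ε δ 10 (headPart z), tailPart z))
      ((jointLaw P ε δ c n₁ n₂).restrict (coarseSucceeds ε δ 10 n₁ n₂))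
      ((centerLaw P ε δ n₁).prod
        (tailLaw P (Set.projIcc 0 1 zero_le_one δ) (2 * c / (n₂ * ε)) n₂)) := by
  have := isProbabilityMeasure_coarseLaw P hε n₁
  have := isProbabilityMeasure_tailLaw P (Set.projIcc 0 1 zero_le_one δ) hb n₂
  have := isFiniteMeasure_centerLaw P hε δ n₁
  have h1 := (measurePreserving_headPart_tailPart P (δ := δ) hε n₁ hb).restrict_preimage
    ((measurableSet_successSet ε δ n₁).prod MeasurableSet.univ)
  rw [← Measure.prod_restrict, Measure.restrict_univ] at h1
  have e : (fun z : (Fin (n₁ + n₂) → ℝ) × Noise n₂ => (headPart z, tailPart z)) ⁻¹'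
      (successSet ε δ n₁ ×ˢ Set.univ) = coarseSucceeds ε δ 10 n₁ n₂ := by
    rw [coarseSucceeds_eq]
    ext z
    simp
  rw [e] at h1
  have h2 : MeasurePreserving (center ε δ 10) ((coarseLaw P ε n₁).restrict (successSet ε δ n₁))
      (centerLaw P ε δ n₁) := ⟨measurable_center ε δ 10 n₁, rfl⟩
  exact (h2.prod (MeasurePreserving.id _)).comp h1

theorem measurePreserving_failure (hε : 0 < ε) (hb : 0 < 2 * c / (n₂ * ε)) :
    MeasurePreserving (fun z : (Fin (n₁ + n₂) → ℝ) × Noise n₂ => tailPart z)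
      ((jointLaw P ε δ c n₁ n₂).restrict (coarseSucceeds ε δ 10 n₁ n₂)ᶜ)
      (coarseLaw P ε n₁ (successSet ε δ n₁)ᶜ •
        tailLaw P (Set.projIcc 0 1 zero_le_one δ) (2 * c / (n₂ * ε)) n₂) := by
  have := isProbabilityMeasure_coarseLaw P hε n₁
  have := isProbabilityMeasure_tailLaw P (Set.projIcc 0 1 zero_le_one δ) hb n₂
  have h1 := (measurePreserving_headPart_tailPart P (δ := δ) hε n₁ hb).restrict_preimage
    ((measurableSet_successSet ε δ n₁).compl.prod MeasurableSet.univ)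
  rw [← Measure.prod_restrict, Measure.restrict_univ] at h1
  have e : (fun z : (Fin (n₁ + n₂) → ℝ) × Noise n₂ => (headPart z, tailPart z)) ⁻¹'
      ((successSet ε δ n₁)ᶜ ×ˢ Set.univ) = (coarseSucceeds ε δ 10 n₁ n₂)ᶜ := by
    rw [coarseSucceeds_eq]
    ext z
    simp
  rw [e] at h1
  have h2 : MeasurePreserving Prod.snd
      (((coarseLaw P ε n₁).restrict (successSet ε δ n₁)ᶜ).prod
        (tailLaw P (Set.projIcc 0 1 zero_le_one δ) (2 * c / (n₂ * ε)) n₂))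
      (coarseLaw P ε n₁ (successSet ε δ n₁)ᶜ •
        tailLaw P (Set.projIcc 0 1 zero_le_one δ) (2 * c / (n₂ * ε)) n₂) := by
    refine ⟨measurable_snd, ?_⟩
    rw [Measure.map_snd_prod, Measure.restrict_apply_univ]
  exact h2.comp h1

theorem isProbabilityMeasure_jointLaw (P : Measure ℝ) [IsProbabilityMeasure P] (hε : 0 < ε)
    (δ : ℝ) (n₁ : ℕ) (hb : 0 < 2 * c / (n₂ * ε)) :
    IsProbabilityMeasure (jointLaw P ε δ c n₁ n₂) := by
  have := isProbabilityMeasure_laplaceMeasure (b := 2 / ε) (by positivity)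
  have := isProbabilityMeasure_laplaceMeasure hb
  unfold jointLaw noiseLaw
  infer_instance

theorem measureReal_coarseSucceeds (hε : 0 < ε) (hb : 0 < 2 * c / (n₂ * ε)) :
    (jointLaw P ε δ c n₁ n₂).real (coarseSucceeds ε δ 10 n₁ n₂) =
      (centerLaw P ε δ n₁).real Set.univ := by
  have := isProbabilityMeasure_tailLaw P (Set.projIcc 0 1 zero_le_one δ) hb n₂
  have h := (measurePreserving_success (P := P) (δ := δ) (n₁ := n₁) hε hb).measure_preimage
    MeasurableSet.univ.nullMeasurableSet
  rw [Set.preimage_univ, Measure.restrict_apply_univ, ← Set.univ_prod_univ, Measure.prod_prod,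
    measure_univ (μ := tailLaw _ _ _ _), mul_one] at h
  rw [measureReal_def, measureReal_def, h]

theorem real_centerLaw_univ_add (P : Measure ℝ) [IsProbabilityMeasure P] (hε : 0 < ε) (δ : ℝ)
    (n : ℕ) : (centerLaw P ε δ n).real Set.univ + (coarseLaw P ε n).real (successSet ε δ n)ᶜ = 1 := by
  have := isProbabilityMeasure_coarseLaw P hε n
  rw [real_centerLaw_univ, probReal_compl_eq_one_sub (measurableSet_successSet ε δ n)]
  ring

/-! #### Integrability -/

theorem memLp_fine_success (hI : Integrable (fun x => (x - m) ^ 2) P) (hε : 0 < ε)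
    (hb : 0 < 2 * c / (n₂ * ε)) (hn : n₂ ≠ 0) (hc : 0 ≤ c) :
    MemLp (fun z => fine ε δ c 10 n₁ n₂ z.1 z.2 - m) 2
      ((jointLaw P ε δ c n₁ n₂).restrict (coarseSucceeds ε δ 10 n₁ n₂)) := by
  have := isFiniteMeasure_centerLaw P hε δ n₁
  have h := (memLp_clippedMean (p := Set.projIcc 0 1 zero_le_one δ) hI hb hn hc
    (memLp_centerLaw hε δ n₁ hI)).comp_measurePreserving (measurePreserving_success hε hb)
  refine h.ae_eq ?_
  filter_upwards [ae_restrict_mem (measurableSet_coarseSucceeds ε δ n₁ n₂)] with z hz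
  simp only [Function.comp]
  rw [fine_of_success hz]

theorem memLp_fine_failure (hI : Integrable (fun x => (x - m) ^ 2) P) (hε : 0 < ε)
    (hb : 0 < 2 * c / (n₂ * ε)) :
    MemLp (fun z => fine ε δ c 10 n₁ n₂ z.1 z.2 - m) 2
      ((jointLaw P ε δ c n₁ n₂).restrict (coarseSucceeds ε δ 10 n₁ n₂)ᶜ) := by
  have := isProbabilityMeasure_coarseLaw P hε n₁
  have := isProbabilityMeasure_tailLaw P (Set.projIcc 0 1 zero_le_one δ) hb n₂
  have h := (((memLp_nameAndShame (p := Set.projIcc 0 1 zero_le_one δ) (n := n₂) hI hb δ).sub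
    (memLp_const m)).smul_measure (measure_ne_top (coarseLaw P ε n₁)
      (successSet ε δ n₁)ᶜ)).comp_measurePreserving (measurePreserving_failure hε hb)
  refine h.ae_eq ?_
  filter_upwards [ae_restrict_mem (measurableSet_coarseSucceeds ε δ n₁ n₂).compl] with z hz
  simp only [Function.comp, Pi.sub_apply]
  rw [fine_of_failure hz]

theorem memLp_center_success (hI : Integrable (fun x => (x - m) ^ 2) P) (hε : 0 < ε)
    (hb : 0 < 2 * c / (n₂ * ε)) :
    MemLp (fun z => (coarseStep ε δ 10 z.1 z.2).getD 0 - m) 2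
      ((jointLaw P ε δ c n₁ n₂).restrict (coarseSucceeds ε δ 10 n₁ n₂)) := by
  have := isFiniteMeasure_centerLaw P hε δ n₁
  have := isProbabilityMeasure_tailLaw P (Set.projIcc 0 1 zero_le_one δ) hb n₂
  have h := ((memLp_centerLaw hε δ n₁ hI).comp_fst (tailLaw P (Set.projIcc 0 1 zero_le_one δ)
    (2 * c / (n₂ * ε)) n₂)).comp_measurePreserving (measurePreserving_success hε hb)
  refine h.ae_eq ?_
  filter_upwards [ae_restrict_mem (measurableSet_coarseSucceeds ε δ n₁ n₂)] with z hz
  simp only [Function.comp]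
  rw [coarseStep_of_success hz, Option.getD_some]

/-! #### First moments -/

theorem integral_odd_centerLaw (hP : IsSymmetricAbout P m) (hε : 0 < ε) {f : ℝ → ℝ}
    (hf : AEStronglyMeasurable f (centerLaw P ε δ n₁)) (hodd : ∀ t, f (2 * m - t) = -f t) :
    ∫ t, f t ∂(centerLaw P ε δ n₁) = 0 := by
  have h : ∫ t, f t ∂(centerLaw P ε δ n₁) = -∫ t, f t ∂(centerLaw P ε δ n₁) := by
    conv_lhs => rw [← map_reflect_centerLaw hP hε δ n₁]
    rw [integral_map (by fun_prop) (by rwa [map_reflect_centerLaw hP hε δ n₁])]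
    simp_rw [hodd]
    rw [integral_neg]
  linarith

theorem measurable_clipBias (P : Measure ℝ) [IsProbabilityMeasure P] (m c : ℝ) :
    Measurable (clipBias P m c) := by
  have h : StronglyMeasurable (Function.uncurry fun t x : ℝ => clip (t - c) (t + c) x) := by
    have : Measurable (Function.uncurry fun t x : ℝ => clip (t - c) (t + c) x) := by
      unfold clip Function.uncurry
      fun_prop
    exact this.stronglyMeasurable
  exact (h.integral_prod_right (ν := P)).measurable.sub_const m

theorem setIntegral_fine_success (hP : IsSymmetricAbout P m)
    (hI : Integrable (fun x => (x - m) ^ 2) P) (hε : 0 < ε) (hb : 0 < 2 * c / (n₂ * ε))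
    (hn : n₂ ≠ 0) (hc : 0 ≤ c) :
    ∫ z in coarseSucceeds ε δ 10 n₁ n₂, (fine ε δ c 10 n₁ n₂ z.1 z.2 - m)
      ∂(jointLaw P ε δ c n₁ n₂) = 0 := by
  have := isFiniteMeasure_centerLaw P hε δ n₁
  have := isProbabilityMeasure_tailLaw P (Set.projIcc 0 1 zero_le_one δ) hb n₂
  have hL := memLp_clippedMean (p := Set.projIcc 0 1 zero_le_one δ) hI hb hn hc
    (memLp_centerLaw (ε := ε) hε δ n₁ hI)
  have hmp := measurePreserving_success (P := P) (δ := δ) (n₁ := n₁) hε hb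
  calc _ = ∫ z in coarseSucceeds ε δ 10 n₁ n₂,
        (clippedMean c (center ε δ 10 (headPart z)) (tailPart z) - m)
          ∂(jointLaw P ε δ c n₁ n₂) :=
        setIntegral_congr_fun (measurableSet_coarseSucceeds ε δ n₁ n₂) fun z hz => by
          simp only [fine_of_success hz]
    _ = ∫ q, (clippedMean c q.1 q.2 - m) ∂((centerLaw P ε δ n₁).prod
          (tailLaw P (Set.projIcc 0 1 zero_le_one δ) (2 * c / (n₂ * ε)) n₂)) := by
        rw [← hmp.map_eq, integral_map hmp.measurable.aemeasurable
          ((measurable_clippedMean c n₂).sub_const m).aestronglyMeasurable]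
    _ = ∫ t, clipBias P m c t ∂(centerLaw P ε δ n₁) := by
        rw [integral_prod _ (hL.integrable one_le_two)]
        refine integral_congr_ae ?_
        filter_upwards [(hL.integrable one_le_two).prod_right_ae] with t ht
        have hi : Integrable (fun r => clippedMean c t r)
            (tailLaw P (Set.projIcc 0 1 zero_le_one δ) (2 * c / (n₂ * ε)) n₂) := by
          refine (ht.add (integrable_const m)).congr (Filter.Eventually.of_forall fun r => ?_)
          simp
        rw [integral_sub hi (integrable_const m), integral_clippedMean hI hb hn]
        simp
    _ = 0 := integral_odd_centerLaw hP hε (measurable_clipBias P m c).aestronglyMeasurable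
        (clipBias_reflect hP hI hc)

theorem setIntegral_center_success (hP : IsSymmetricAbout P m) (hε : 0 < ε)
    (hb : 0 < 2 * c / (n₂ * ε)) :
    ∫ z in coarseSucceeds ε δ 10 n₁ n₂, ((coarseStep ε δ 10 z.1 z.2).getD 0 - m)
      ∂(jointLaw P ε δ c n₁ n₂) = 0 := by
  have := isFiniteMeasure_centerLaw P hε δ n₁
  have := isProbabilityMeasure_tailLaw P (Set.projIcc 0 1 zero_le_one δ) hb n₂
  have hmp := measurePreserving_success (P := P) (δ := δ) (n₁ := n₁) hε hb
  calc _ = ∫ z in coarseSucceeds ε δ 10 n₁ n₂, (center ε δ 10 (headPart z) - m)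
          ∂(jointLaw P ε δ c n₁ n₂) :=
        setIntegral_congr_fun (measurableSet_coarseSucceeds ε δ n₁ n₂) fun z hz => by
          simp only [coarseStep_of_success hz, Option.getD_some]
    _ = ∫ q, (q.1 - m) ∂((centerLaw P ε δ n₁).prod
          (tailLaw P (Set.projIcc 0 1 zero_le_one δ) (2 * c / (n₂ * ε)) n₂)) := by
        rw [← hmp.map_eq, integral_map hmp.measurable.aemeasurable (by fun_prop)]
    _ = ∫ t, (t - m) ∂(centerLaw P ε δ n₁) := by
        rw [integral_fun_fst (fun t => t - m)]
        simp
    _ = 0 := integral_odd_centerLaw hP hε (by fun_prop) (fun t => by ring)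

theorem setIntegral_fine_failure (hP : IsSymmetricAbout P m)
    (hI : Integrable (fun x => (x - m) ^ 2) P) (hε : 0 < ε) (hδ : 0 < δ) (hδ1 : δ < 1)
    (hb : 0 < 2 * c / (n₂ * ε)) (hn : n₂ ≠ 0) :
    ∫ z in (coarseSucceeds ε δ 10 n₁ n₂)ᶜ, (fine ε δ c 10 n₁ n₂ z.1 z.2 - m)
      ∂(jointLaw P ε δ c n₁ n₂) = 0 := by
  have := isProbabilityMeasure_tailLaw P (Set.projIcc 0 1 zero_le_one δ) hb n₂
  have hmp := measurePreserving_failure (P := P) (δ := δ) (n₁ := n₁) hε hb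
  have hp : ((Set.projIcc 0 1 zero_le_one δ : unitInterval) : ℝ) = δ := by
    rw [Set.projIcc_of_mem zero_le_one ⟨hδ.le, hδ1.le⟩]
  have hS := integral_nameAndShame (p := Set.projIcc 0 1 zero_le_one δ) hI
    (integral_id_eq_of_symmetric hP hI) hb hn (by rw [hp]; exact hδ)
  rw [hp] at hS
  calc _ = ∫ z in (coarseSucceeds ε δ 10 n₁ n₂)ᶜ, (nameAndShame δ (tailPart z) - m)
          ∂(jointLaw P ε δ c n₁ n₂) :=
        setIntegral_congr_fun (measurableSet_coarseSucceeds ε δ n₁ n₂).compl fun z hz => by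
          simp only [fine_of_failure hz]
    _ = ∫ r, (nameAndShame δ r - m) ∂(coarseLaw P ε n₁ (successSet ε δ n₁)ᶜ •
          tailLaw P (Set.projIcc 0 1 zero_le_one δ) (2 * c / (n₂ * ε)) n₂) := by
        rw [← hmp.map_eq, integral_map hmp.measurable.aemeasurable
          ((measurable_nameAndShame δ n₂).sub_const m).aestronglyMeasurable]
    _ = 0 := by
        rw [integral_smul_measure, integral_sub
          ((memLp_nameAndShame hI hb δ).integrable one_le_two) (integrable_const m), hS]
        simp

/-! #### Second moments -/

theorem setIntegral_sq_fine_failure_le (hP : IsSymmetricAbout P m)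
    (hI : Integrable (fun x => (x - m) ^ 2) P) (h1 : ∫ x, (x - m) ^ 2 ∂P ≤ 1) (hε : 0 < ε)
    (hδ : 0 < δ) (hδ1 : δ < 1) (hb : 0 < 2 * c / (n₂ * ε)) (hn : n₂ ≠ 0)
    (hn₁ : LargeEnough ε δ (δ ^ 2) n₁) :
    ∫ z in (coarseSucceeds ε δ 10 n₁ n₂)ᶜ, (fine ε δ c 10 n₁ n₂ z.1 z.2 - m) ^ 2
      ∂(jointLaw P ε δ c n₁ n₂) ≤ δ * (1 + m ^ 2) / n₂ := by
  have := isProbabilityMeasure_tailLaw P (Set.projIcc 0 1 zero_le_one δ) hb n₂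
  have hmp := measurePreserving_failure (P := P) (δ := δ) (n₁ := n₁) hε hb
  have hn' : (0 : ℝ) < n₂ := Nat.cast_pos.2 (Nat.pos_of_ne_zero hn)
  have hp : ((Set.projIcc 0 1 zero_le_one δ : unitInterval) : ℝ) = δ := by
    rw [Set.projIcc_of_mem zero_le_one ⟨hδ.le, hδ1.le⟩]
  have hS := integral_sq_nameAndShame_le (p := Set.projIcc 0 1 zero_le_one δ) hI h1
    (integral_id_eq_of_symmetric hP hI) hb hn (by rw [hp]; exact hδ)
  rw [hp] at hS
  calc _ = ∫ z in (coarseSucceeds ε δ 10 n₁ n₂)ᶜ, (nameAndShame δ (tailPart z) - m) ^ 2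
          ∂(jointLaw P ε δ c n₁ n₂) :=
        setIntegral_congr_fun (measurableSet_coarseSucceeds ε δ n₁ n₂).compl fun z hz => by
          simp only [fine_of_failure hz]
    _ = ∫ r, (nameAndShame δ r - m) ^ 2 ∂(coarseLaw P ε n₁ (successSet ε δ n₁)ᶜ •
          tailLaw P (Set.projIcc 0 1 zero_le_one δ) (2 * c / (n₂ * ε)) n₂) := by
        rw [← hmp.map_eq, integral_map hmp.measurable.aemeasurable
          (((measurable_nameAndShame δ n₂).sub_const m).pow_const 2).aestronglyMeasurable]
    _ ≤ δ ^ 2 * ((1 + m ^ 2) / (n₂ * δ)) := by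
        rw [integral_smul_measure, smul_eq_mul]
        -- The choice γ = δ² outweighs the factor 1/δ in the name-and-shame variance.
        refine mul_le_mul ?_ hS (integral_nonneg fun r => sq_nonneg _) (by positivity)
        refine (measureReal_compl_successSet_le hε hδ hδ1 hI h1 hn₁).trans ?_
        nlinarith [sq_nonneg δ]
    _ = δ * (1 + m ^ 2) / n₂ := by
        field_simp

theorem setIntegral_sq_fine_success_le {lam ψ w : ℝ} (hP : IsSymmetricAbout P m)
    (hI : Integrable (fun x => (x - m) ^ 2) P) (h1 : ∫ x, (x - m) ^ 2 ∂P ≤ 1)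
    (hIl : Integrable (fun x => |x - m| ^ lam) P) (hl : ∫ x, |x - m| ^ lam ∂P ≤ ψ ^ lam)
    (hlam : 2 ≤ lam) (hw : 0 < w) (hc : c = 10 + w)
    (hε : 0 < ε) (hb : 0 < 2 * c / (n₂ * ε)) (hn : n₂ ≠ 0) :
    ∫ z in coarseSucceeds ε δ 10 n₁ n₂, (fine ε δ c 10 n₁ n₂ z.1 z.2 - m) ^ 2
      ∂(jointLaw P ε δ c n₁ n₂) ≤
      (jointLaw P ε δ c n₁ n₂).real (coarseSucceeds ε δ 10 n₁ n₂) *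
        (1 / n₂ + 2 * (2 * c / (n₂ * ε)) ^ 2 + (ψ ^ lam / w ^ (lam - 1)) ^ 2) +
        4 * ∫ t in {t | 10 < |t - m|}, (t - m) ^ 2 ∂(centerLaw P ε δ n₁) := by
  have := isFiniteMeasure_centerLaw P hε δ n₁
  have := isProbabilityMeasure_tailLaw P (Set.projIcc 0 1 zero_le_one δ) hb n₂
  have hc0 : 0 ≤ c := by linarith
  have hL := (memLp_clippedMean (p := Set.projIcc 0 1 zero_le_one δ) hI hb hn hc0
    (memLp_centerLaw (ε := ε) hε δ n₁ hI)).integrable_sq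
  have hmp := measurePreserving_success (P := P) (δ := δ) (n₁ := n₁) hε hb
  have hfar : MeasurableSet {t : ℝ | 10 < |t - m|} := measurableSet_lt (by fun_prop) (by fun_prop)
  set A := 1 / (n₂ : ℝ) + 2 * (2 * c / (n₂ * ε)) ^ 2 + (ψ ^ lam / w ^ (lam - 1)) ^ 2 with hA
  have iF : Integrable ({t | 10 < |t - m|}.indicator fun t => (t - m) ^ 2) (centerLaw P ε δ n₁) :=
    (memLp_centerLaw hε δ n₁ hI).integrable_sq.indicator hfar
  -- For |t − m| ≤ 10 = c − w the moment bound applies; otherwise the crude bound 1 + |t − m| is at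
  -- most 2|t − m|.
  have hbias : ∀ t, clipBias P m c t ^ 2 ≤ (ψ ^ lam / w ^ (lam - 1)) ^ 2 +
      4 * ({t | 10 < |t - m|}.indicator (fun t => (t - m) ^ 2) t) := by
    intro t
    by_cases ht : 10 < |t - m|
    · rw [Set.indicator_of_mem (by exact ht)]
      have h2 := abs_clipBias_le hI h1 hc0 t
      have h3 : clipBias P m c t ^ 2 ≤ (2 * |t - m|) ^ 2 := by
        rw [← sq_abs]
        gcongr
        linarith
      rw [mul_pow, sq_abs] at h3
      nlinarith [sq_nonneg (ψ ^ lam / w ^ (lam - 1))]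
    · rw [Set.indicator_of_notMem (by exact ht), mul_zero, add_zero, ← sq_abs (clipBias P m c t)]
      gcongr
      refine abs_clipBias_le_of_near hI (integral_id_eq_of_symmetric hP hI) hIl hl hw
        (by linarith) ?_
      rw [hc]
      linarith
  calc _ = ∫ z in coarseSucceeds ε δ 10 n₁ n₂,
        (clippedMean c (center ε δ 10 (headPart z)) (tailPart z) - m) ^ 2
          ∂(jointLaw P ε δ c n₁ n₂) :=
        setIntegral_congr_fun (measurableSet_coarseSucceeds ε δ n₁ n₂) fun z hz => by
          simp only [fine_of_success hz]
    _ = ∫ q, (clippedMean c q.1 q.2 - m) ^ 2 ∂((centerLaw P ε δ n₁).prod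
          (tailLaw P (Set.projIcc 0 1 zero_le_one δ) (2 * c / (n₂ * ε)) n₂)) := by
        rw [← hmp.map_eq, integral_map hmp.measurable.aemeasurable
          (((measurable_clippedMean c n₂).sub_const m).pow_const 2).aestronglyMeasurable]
    _ ≤ ∫ t, (A + 4 * ({t | 10 < |t - m|}.indicator (fun t => (t - m) ^ 2) t))
          ∂(centerLaw P ε δ n₁) := by
        rw [integral_prod _ hL]
        refine integral_mono hL.integral_prod_left ((integrable_const A).add (iF.const_mul 4))
          fun t => ?_
        have h2 := integral_sq_clippedMean_le (p := Set.projIcc 0 1 zero_le_one δ) hI h1 hb hn c t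
        have h3 := hbias t
        simp only [hA]
        linarith
    _ = _ := by
        rw [integral_add (integrable_const A) (iF.const_mul 4), integral_const_mul,
          integral_indicator hfar, measureReal_coarseSucceeds hε hb]
        simp

end Fine

/-! ### Privacy -/

section Privacy

/-- A privacy bound that holds for every value of an independent random choice survives averaging
over it. -/
theorem prod_apply_le_of_forall {α β : Type*} [MeasurableSpace α] [MeasurableSpace β]
    {μ : Measure α} {ν : Measure β} [IsProbabilityMeasure μ] [IsProbabilityMeasure ν]
    {s s' : Set (α × β)} (hs : MeasurableSet s) (hs' : MeasurableSet s') {a d : ENNReal}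
    (h : ∀ x, ν (Prod.mk x ⁻¹' s) ≤ a * ν (Prod.mk x ⁻¹' s') + d) :
    (μ.prod ν) s ≤ a * (μ.prod ν) s' + d := by
  rw [Measure.prod_apply hs, Measure.prod_apply hs']
  refine (lintegral_mono h).trans (le_of_eq ?_)
  rw [lintegral_add_right _ measurable_const,
    lintegral_const_mul _ (measurable_measure_prodMk_left hs')]
  simp

theorem prod_apply_le_of_forall_symm {α β : Type*} [MeasurableSpace α] [MeasurableSpace β]
    {μ : Measure α} {ν : Measure β} [IsProbabilityMeasure μ] [IsProbabilityMeasure ν]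
    {s s' : Set (α × β)} (hs : MeasurableSet s) (hs' : MeasurableSet s') {a d : ENNReal}
    (h : ∀ y, μ ((fun x => (x, y)) ⁻¹' s) ≤ a * μ ((fun x => (x, y)) ⁻¹' s') + d) :
    (μ.prod ν) s ≤ a * (μ.prod ν) s' + d := by
  rw [Measure.prod_apply_symm hs, Measure.prod_apply_symm hs']
  refine (lintegral_mono h).trans (le_of_eq ?_)
  rw [lintegral_add_right _ measurable_const,
    lintegral_const_mul _ (measurable_measure_prodMk_right hs')]
  simp

/-- The output of the algorithm, given the offset and the selected bucket. -/
noncomputable def finish (δ c : ℝ) {n : ℕ} (T : ℝ) (o : Option ℤ)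
    (r : (Fin n → ℝ) × (Fin n → ℝ) × ℝ) : ℝ :=
  match o with
  | none => nameAndShame δ r
  | some k => clippedMean c (10 * (T + k)) r

theorem fine_eq_finish (ε δ c : ℝ) {n₁ n₂ : ℕ} (z : (Fin (n₁ + n₂) → ℝ) × Noise n₂) :
    fine ε δ c 10 n₁ n₂ z.1 z.2 = finish δ c z.2.1 (chosen ε δ 10 (headPart z)) (tailPart z) := by
  rw [fine, coarseStep_eq]
  cases chosen ε δ 10 (headPart z) <;> rfl

theorem measurable_fine (ε δ c : ℝ) (n₁ n₂ : ℕ) :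
    Measurable fun z : (Fin (n₁ + n₂) → ℝ) × Noise n₂ => fine ε δ c 10 n₁ n₂ z.1 z.2 := by
  classical
  have h1 : Measurable fun z : (Fin (n₁ + n₂) → ℝ) × Noise n₂ =>
      clippedMean c (center ε δ 10 (headPart z)) (tailPart z) :=
    (measurable_clippedMean c n₂).comp (((measurable_center ε δ 10 n₁).comp
      (measurable_headPart n₁ n₂)).prodMk (measurable_tailPart n₁ n₂))
  have h2 : Measurable fun z : (Fin (n₁ + n₂) → ℝ) × Noise n₂ => nameAndShame δ (tailPart z) :=
    (measurable_nameAndShame δ n₂).comp (measurable_tailPart n₁ n₂)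
  have e : (fun z : (Fin (n₁ + n₂) → ℝ) × Noise n₂ => fine ε δ c 10 n₁ n₂ z.1 z.2) =
      fun z => if z ∈ coarseSucceeds ε δ 10 n₁ n₂ then
        clippedMean c (center ε δ 10 (headPart z)) (tailPart z) else nameAndShame δ (tailPart z) := by
    funext z
    split_ifs with hz
    · exact fine_of_success hz
    · exact fine_of_failure hz
  rw [e]
  exact Measurable.ite (p := fun z => z ∈ coarseSucceeds ε δ 10 n₁ n₂)
    (measurableSet_coarseSucceeds ε δ n₁ n₂) h1 h2

theorem measurableSet_fine_mem (ε δ c : ℝ) {n₁ n₂ : ℕ} (x : Fin (n₁ + n₂) → ℝ) {Y : Set ℝ}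
    (hY : MeasurableSet Y) : MeasurableSet {ω : Noise n₂ | fine ε δ c 10 n₁ n₂ x ω ∈ Y} :=
  ((measurable_fine ε δ c n₁ n₂).comp measurable_prodMk_left) hY

theorem exists_of_hammingDist_eq_one {α : Type*} [DecidableEq α] {n : ℕ} {x x' : Fin n → α}
    (h : hammingDist x x' = 1) : ∃ i, ∀ j, j ≠ i → x j = x' j := by
  obtain ⟨i, hi⟩ := Finset.card_eq_one.1 h
  refine ⟨i, fun j hj => ?_⟩
  by_contra hne
  have : j ∈ Finset.univ.filter fun i => x i ≠ x' i := Finset.mem_filter.2 ⟨Finset.mem_univ _, hne⟩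
  rw [hi, Finset.mem_singleton] at this
  exact hj this

variable {ε δ c : ℝ} {n₁ n₂ : ℕ}

theorem fine_dp_of_head (hε : 0 < ε) (hδ : 0 < δ) (hδ1 : δ < 1) (hb : 0 < 2 * c / (n₂ * ε))
    {x x' : Fin (n₁ + n₂) → ℝ} {i : Fin n₁} (h : ∀ j, j ≠ Fin.castAdd n₂ i → x j = x' j)
    {Y : Set ℝ} (hY : MeasurableSet Y) :
    noiseLaw ε δ c n₂ {ω | fine ε δ c 10 n₁ n₂ x ω ∈ Y} ≤
      ENNReal.ofReal (Real.exp ε) * noiseLaw ε δ c n₂ {ω | fine ε δ c 10 n₁ n₂ x' ω ∈ Y} +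
        ENNReal.ofReal δ := by
  have := isProbabilityMeasure_laplaceMeasure (b := 2 / ε) (by positivity)
  have := isProbabilityMeasure_laplaceMeasure hb
  have hm := measurableSet_fine_mem (n₁ := n₁) (n₂ := n₂) ε δ c x hY
  have hm' := measurableSet_fine_mem (n₁ := n₁) (n₂ := n₂) ε δ c x' hY
  have htail : ∀ ω : Noise n₂, tailPart (n₁ := n₁) (x, ω) = tailPart (x', ω) := by
    intro ω
    have : ∀ j, x (Fin.natAdd n₁ j) = x' (Fin.natAdd n₁ j) := fun j => h _ fun hj => by
      have := congrArg Fin.val hj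
      simp only [Fin.val_natAdd, Fin.val_castAdd] at this
      omega
    simp [tailPart, this]
  -- The offset, the bits and the final noise are frozen; only the bucket noises remain random, and
  -- the output is a function of the selected bucket.
  refine prod_apply_le_of_forall hm hm' fun T => ?_
  refine prod_apply_le_of_forall_symm (measurable_prodMk_left hm) (measurable_prodMk_left hm')
    fun r => ?_
  have key := pick_dp hε hδ hδ1 (r := labels (fun j => x (Fin.castAdd n₂ j) / 10) T)
    (r' := labels (fun j => x' (Fin.castAdd n₂ j) / 10) T) (i₀ := i)
    (fun j hj => by
      simp only [labels]
      rw [h _ fun hh => hj (Fin.castAdd_injective n₁ n₂ hh)])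
    {o | finish δ c T o (fun j => x' (Fin.natAdd n₁ j), r.1, r.2) ∈ Y}
  have e1 : (fun ξ => (ξ, r)) ⁻¹' (Prod.mk T ⁻¹' {ω : Noise n₂ | fine ε δ c 10 n₁ n₂ x ω ∈ Y}) =
      {ξ | pick (2 + 2 * Real.log (1 / δ) / ε) (labels (fun j => x (Fin.castAdd n₂ j) / 10) T) ξ ∈
        {o | finish δ c T o (fun j => x' (Fin.natAdd n₁ j), r.1, r.2) ∈ Y}} := by
    ext ξ
    change fine ε δ c 10 n₁ n₂ x (T, ξ, r) ∈ Y ↔ _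
    rw [show fine ε δ c 10 n₁ n₂ x (T, ξ, r) = _ from fine_eq_finish ε δ c (x, (T, ξ, r)), htail]
    rfl
  have e2 : (fun ξ => (ξ, r)) ⁻¹' (Prod.mk T ⁻¹' {ω : Noise n₂ | fine ε δ c 10 n₁ n₂ x' ω ∈ Y}) =
      {ξ | pick (2 + 2 * Real.log (1 / δ) / ε) (labels (fun j => x' (Fin.castAdd n₂ j) / 10) T) ξ ∈
        {o | finish δ c T o (fun j => x' (Fin.natAdd n₁ j), r.1, r.2) ∈ Y}} := by
    ext ξ
    change fine ε δ c 10 n₁ n₂ x' (T, ξ, r) ∈ Y ↔ _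
    rw [show fine ε δ c 10 n₁ n₂ x' (T, ξ, r) = _ from fine_eq_finish ε δ c (x', (T, ξ, r))]
    rfl
  rw [e1, e2]
  exact key

/-- The two outputs coincide unless the bit of the modified point is nonzero. -/
theorem nameAndShame_dp {p : unitInterval} {b : ℝ} (hb : 0 < b) {n : ℕ} {y y' : Fin n → ℝ}
    {i : Fin n} (h : ∀ j, j ≠ i → y j = y' j) (δ : ℝ) (Y : Set ℝ) :
    ((Measure.pi fun _ : Fin n => bernoulliMeasure (1 : ℝ) 0 p).prod (laplaceMeasure b))
        {r | nameAndShame δ (y, r) ∈ Y} ≤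
      ((Measure.pi fun _ : Fin n => bernoulliMeasure (1 : ℝ) 0 p).prod (laplaceMeasure b))
        {r | nameAndShame δ (y', r) ∈ Y} + ENNReal.ofReal p := by
  have := isProbabilityMeasure_laplaceMeasure hb
  have h0 : ((Measure.pi fun _ : Fin n => bernoulliMeasure (1 : ℝ) 0 p).prod (laplaceMeasure b))
      {r | r.1 i ∈ ({0}ᶜ : Set ℝ)} = ENNReal.ofReal p := by
    have e : {r : (Fin n → ℝ) × ℝ | r.1 i ∈ ({0}ᶜ : Set ℝ)} =
        (Function.eval i ⁻¹' ({0}ᶜ : Set ℝ)) ×ˢ Set.univ := by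
      ext r; simp
    rw [e, Measure.prod_prod, measure_univ, mul_one,
      (measurePreserving_eval (fun _ : Fin n => bernoulliMeasure (1 : ℝ) 0 p) i).measure_preimage
        (measurableSet_singleton (0 : ℝ)).compl.nullMeasurableSet,
      bernoulliMeasure_apply_of_mem_of_notMem p (measurableSet_singleton (0 : ℝ)).compl
        (by simp) (by simp)]
    rw [ENNReal.ofReal, ← unitInterval.coe_toNNReal, Real.toNNReal_coe]
  rw [← h0]
  refine (measure_mono fun r hr => ?_).trans (measure_union_le _ _)
  by_cases hr0 : r.1 i = 0
  · left
    have e : nameAndShame δ (y', r) = nameAndShame δ (y, r) := by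
      rw [nameAndShame, nameAndShame]
      congr 1
      refine Finset.sum_congr rfl fun j _ => ?_
      by_cases hj : j = i
      · subst hj; simp [hr0]
      · simp [h j hj]
    rw [Set.mem_ofPred_eq, e]
    exact hr
  · right
    exact hr0

theorem abs_sum_clip_sub_le {n : ℕ} {y y' : Fin n → ℝ} {i : Fin n} (h : ∀ j, j ≠ i → y j = y' j)
    {t c : ℝ} (hc : 0 ≤ c) :
    |∑ j, clip (t - c) (t + c) (y j) - ∑ j, clip (t - c) (t + c) (y' j)| ≤ 2 * c := by
  have hr : ∀ x, t - c ≤ clip (t - c) (t + c) x ∧ clip (t - c) (t + c) x ≤ t + c := fun x =>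
    ⟨le_max_left _ _, max_le (by linarith) (min_le_left _ _)⟩
  rw [← Finset.sum_sub_distrib, Finset.sum_eq_single i (fun j _ hj => by rw [h j hj, sub_self])
    (fun hi => absurd (Finset.mem_univ i) hi), abs_le]
  have h1 := hr (y i)
  have h2 := hr (y' i)
  constructor <;> linarith

theorem clippedMean_dp {p : unitInterval} (hε : 0 < ε) (hc : 0 < c) {n : ℕ} (hn : n ≠ 0)
    {y y' : Fin n → ℝ} {i : Fin n} (h : ∀ j, j ≠ i → y j = y' j) (t : ℝ) {Y : Set ℝ}
    (hY : MeasurableSet Y) :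
    ((Measure.pi fun _ : Fin n => bernoulliMeasure (1 : ℝ) 0 p).prod
        (laplaceMeasure (2 * c / (n * ε)))) {r | clippedMean c t (y, r) ∈ Y} ≤
      ENNReal.ofReal (Real.exp ε) *
        ((Measure.pi fun _ : Fin n => bernoulliMeasure (1 : ℝ) 0 p).prod
          (laplaceMeasure (2 * c / (n * ε)))) {r | clippedMean c t (y', r) ∈ Y} + 0 := by
  have hn' : (0 : ℝ) < n := Nat.cast_pos.2 (Nat.pos_of_ne_zero hn)
  have hb : 0 < 2 * c / (n * ε) := by positivity
  have := isProbabilityMeasure_laplaceMeasure hb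
  have hm : ∀ y : Fin n → ℝ, MeasurableSet {r : (Fin n → ℝ) × ℝ | clippedMean c t (y, r) ∈ Y} :=
    fun y => ((measurable_clippedMean c n).comp
      (show Measurable fun r : (Fin n → ℝ) × ℝ => (t, y, r) by fun_prop)) hY
  refine prod_apply_le_of_forall (hm y) (hm y') fun β => ?_
  rw [add_zero]
  set M := 1 / (n : ℝ) * ∑ j, clip (t - c) (t + c) (y j) with hM
  set M' := 1 / (n : ℝ) * ∑ j, clip (t - c) (t + c) (y' j) with hM'
  have hB : MeasurableSet {l : ℝ | M' + l ∈ Y} :=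
    (show Measurable fun l : ℝ => M' + l by fun_prop) hY
  have hs := laplaceMeasure_shift_le hb (M - M') hB
  have e1 : Prod.mk β ⁻¹' {r : (Fin n → ℝ) × ℝ | clippedMean c t (y, r) ∈ Y} =
      {l | l + (M - M') ∈ {l : ℝ | M' + l ∈ Y}} := by
    ext l
    change M + l ∈ Y ↔ M' + (l + (M - M')) ∈ Y
    rw [show M' + (l + (M - M')) = M + l by ring]
  rw [e1]
  refine hs.trans (mul_le_mul_left (ENNReal.ofReal_le_ofReal (Real.exp_le_exp.2 ?_)) _)
  have h2 := abs_sum_clip_sub_le h (t := t) hc.le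
  have h3 : M - M' = 1 / n *
      (∑ j, clip (t - c) (t + c) (y j) - ∑ j, clip (t - c) (t + c) (y' j)) := by
    rw [hM, hM']; ring
  rw [div_le_iff₀ hb, h3, abs_mul, abs_of_pos (by positivity)]
  calc 1 / (n : ℝ) * |∑ j, clip (t - c) (t + c) (y j) - ∑ j, clip (t - c) (t + c) (y' j)|
      ≤ 1 / n * (2 * c) := by gcongr
    _ = ε * (2 * c / (n * ε)) := by field_simp

theorem fine_dp_of_tail (hε : 0 < ε) (hδ : 0 < δ) (hδ1 : δ < 1) (hc : 0 < c) (hn : n₂ ≠ 0)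
    {x x' : Fin (n₁ + n₂) → ℝ} {i : Fin n₂} (h : ∀ j, j ≠ Fin.natAdd n₁ i → x j = x' j)
    {Y : Set ℝ} (hY : MeasurableSet Y) :
    noiseLaw ε δ c n₂ {ω | fine ε δ c 10 n₁ n₂ x ω ∈ Y} ≤
      ENNReal.ofReal (Real.exp ε) * noiseLaw ε δ c n₂ {ω | fine ε δ c 10 n₁ n₂ x' ω ∈ Y} +
        ENNReal.ofReal δ := by
  have hn' : (0 : ℝ) < n₂ := Nat.cast_pos.2 (Nat.pos_of_ne_zero hn)
  have hb : 0 < 2 * c / (n₂ * ε) := by positivity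
  have := isProbabilityMeasure_laplaceMeasure (b := 2 / ε) (by positivity)
  have := isProbabilityMeasure_laplaceMeasure hb
  have hm := measurableSet_fine_mem (n₁ := n₁) (n₂ := n₂) ε δ c x hY
  have hm' := measurableSet_fine_mem (n₁ := n₁) (n₂ := n₂) ε δ c x' hY
  have hhead : ∀ ω : Noise n₂, headPart (n₁ := n₁) (x, ω) = headPart (x', ω) := by
    intro ω
    have : ∀ j, x (Fin.castAdd n₂ j) = x' (Fin.castAdd n₂ j) := fun j => h _ fun hj => by
      have := congrArg Fin.val hj
      simp only [Fin.val_natAdd, Fin.val_castAdd] at this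
      omega
    simp [headPart, this]
  have hy : ∀ j, j ≠ i → x (Fin.natAdd n₁ j) = x' (Fin.natAdd n₁ j) := fun j hj =>
    h _ fun hh => hj (Fin.natAdd_injective n₂ n₁ hh)
  refine prod_apply_le_of_forall hm hm' fun T => ?_
  refine prod_apply_le_of_forall (measurable_prodMk_left hm) (measurable_prodMk_left hm')
    fun ξ => ?_
  have e : ∀ u : Fin (n₁ + n₂) → ℝ, Prod.mk ξ ⁻¹' (Prod.mk T ⁻¹'
      {ω : Noise n₂ | fine ε δ c 10 n₁ n₂ u ω ∈ Y}) =
      {r | finish δ c T (chosen ε δ 10 (fun j => u (Fin.castAdd n₂ j), T, ξ))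
        (fun j => u (Fin.natAdd n₁ j), r) ∈ Y} := by
    intro u
    ext r
    change fine ε δ c 10 n₁ n₂ u (T, ξ, r) ∈ Y ↔ _
    rw [show fine ε δ c 10 n₁ n₂ u (T, ξ, r) = _ from fine_eq_finish ε δ c (u, (T, ξ, r))]
    rfl
  have e0 : chosen ε δ 10 (fun j => x (Fin.castAdd n₂ j), T, ξ) =
      chosen ε δ 10 (fun j => x' (Fin.castAdd n₂ j), T, ξ) := by
    have := hhead (T, ξ, 0, 0)
    exact congrArg (chosen ε δ 10) this
  rw [e, e, e0]
  cases chosen ε δ 10 (fun j => x' (Fin.castAdd n₂ j), T, ξ) with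
  | none =>
    have hp : ((Set.projIcc 0 1 zero_le_one δ : unitInterval) : ℝ) = δ := by
      rw [Set.projIcc_of_mem zero_le_one ⟨hδ.le, hδ1.le⟩]
    have h1 := nameAndShame_dp (p := Set.projIcc 0 1 zero_le_one δ) hb hy δ Y
    rw [hp] at h1
    refine h1.trans ?_
    gcongr
    refine le_mul_of_one_le_left' ?_
    rw [ENNReal.one_le_ofReal]
    exact Real.one_le_exp hε.le
  | some k =>
    refine (clippedMean_dp hε hc hn hy (10 * (T + k)) hY).trans ?_
    exact add_le_add le_rfl bot_le

theorem isDP_fine (hε : 0 < ε) (hδ : 0 < δ) (hδ1 : δ < 1) (hc : 0 < c) (hn : n₂ ≠ 0) :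
    IsDP (noiseLaw ε δ c n₂) (fine ε δ c 10 n₁ n₂) ε δ := by
  have hn' : (0 : ℝ) < n₂ := Nat.cast_pos.2 (Nat.pos_of_ne_zero hn)
  intro x x' hx Y hY
  obtain ⟨i, hi⟩ := exists_of_hammingDist_eq_one hx
  induction i using Fin.addCases with
  | left i => exact fine_dp_of_head hε hδ hδ1 (by positivity) hi hY
  | right i => exact fine_dp_of_tail hε hδ hδ1 hc hn hi hY

end Privacy

/-! ### The sample size of the coarse step -/

theorem eventually_log_div_le {ε γ : ℝ} (hε : 0 < ε) (hγ : 0 < γ) :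
    ∀ᶠ n : ℕ in Filter.atTop, 16 / ε * Real.log (n / γ) ≤ n := by
  have h1 := Real.isLittleO_log_id_atTop.bound (c := ε * γ / 16) (by positivity)
  have h2 : Filter.Tendsto (fun n : ℕ => (n : ℝ) / γ) Filter.atTop Filter.atTop :=
    tendsto_natCast_atTop_atTop.atTop_div_const hγ
  filter_upwards [h2.eventually h1] with n hn
  have h3 := (le_abs_self _).trans hn
  have h0 : 0 ≤ (n : ℝ) / γ := by positivity
  rw [id, Real.norm_eq_abs, abs_of_nonneg h0] at h3
  calc 16 / ε * Real.log (n / γ) ≤ 16 / ε * (ε * γ / 16 * (n / γ)) := by gcongr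
    _ = n := by field_simp

/-- The least admissible size n works: n − 1 violates one of the three conditions, so it lies below
a bound of at most 128 L/ε, where L = log(n/δ³) ≥ 1. Adding 1 ≤ L/ε gives 129. -/
theorem exists_largeEnough {ε δ : ℝ} (hε : 0 < ε) (hε1 : ε < 1) (hδ : 0 < δ) (hδ1 : δ < 1) :
    ∃ n : ℕ, LargeEnough ε δ (δ ^ 2) n ∧
      (n : ℝ) ≤ 129 * (Real.log (n / (δ ^ 2 * δ)) / ε) := by
  classical
  have hex : ∃ n, LargeEnough ε δ (δ ^ 2) n :=
    ((tendsto_natCast_atTop_atTop.eventually_ge_atTop (7 + 7 / ε * Real.log (1 / δ))).and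
      ((tendsto_natCast_atTop_atTop.eventually_ge_atTop (128 * Real.log (2 / δ ^ 2))).and
        (eventually_log_div_le hε (by positivity : 0 < δ ^ 2)))).exists
  obtain ⟨n, hn, hmin⟩ : ∃ n, LargeEnough ε δ (δ ^ 2) n ∧
      ∀ k < n, ¬ LargeEnough ε δ (δ ^ 2) k :=
    ⟨Nat.find hex, Nat.find_spec hex, fun k hk => Nat.find_min hex hk⟩
  refine ⟨n, hn, ?_⟩
  have hlog : 0 ≤ Real.log (1 / δ) := Real.log_nonneg (by rw [le_div_iff₀ hδ]; linarith)
  have hn7 : (7 : ℝ) ≤ n := by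
    have : 0 ≤ 7 / ε * Real.log (1 / δ) := by positivity
    linarith [hn.1]
  have hn7' : 7 ≤ n := by exact_mod_cast hn7
  obtain ⟨k, rfl⟩ : ∃ k, n = k + 1 := ⟨n - 1, by omega⟩
  have hk : (6 : ℝ) ≤ k := by push_cast at hn7; linarith
  have hfail := hmin k (by omega)
  push_cast at hn7 ⊢
  have hδ2 : δ ^ 2 ≤ 1 := by nlinarith
  have hδ3 : 0 < δ ^ 2 * δ := by positivity
  set L := Real.log ((k + 1 : ℝ) / (δ ^ 2 * δ)) with hL
  have hcmp : ∀ u v : ℝ, 0 < u → u ≤ k + 1 → δ ^ 2 * δ ≤ v → Real.log (u / v) ≤ L := by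
    intro u v hu hu1 hv
    have hv0 : 0 < v := hδ3.trans_le hv
    exact Real.log_le_log (by positivity) (by gcongr)
  have hL1 : 1 ≤ L := by
    have h1 := hcmp (Real.exp 1) 1 (Real.exp_pos 1) (by linarith [Real.exp_one_lt_d9])
      (by nlinarith)
    rwa [div_one, Real.log_exp] at h1
  have hLA := hcmp 1 δ one_pos (by linarith) (by nlinarith)
  have hLB := hcmp 2 (δ ^ 2) two_pos (by linarith) (by nlinarith [sq_nonneg δ])
  have hLC := hcmp k (δ ^ 2) (by linarith) (by linarith) (by nlinarith [sq_nonneg δ])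
  have hLe : L ≤ L / ε := by rw [le_div_iff₀ hε]; nlinarith
  rw [LargeEnough, not_and_or, not_and_or, not_le, not_le, not_le] at hfail
  rcases hfail with h | h | h
  · have : 7 / ε * Real.log (1 / δ) ≤ 7 / ε * L := by gcongr
    have e : 7 / ε * L = 7 * (L / ε) := by ring
    linarith
  · linarith
  · have : 16 / ε * Real.log (k / δ ^ 2) ≤ 16 / ε * L := by gcongr
    have e : 16 / ε * L = 16 * (L / ε) := by ring
    linarith

/-! ### Error bounds -/

section Bounds

variable {κ s ψ lam : ℝ}

theorem min_one_le_rpow (hκ : 0 < κ) (hs : κ ≤ s) (hlam : 2 ≤ lam) : min 1 κ ≤ s ^ (2 / lam) := by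
  have hs0 : 0 < s := hκ.trans_le hs
  have h2 : 2 / lam ≤ 1 := by rw [div_le_one (by linarith)]; exact hlam
  rcases le_total 1 s with h | h
  · exact (min_le_left _ _).trans (Real.one_le_rpow h (by positivity))
  · calc min 1 κ ≤ s := (min_le_right _ _).trans hs
      _ = s ^ (1 : ℝ) := (Real.rpow_one s).symm
      _ ≤ s ^ (2 / lam) := Real.rpow_le_rpow_of_exponent_ge hs0 h h2

theorem rpow_two_sub_eq (hs : 0 < s) (lam : ℝ) :
    s ^ (2 - 2 / lam) = s ^ 2 / s ^ (2 / lam) := by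
  rw [Real.rpow_sub hs]
  norm_cast

/-- The constant part 10 of the clipping radius must be absorbed into ψ s^{1/λ}. This is where s ≥ κ
enters and makes the constant depend on κ. -/
theorem noise_error_le (hκ : 0 < κ) (hs : κ ≤ s) (hψ : 1 ≤ ψ) (hlam : 2 ≤ lam) :
    2 * (2 * (10 + ψ * s ^ (1 / lam)) / s) ^ 2 ≤
      (16 + 1600 / min 1 κ) * (ψ ^ 2 / s ^ (2 - 2 / lam)) := by
  have hs0 : 0 < s := hκ.trans_le hs
  have hk : 0 < min 1 κ := lt_min one_pos hκ
  have hle := min_one_le_rpow hκ hs hlam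
  rw [rpow_two_sub_eq hs0]
  have e : s ^ (2 / lam) = (s ^ (1 / lam)) ^ 2 := by
    rw [← Real.rpow_natCast, ← Real.rpow_mul hs0.le]
    congr 1; push_cast; ring
  rw [e] at hle ⊢
  set v := s ^ (1 / lam) with hv
  have hv0 : 0 < v := by positivity
  have h1 : 1 ≤ v ^ 2 / min 1 κ := by rwa [one_le_div hk]
  have h2 : 1 ≤ ψ ^ 2 := one_le_pow₀ hψ
  have h3 : 1 ≤ ψ ^ 2 * (v ^ 2 / min 1 κ) := one_le_mul_of_one_le_of_one_le h2 h1
  have h4 : (10 + ψ * v) ^ 2 ≤ 200 + 2 * (ψ * v) ^ 2 := by nlinarith [sq_nonneg (10 - ψ * v)]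
  calc 2 * (2 * (10 + ψ * v) / s) ^ 2 = 8 * (10 + ψ * v) ^ 2 / s ^ 2 := by ring
    _ ≤ 8 * (200 * (ψ ^ 2 * (v ^ 2 / min 1 κ)) + 2 * (ψ * v) ^ 2) / s ^ 2 := by
        gcongr
        linarith
    _ = (16 + 1600 / min 1 κ) * (ψ ^ 2 / (s ^ 2 / v ^ 2)) := by
        field_simp
        ring

theorem bias_error_eq (hs : 0 < s) (hψ : 0 < ψ) (hlam : 2 ≤ lam) :
    (ψ ^ lam / (ψ * s ^ (1 / lam)) ^ (lam - 1)) ^ 2 = ψ ^ 2 / s ^ (2 - 2 / lam) := by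
  have hl : lam ≠ 0 := by linarith
  have h1 : (s ^ (1 / lam)) ^ (lam - 1) = s ^ (1 - 1 / lam) := by
    rw [← Real.rpow_mul hs.le]
    congr 1; field_simp
  have h2 : (s ^ (1 - 1 / lam)) ^ 2 = s ^ (2 - 2 / lam) := by
    rw [← Real.rpow_natCast, ← Real.rpow_mul hs.le]
    congr 1; push_cast; ring
  rw [Real.mul_rpow hψ.le (by positivity), h1, ← div_div, ← Real.rpow_sub hψ, div_pow, h2]
  simp

theorem failure_error_le {δ ε : ℝ} {n₁ n₂ : ℕ} (hε : 0 < ε) (hε1 : ε < 1) (hδ : 0 < δ)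
    (hδ1 : δ < 1) (hψ : 1 ≤ ψ) (hlam : 2 ≤ lam) (hn₁ : 1 ≤ n₁) (hn₂ : 1 ≤ n₂) :
    δ / n₂ ≤ ψ ^ 2 / (n₂ * ε) ^ (2 - 2 / lam) +
      δ ^ (2 - 4 / lam) * (n₁ + n₂ * ε) ^ (2 / lam) * ψ ^ 2 := by
  have hn₁' : (1 : ℝ) ≤ n₁ := Nat.one_le_cast.2 hn₁
  have hn₂' : (1 : ℝ) ≤ n₂ := Nat.one_le_cast.2 hn₂
  have hn0 : (0 : ℝ) < n₂ := by linarith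
  have hs0 : 0 < n₂ * ε := by positivity
  have hs1 : n₂ * ε ≤ n₂ := by nlinarith
  have hψ2 : 1 ≤ ψ ^ 2 := one_le_pow₀ hψ
  have hl2 : 2 / lam ≤ 1 := by rw [div_le_one (by linarith)]; exact hlam
  have hl0 : 0 ≤ 2 / lam := by positivity
  have hR1 : 0 ≤ ψ ^ 2 / (n₂ * ε) ^ (2 - 2 / lam) := by positivity
  have hR3 : 0 ≤ δ ^ (2 - 4 / lam) * (n₁ + n₂ * ε) ^ (2 / lam) * ψ ^ 2 := by positivity
  -- If δ ≥ 1/n₂ then δ/n₂ ≤ δ² is absorbed by the last term; otherwise δ/n₂ ≤ 1/n₂² is absorbed by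
  -- the first.
  rcases le_total (1 / (n₂ : ℝ)) δ with h | h
  · refine le_trans ?_ (le_add_of_nonneg_left hR1)
    calc δ / n₂ = δ * (1 / n₂) := by ring
      _ ≤ δ * δ := by gcongr
      _ = δ ^ (2 : ℝ) := by norm_cast; ring
      _ ≤ δ ^ (2 - 4 / lam) := by
          refine Real.rpow_le_rpow_of_exponent_ge hδ hδ1.le ?_
          have : 0 ≤ 4 / lam := by positivity
          linarith
      _ = δ ^ (2 - 4 / lam) * 1 * 1 := by ring
      _ ≤ _ := by
          gcongr
          exact Real.one_le_rpow (by linarith) hl0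
  · refine le_trans ?_ (le_add_of_nonneg_right hR3)
    calc δ / n₂ ≤ 1 / n₂ / n₂ := by gcongr
      _ = 1 / (n₂ : ℝ) ^ (2 : ℝ) := by norm_cast; rw [div_div]; push_cast; ring_nf
      _ ≤ ψ ^ 2 / (n₂ * ε) ^ (2 - 2 / lam) := by
          gcongr
          calc (n₂ * ε) ^ (2 - 2 / lam) ≤ (n₂ : ℝ) ^ (2 - 2 / lam) :=
                Real.rpow_le_rpow hs0.le hs1 (by linarith)
            _ ≤ (n₂ : ℝ) ^ (2 : ℝ) := Real.rpow_le_rpow_of_exponent_le hn₂' (by linarith)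

end Bounds

/-! ### Error of the algorithm -/

section Error

variable {P : Measure ℝ} [IsProbabilityMeasure P] {m κ ε δ ψ lam c : ℝ} {n₁ n₂ : ℕ}

theorem one_le_of_largeEnough (hε : 0 < ε) (hδ : 0 < δ) (hδ1 : δ < 1) {γ : ℝ}
    (h : LargeEnough ε δ γ n₁) : 1 ≤ n₁ := by
  have hlog : 0 ≤ Real.log (1 / δ) := Real.log_nonneg (by rw [le_div_iff₀ hδ]; linarith)
  have h7 : (1 : ℝ) ≤ n₁ := by
    have : 0 ≤ 7 / ε * Real.log (1 / δ) := by positivity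
    linarith [h.1]
  exact_mod_cast h7

theorem setIntegral_sq_fine_success_le' (hκ : 0 < κ) (hs : κ ≤ n₂ * ε)
    (hP : IsSymmetricAbout P m)
    (hI : Integrable (fun x => (x - m) ^ 2) P) (h1 : ∫ x, (x - m) ^ 2 ∂P ≤ 1)
    (hIl : Integrable (fun x => |x - m| ^ lam) P) (hl : ∫ x, |x - m| ^ lam ∂P ≤ ψ ^ lam)
    (hε : 0 < ε) (hδ : 0 < δ) (hδ1 : δ < 1) (hψ : 1 ≤ ψ) (hlam : 2 ≤ lam)
    (hc : c = 10 + ψ * (n₂ * ε) ^ (1 / lam)) (hn : 1 ≤ n₂) (hn₁ : LargeEnough ε δ (δ ^ 2) n₁) :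
    ∫ z in coarseSucceeds ε δ 10 n₁ n₂, (fine ε δ c 10 n₁ n₂ z.1 z.2 - m) ^ 2
      ∂(jointLaw P ε δ c n₁ n₂) ≤
      (jointLaw P ε δ c n₁ n₂).real (coarseSucceeds ε δ 10 n₁ n₂) *
        (1 / n₂ + (17 + 1600 / min 1 κ) * (ψ ^ 2 / (n₂ * ε) ^ (2 - 2 / lam))) +
        32 * (δ ^ (2 - 4 / lam) * (n₁ + n₂ * ε) ^ (2 / lam) * ψ ^ 2) := by
  have hn0 : n₂ ≠ 0 := by omega
  have hn' : (0 : ℝ) < n₂ := Nat.cast_pos.2 hn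
  have hs0 : 0 < n₂ * ε := by positivity
  have hw : 0 < ψ * (n₂ * ε) ^ (1 / lam) := by positivity
  have hc0 : 0 < c := by rw [hc]; positivity
  have hb : 0 < 2 * c / (n₂ * ε) := by positivity
  have hψ0 : 0 < ψ := by linarith
  have h := setIntegral_sq_fine_success_le (δ := δ) (n₁ := n₁) hP hI h1 hIl hl hlam hw hc hε hb hn0
  have hfar := setIntegral_far_le' hε hδ hδ1 hψ0 hI h1 hIl hl hn₁
    (one_le_of_largeEnough hε hδ hδ1 hn₁) hlam
  have hnoise := noise_error_le hκ hs hψ hlam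
  rw [← hc] at hnoise
  rw [bias_error_eq hs0 hψ0 hlam] at h
  have hmono : δ ^ (2 - 4 / lam) * n₁ ^ (2 / lam) * ψ ^ 2 ≤
      δ ^ (2 - 4 / lam) * (n₁ + n₂ * ε) ^ (2 / lam) * ψ ^ 2 := by
    gcongr
    linarith
  refine h.trans (add_le_add (mul_le_mul_of_nonneg_left ?_ measureReal_nonneg) (by linarith))
  linarith

end Error

end UnbiasedDP

/-! ### Assembly of the theorem. -/

theorem mainTheorem5 (κ : ℝ) (hκ : 0 < κ) :
    ∃ C : ℝ, 0 < C ∧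
      (∀ ε δ : ℝ, 0 < ε → ε < 1 → 0 < δ → δ < 1 →
        ∃ n₁ : ℕ, LargeEnough ε δ (δ ^ 2) n₁ ∧
          (n₁ : ℝ) ≤ C * (Real.log (n₁ / (δ ^ 2 * δ)) / ε)) ∧
      ∀ (ε δ ψ lam σ c : ℝ) (n₁ n₂ : ℕ),
        0 < ε → ε < 1 → 0 < δ → δ < 1 → 1 ≤ n₂ → 1 ≤ ψ → 2 ≤ lam →
        σ = 10 → c = σ + ψ * (n₂ * ε) ^ (1 / lam) → LargeEnough ε δ (δ ^ 2) n₁ →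
        IsDP (noiseLaw ε δ c n₂) (fine ε δ c σ n₁ n₂) ε δ ∧
        ∀ (P : Measure ℝ) [IsProbabilityMeasure P] (m : ℝ), IsSymmetricAbout P m →
          Integrable (fun x => (x - m) ^ 2) P → ∫ x, (x - m) ^ 2 ∂P ≤ 1 →
          Integrable (fun x => |x - m| ^ lam) P → ∫ x, |x - m| ^ lam ∂P ≤ ψ ^ lam →
          ∀ (μ : Measure ((Fin (n₁ + n₂) → ℝ) × Noise n₂)) (E : Set ((Fin (n₁ + n₂) → ℝ) × Noise n₂)),
          μ = jointLaw P ε δ c n₁ n₂ → E = coarseSucceeds ε δ σ n₁ n₂ →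
          -- unbiasedness
          (Integrable (fun z => fine ε δ c σ n₁ n₂ z.1 z.2) μ ∧
            ∫ z, fine ε δ c σ n₁ n₂ z.1 z.2 ∂μ = m) ∧
          -- mean squared error
          Integrable (fun z => (fine ε δ c σ n₁ n₂ z.1 z.2 - m) ^ 2) μ ∧
          (κ ≤ n₂ * ε →
            ∫ z, (fine ε δ c σ n₁ n₂ z.1 z.2 - m) ^ 2 ∂μ ≤
              1 / n₂ + C * (ψ ^ 2 / (n₂ * ε) ^ (2 - 2 / lam) + δ * (m ^ 2 / n₂) +
                δ ^ (2 - 4 / lam) * (n₁ + n₂ * ε) ^ (2 / lam) * ψ ^ 2)) ∧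
          -- the coarse step rarely fails
          1 - δ ^ 2 ≤ μ.real E ∧
          -- conditional unbiasedness of both estimates
          (Integrable (fun z => fine ε δ c σ n₁ n₂ z.1 z.2) (cond μ E) ∧
            ∫ z, fine ε δ c σ n₁ n₂ z.1 z.2 ∂(cond μ E) = m) ∧
          (Integrable (fun z => (coarseStep ε δ σ z.1 z.2).getD 0) (cond μ E) ∧
            ∫ z, (coarseStep ε δ σ z.1 z.2).getD 0 ∂(cond μ E) = m) ∧
          -- conditional mean squared error
          Integrable (fun z => (fine ε δ c σ n₁ n₂ z.1 z.2 - m) ^ 2) (cond μ E) ∧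
          (κ ≤ n₂ * ε →
            ∫ z, (fine ε δ c σ n₁ n₂ z.1 z.2 - m) ^ 2 ∂(cond μ E) ≤
              1 / n₂ + C * (ψ ^ 2 / (n₂ * ε) ^ (2 - 2 / lam) +
                δ ^ (2 - 4 / lam) * (n₁ + n₂ * ε) ^ (2 / (lam - 1)) * ψ ^ 2)) := by
  have hk : 0 < min 1 κ := lt_min one_pos hκ
  have hk' : 0 < 1600 / min 1 κ := by positivity
  refine ⟨17 + 1600 / min 1 κ + 129, by positivity, ?_, ?_⟩
  · intro ε δ hε hε1 hδ hδ1
    obtain ⟨n, hn, hle⟩ := exists_largeEnough hε hε1 hδ hδ1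
    refine ⟨n, hn, hle.trans ?_⟩
    have h0 : 0 ≤ Real.log (n / (δ ^ 2 * δ)) / ε := by
      have : (0 : ℝ) ≤ n := Nat.cast_nonneg n
      linarith
    exact mul_le_mul_of_nonneg_right (by linarith) h0
  intro ε δ ψ lam σ c n₁ n₂ hε hε1 hδ hδ1 hn hψ hlam hσ hc hn₁
  subst hσ
  have hn0 : n₂ ≠ 0 := by omega
  have hn' : (0 : ℝ) < n₂ := Nat.cast_pos.2 hn
  have hs0 : 0 < n₂ * ε := by positivity
  have hc0 : 0 < c := by rw [hc]; positivity
  have hb : 0 < 2 * c / (n₂ * ε) := by positivity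
  refine ⟨isDP_fine hε hδ hδ1 hc0 hn0, ?_⟩
  intro P _ m hP hI h1 hIl hl μ E hμ hE
  have hprob : IsProbabilityMeasure μ := hμ ▸ isProbabilityMeasure_jointLaw P hε δ n₁ hb
  have hEm : MeasurableSet E := hE ▸ measurableSet_coarseSucceeds ε δ n₁ n₂
  have hfail := measureReal_compl_successSet_le hε hδ hδ1 hI h1 hn₁
  have hqeq : μ.real E = (centerLaw P ε δ n₁).real Set.univ := by
    rw [hμ, hE, measureReal_coarseSucceeds hε hb]
  have hqadd := real_centerLaw_univ_add P hε δ n₁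
  have hδ2 : δ ^ 2 ≤ 1 := by nlinarith
  -- The bound 1 − δ² would degenerate as δ tends to 1. The sharper failure bound 9δ²/16 keeps the
  -- success probability away from 0, so conditioning costs only a constant.
  have hq : 7 / 16 ≤ μ.real E := by rw [hqeq]; linarith
  have hq1 : μ.real E ≤ 1 := measureReal_le_one
  have hq0 : 0 < μ.real E := by linarith
  have hE0 : μ E ≠ 0 := fun h => by
    rw [measureReal_def, h] at hq0
    simp at hq0
  have hcond : IsProbabilityMeasure (cond μ E) := cond_isProbabilityMeasure hE0
  have hLs : MemLp (fun z => fine ε δ c 10 n₁ n₂ z.1 z.2 - m) 2 (μ.restrict E) := by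
    rw [hμ, hE]
    exact memLp_fine_success hI hε hb hn0 hc0.le
  have hLf : MemLp (fun z => fine ε δ c 10 n₁ n₂ z.1 z.2 - m) 2 (μ.restrict Eᶜ) := by
    rw [hμ, hE]
    exact memLp_fine_failure hI hε hb
  have hLc : MemLp (fun z => (coarseStep ε δ 10 z.1 z.2).getD 0 - m) 2 (μ.restrict E) := by
    rw [hμ, hE]
    exact memLp_center_success hI hε hb
  have hInt : Integrable (fun z => fine ε δ c 10 n₁ n₂ z.1 z.2 - m) μ := by
    have := IntegrableOn.union (hLs.integrable one_le_two) (hLf.integrable one_le_two)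
    rwa [Set.union_compl_self, integrableOn_univ] at this
  have hIntSq : Integrable (fun z => (fine ε δ c 10 n₁ n₂ z.1 z.2 - m) ^ 2) μ := by
    have := IntegrableOn.union hLs.integrable_sq hLf.integrable_sq
    rwa [Set.union_compl_self, integrableOn_univ] at this
  have hshift : ∀ (ν : Measure ((Fin (n₁ + n₂) → ℝ) × Noise n₂)) [IsProbabilityMeasure ν]
      (f : (Fin (n₁ + n₂) → ℝ) × Noise n₂ → ℝ), Integrable (fun z => f z - m) ν →
      ∫ z, (f z - m) ∂ν = 0 → Integrable f ν ∧ ∫ z, f z ∂ν = m := by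
    intro ν _ f hf h0
    have hf' : Integrable f ν :=
      (hf.add (integrable_const m)).congr (Filter.Eventually.of_forall fun z => by simp)
    refine ⟨hf', ?_⟩
    rw [integral_sub hf' (integrable_const m)] at h0
    simp at h0
    linarith
  have hcondI : ∀ f : (Fin (n₁ + n₂) → ℝ) × Noise n₂ → ℝ, Integrable f (μ.restrict E) →
      Integrable f (cond μ E) := fun f hf => hf.smul_measure (ENNReal.inv_ne_top.2 hE0)
  have hcondE : ∀ f : (Fin (n₁ + n₂) → ℝ) × Noise n₂ → ℝ,
      ∫ z, f z ∂(cond μ E) = (μ.real E)⁻¹ * ∫ z in E, f z ∂μ := fun f => by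
    rw [ProbabilityTheory.cond, integral_smul_measure, ENNReal.toReal_inv, smul_eq_mul]
    rfl
  have hm1 : ∫ z in E, (fine ε δ c 10 n₁ n₂ z.1 z.2 - m) ∂μ = 0 := by
    rw [hμ, hE]
    exact setIntegral_fine_success hP hI hε hb hn0 hc0.le
  have hm2 : ∫ z in Eᶜ, (fine ε δ c 10 n₁ n₂ z.1 z.2 - m) ∂μ = 0 := by
    rw [hμ, hE]
    exact setIntegral_fine_failure hP hI hε hδ hδ1 hb hn0
  have hm3 : ∫ z in E, ((coarseStep ε δ 10 z.1 z.2).getD 0 - m) ∂μ = 0 := by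
    rw [hμ, hE]
    exact setIntegral_center_success hP hε hb
  have hV : κ ≤ n₂ * ε → ∫ z in E, (fine ε δ c 10 n₁ n₂ z.1 z.2 - m) ^ 2 ∂μ ≤ μ.real E *
      (1 / n₂ + (17 + 1600 / min 1 κ) * (ψ ^ 2 / (n₂ * ε) ^ (2 - 2 / lam))) +
      32 * (δ ^ (2 - 4 / lam) * (n₁ + n₂ * ε) ^ (2 / lam) * ψ ^ 2) := fun hs => by
    rw [hμ, hE]
    exact setIntegral_sq_fine_success_le' hκ hs hP hI h1 hIl hl hε hδ hδ1 hψ hlam hc hn hn₁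
  have hR1 : 0 ≤ ψ ^ 2 / (n₂ * ε) ^ (2 - 2 / lam) := by positivity
  have hR3 : 0 ≤ δ ^ (2 - 4 / lam) * (n₁ + n₂ * ε) ^ (2 / lam) * ψ ^ 2 := by positivity
  have hn1' : 1 ≤ n₁ := one_le_of_largeEnough hε hδ hδ1 hn₁
  refine ⟨hshift μ _ hInt ?_, hIntSq, fun hs => ?_, ?_, hshift _ _ (hcondI _
    (hLs.integrable one_le_two)) ?_, hshift _ _ (hcondI _ (hLc.integrable one_le_two)) ?_,
    hcondI _ hLs.integrable_sq, fun hs => ?_⟩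
  · rw [← integral_add_compl hEm hInt, hm1, hm2, add_zero]
  · have hF : ∫ z in Eᶜ, (fine ε δ c 10 n₁ n₂ z.1 z.2 - m) ^ 2 ∂μ ≤ δ * (1 + m ^ 2) / n₂ := by
      rw [hμ, hE]
      exact setIntegral_sq_fine_failure_le hP hI h1 hε hδ hδ1 hb hn0 hn₁
    have hD := failure_error_le hε hε1 hδ hδ1 hψ hlam hn1' hn
    have eF : δ * (1 + m ^ 2) / n₂ = δ / n₂ + δ * (m ^ 2 / n₂) := by ring
    have hR2 : 0 ≤ δ * (m ^ 2 / n₂) := by positivity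
    rw [← integral_add_compl hEm hIntSq]
    have hV' := hV hs
    set R1 := ψ ^ 2 / (n₂ * ε) ^ (2 - 2 / lam)
    set R2 := δ * (m ^ 2 / n₂)
    set R3 := δ ^ (2 - 4 / lam) * (n₁ + n₂ * ε) ^ (2 / lam) * ψ ^ 2
    set K := 17 + 1600 / min 1 κ with hK
    have hK0 : 0 ≤ K := by positivity
    have hA : μ.real E * (1 / n₂ + K * R1) ≤ 1 * (1 / n₂ + K * R1) := by gcongr
    have hKR2 : 0 ≤ K * R2 := by positivity
    have hKR3 : 0 ≤ K * R3 := by positivity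
    linarith
  · rw [hqeq]
    nlinarith [sq_nonneg δ]
  · rw [hcondE, hm1, mul_zero]
  · rw [hcondE, hm3, mul_zero]
  · rw [hcondE]
    have hV' := hV hs
    have hR : δ ^ (2 - 4 / lam) * (n₁ + n₂ * ε) ^ (2 / lam) * ψ ^ 2 ≤
        δ ^ (2 - 4 / lam) * (n₁ + n₂ * ε) ^ (2 / (lam - 1)) * ψ ^ 2 := by
      have h2 : (1 : ℝ) ≤ n₁ + n₂ * ε := by
        have : (1 : ℝ) ≤ n₁ := Nat.one_le_cast.2 hn1'
        linarith
      have h3 : 2 / lam ≤ 2 / (lam - 1) :=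
        div_le_div_of_nonneg_left two_pos.le (by linarith) (by linarith)
      gcongr
    set R1 := ψ ^ 2 / (n₂ * ε) ^ (2 - 2 / lam)
    set R3 := δ ^ (2 - 4 / lam) * (n₁ + n₂ * ε) ^ (2 / lam) * ψ ^ 2
    set R3' := δ ^ (2 - 4 / lam) * (n₁ + n₂ * ε) ^ (2 / (lam - 1)) * ψ ^ 2
    set K := 17 + 1600 / min 1 κ with hK
    have hK0 : 0 ≤ K := by positivity
    have hR3' : 0 ≤ R3' := hR3.trans hR
    have hKR3 : 0 ≤ K * R3' := by positivity
    -- The main terms of the bound already carry the factor μ(E), so 1/n₂ keeps coefficient 1. Only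
    -- the far term is really divided by μ(E), and 32 ≤ 129 · 7/16.
    rw [inv_mul_le_iff₀ hq0]
    have h4 : 32 * R3 ≤ μ.real E * (129 * R3') := by nlinarith
    have h5 : 0 ≤ μ.real E * (K * R3' + 129 * R1) := by positivity
    calc _ ≤ _ := hV'
      _ ≤ μ.real E * (1 / n₂ + (K + 129) * (R1 + R3')) := by linarith
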